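/- A \emph{board} is a finite union $\Delta$ of closed unit squares of $\mathbb{R}^2$ with vertices in $\mathbb{Z}^2$ that is homeomorphic to a closed disk. A vertex of $\Delta$ is \emph{interior} if it belongs to four squares of $\Delta$, a \emph{boundary} vertex otherwise, and a \emph{corner} if it belongs to a single square of $\Delta$. A \emph{diagonal} of $\Delta$ is a sequence of vertices $v_0v_1\ldots v_k$, $k>0$, such that $v_0$ is a corner, $v_1,\ldots,v_{k-1}$ are interior and $v_k$ is a boundary vertex; $v_{i-1}$ and $v_i$ are opposite vertices of a square $s_i$ of $\Delta$ ($1\le i\le k$); and $s_i$ and $s_{i+1}$ have a single vertex in common ($1\le i<k$). It is \emph{good} if at least one side of $s_k$ containing $v_k$ lies on the boundary of $\Delta$, and a good diagonal is \emph{balanced} if exactly one does. It is \emph{excellent} if both coordinates $x$ and $y$ are monotonic along one of the two boundary arcs of $\Delta$ between $v_0$ and $v_k$; call the side of the diagonal on which this arc lies the right (the other case being the mirror image). \emph{Cut and paste} along a good diagonal is the following. Let $v^r_{i-1/2}$ and $v^l_{i-1/2}$ be the vertices of $s_i$ to the right and to the left of the diagonal, and let $s^r_i$ (resp. $s^l_i$)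 be the lattice square that shares with $s_i$ the side $v^r_{i-1/2}v_i$ (resp. $v^l_{i-1/2}v_i$). If the diagonal is balanced, $s^l_k$ is required to belong to $\Delta$ (if it is not balanced, $s^l_k$ does not belong to $\Delta$). Let $\Delta^r$ be the part of $\Delta$ beyond the zig-zag $\zeta^r = v^r_{1/2}v_1v^r_{3/2}\ldots v_{k-1}v^r_{k-1/2}$, i.e. the squares of $\Delta$ that can be reached from one of $s^r_1,\ldots,s^r_{k-1}$ through common sides without entering $s_1,\ldots,s_k$. Let $\Delta^l$ consist of the squares of $\Delta$ other than those of $\Delta^r$, the $s_i$ and the $s^l_i$ ($1\le i\le k$). Remove the squares $s_i$ and $s^l_i$, and attach $\Delta^r$ to $\Delta^l$ by the translation by $v^l_{1/2}-v^r_{1/2}$, which identifies $\zeta^r$ with its translate $\zeta^l$. \textbf{Theorem.} Every board $\Delta$ admits an excellent diagonal. Moreover, for every excellent diagonal of $\Delta$ (with the monotonic arc to its right): the diagonal is good and, if it is balanced, the squares $s^l_1,\ldots,s^l_k$ belong to $\Delta$, so that cut and paste along it as above is defined; it can be performed in the plane, i.e. every vertex common to $\Delta^l$ and to the translate of $\Delta^r$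 lies on $\zeta^l$; and the resulting set $\Delta'$ of unit squares is a (possibly empty) disjoint union of boards, any two of which have at most a single vertex in common. -/

import Mathlib

namespace Quad

/-! A unit square of the lattice is given by its lower left corner `c : ℤ × ℤ`; vertices are
points of `ℤ × ℤ`; a set of squares is a `Finset (ℤ × ℤ)` of lower left corners. -/

/-- The closed unit square with lower left corner `c`, as a subset of the plane. -/
def closedSquare (c : ℤ × ℤ) : Set (ℝ × ℝ) :=
  Set.Icc (c.1 : ℝ) (c.1 + 1) ×ˢ Set.Icc (c.2 : ℝ) (c.2 + 1)

/-- The part of the plane covered by a finite set of unit squares. -/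
def region (Δ : Finset (ℤ × ℤ)) : Set (ℝ × ℝ) := ⋃ c ∈ Δ, closedSquare c

/-- A board: finitely many unit squares of the lattice whose union is a closed topological disk. -/
def IsBoard (Δ : Finset (ℤ × ℤ)) : Prop :=
  Nonempty (region Δ ≃ₜ Metric.closedBall (0 : EuclideanSpace ℝ (Fin 2)) 1)

/-- The four vertices of the square `c`. -/
def vertices (c : ℤ × ℤ) : Finset (ℤ × ℤ) := {c, c + (1, 0), c + (1, 1), c + (0, 1)}

/-- All the vertices of a set of squares. -/
def vertexSet (Δ : Finset (ℤ × ℤ)) : Finset (ℤ × ℤ) := Δ.biUnion vertices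

/-- The squares of `Δ` that have `p` as a vertex. -/
def squaresAt (Δ : Finset (ℤ × ℤ)) (p : ℤ × ℤ) : Finset (ℤ × ℤ) :=
  Δ.filter fun c => p ∈ vertices c

/-- `p` is an interior vertex: it belongs to four squares of `Δ`. -/
def IsInteriorVertex (Δ : Finset (ℤ × ℤ)) (p : ℤ × ℤ) : Prop := (squaresAt Δ p).card = 4

/-- `p` is a boundary vertex: a vertex of `Δ` that is not interior. -/
def IsBoundaryVertex (Δ : Finset (ℤ × ℤ)) (p : ℤ × ℤ) : Prop :=
  p ∈ vertexSet Δ ∧ ¬ IsInteriorVertex Δ p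

/-- `p` is a corner: a vertex of a single square of `Δ` (hence on the boundary). -/
def IsCorner (Δ : Finset (ℤ × ℤ)) (p : ℤ × ℤ) : Prop := (squaresAt Δ p).card = 1

/-- `p` and `q` are the endpoints of a unit segment of the lattice. -/
def IsSegment (p q : ℤ × ℤ) : Prop := |q.1 - p.1| + |q.2 - p.2| = 1

/-- The unit segment `pq` lies on the boundary of `Δ`: it is a side of exactly one square. -/
def IsBoundaryEdge (Δ : Finset (ℤ × ℤ)) (p q : ℤ × ℤ) : Prop :=
  IsSegment p q ∧ (Δ.filter fun c => p ∈ vertices c ∧ q ∈ vertices c).card = 1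

/-- Two squares have a common side. -/
def ShareSide (c d : ℤ × ℤ) : Prop := IsSegment c d

/-- `p` and `q` are opposite vertices of a unit square (which is then `squareOn p q`). -/
def AreOpposite (p q : ℤ × ℤ) : Prop := |q.1 - p.1| = 1 ∧ |q.2 - p.2| = 1

/-- The unit square with opposite vertices `p` and `q`. -/
def squareOn (p q : ℤ × ℤ) : ℤ × ℤ := (min p.1 q.1, min p.2 q.2)

/-- The two sides of an oriented diagonal. -/
inductive Side
  | left
  | right

/-- The other side. -/
def Side.opp : Side → Side
  | .left => .right
  | .right => .left

/-- For opposite vertices `p`, `q` of a unit square, the vertex of that square to the right of the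
segment oriented from `p` to `q`. -/
def rightVertex (p q : ℤ × ℤ) : ℤ × ℤ :=
  if 0 < (q.1 - p.1) * (q.2 - p.2) then (q.1, p.2) else (p.1, q.2)

/-- For opposite vertices `p`, `q` of a unit square, the vertex of that square on the side `σ` of
the segment oriented from `p` to `q`. -/
def sideVertex : Side → ℤ × ℤ → ℤ × ℤ → ℤ × ℤ
  | .right, p, q => rightVertex p q
  | .left, p, q => rightVertex q p

/-- A diagonal `v 0, …, v k` of `Δ` (the values `v i` for `i > k` are irrelevant). -/
structure Diagonal (Δ : Finset (ℤ × ℤ)) where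
  /-- the number of squares -/
  k : ℕ
  /-- the vertices -/
  v : ℕ → ℤ × ℤ
  k_pos : 0 < k
  corner : IsCorner Δ (v 0)
  interior : ∀ i, 0 < i → i < k → IsInteriorVertex Δ (v i)
  boundary : IsBoundaryVertex Δ (v k)
  opposite : ∀ i, i < k → AreOpposite (v i) (v (i + 1))
  mem : ∀ i, i < k → squareOn (v i) (v (i + 1)) ∈ Δ
  single : ∀ i, i + 1 < k →
    (vertices (squareOn (v i) (v (i + 1))) ∩
      vertices (squareOn (v (i + 1)) (v (i + 2)))).card = 1

namespace Diagonal

variable {Δ : Finset (ℤ × ℤ)} (δ : Diagonal Δ)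

/-- The squares of the diagonal, numbered from `0` to `k - 1`: `δ.sq i` has the opposite vertices
`v i` and `v (i + 1)`. -/
def sq (i : ℕ) : ℤ × ℤ := squareOn (δ.v i) (δ.v (i + 1))

/-- The vertex of `δ.sq i` on the side `σ` of the diagonal. -/
def mid (σ : Side) (i : ℕ) : ℤ × ℤ := sideVertex σ (δ.v i) (δ.v (i + 1))

/-- The lattice square on the side `σ` of the diagonal that has in common with `δ.sq i` the side
joining `δ.mid σ i` and `v (i + 1)`. It belongs to `Δ` for `i + 1 < k`, and for `i + 1 = k` it
does exactly if that side is not on the boundary. -/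
def flank (σ : Side) (i : ℕ) : ℤ × ℤ := δ.sq i + (δ.mid σ i - δ.v i)

/-- A diagonal is good if at least one side of its last square that contains its last vertex lies
on the boundary. -/
def IsGood : Prop :=
  ∃ u ∈ vertices (δ.sq (δ.k - 1)), IsBoundaryEdge Δ (δ.v δ.k) u

/-- A good diagonal is balanced if exactly one side of its last square that contains its last
vertex lies on the boundary. -/
def IsBalanced : Prop :=
  ∃! u, u ∈ vertices (δ.sq (δ.k - 1)) ∧ IsBoundaryEdge Δ (δ.v δ.k) u

/-- Cut and paste is defined along `δ`, the part of `Δ` on the side `σ` being moved: the diagonal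
is good and, if it is balanced, it has `k` neighbouring squares of `Δ` on the other side. -/
def CanCutPaste (σ : Side) : Prop :=
  δ.IsGood ∧ (δ.IsBalanced → ∀ i, i < δ.k → δ.flank σ.opp i ∈ Δ)

/-- The squares of the diagonal. -/
def squares : Finset (ℤ × ℤ) := (Finset.range δ.k).image δ.sq

/-- The zig-zag `mid 0, v 1, mid 1, …, v (k - 1), mid (k - 1)` along the side `σ` of the diagonal
(its set of vertices). -/
def zigzag (σ : Side) : Finset (ℤ × ℤ) :=
  (Finset.range δ.k).image (δ.mid σ) ∪ (Finset.Ioo 0 δ.k).image δ.v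

open Classical in
/-- The part of `Δ` beyond the zig-zag on the side `σ`: the squares of `Δ` that are connected
through common sides, without entering the diagonal, to one of the `k - 1` neighbours of the
diagonal on the side `σ`. -/
noncomputable def movedPart (σ : Side) : Finset (ℤ × ℤ) :=
  (Δ \ δ.squares).filter fun c =>
    ∃ i, i + 1 < δ.k ∧
      Relation.ReflTransGen (fun a b => b ∈ Δ \ δ.squares ∧ ShareSide a b) (δ.flank σ i) c

/-- What remains of `Δ` after the removal of the diagonal, of its neighbours on the side opposite
to `σ`, and of the part to be moved. -/
noncomputable def fixedPart (σ : Side) : Finset (ℤ × ℤ) :=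
  ((Δ \ δ.squares) \ (Finset.range δ.k).image (δ.flank σ.opp)) \ δ.movedPart σ

/-- The translation that identifies the zig-zag on the side `σ` of the diagonal with the zig-zag
beyond the removed squares on the other side. -/
def shift (σ : Side) : ℤ × ℤ := δ.mid σ.opp 0 - δ.mid σ 0

/-- The result of cut and paste along `δ` as a set of lattice squares, the part on the side `σ`
being moved. -/
noncomputable def cutPaste (σ : Side) : Finset (ℤ × ℤ) :=
  δ.fixedPart σ ∪ (δ.movedPart σ).image (· + δ.shift σ)

/-- In the plane, the fixed part and the translated part meet only along the zig-zag where they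
are glued; no other squares, sides or vertices are superimposed. -/
def GluesInPlane (σ : Side) : Prop :=
  vertexSet (δ.fixedPart σ) ∩ (vertexSet (δ.movedPart σ)).image (· + δ.shift σ) ⊆
    (δ.zigzag σ).image (· + δ.shift σ)

/-- `u 0, …, u n` are the successive vertices of the boundary arc from the first to the last
vertex of the diagonal that lies on the side `σ`: a simple path of boundary segments that starts
with the side of the first square on the side `σ`. -/
def IsBoundaryArc (σ : Side) (n : ℕ) (u : ℕ → ℤ × ℤ) : Prop :=
  0 < n ∧ u 0 = δ.v 0 ∧ u 1 = δ.mid σ 0 ∧ u n = δ.v δ.k ∧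
    Set.InjOn u (Set.Iic n) ∧ ∀ j, j < n → IsBoundaryEdge Δ (u j) (u (j + 1))

/-- Both coordinates are monotonic along the boundary arc on the side `σ` of the diagonal. -/
def IsExcellentOn (σ : Side) : Prop :=
  ∃ (n : ℕ) (u : ℕ → ℤ × ℤ), δ.IsBoundaryArc σ n u ∧
    (MonotoneOn (fun j => (u j).1) (Set.Iic n) ∨ AntitoneOn (fun j => (u j).1) (Set.Iic n)) ∧
    (MonotoneOn (fun j => (u j).2) (Set.Iic n) ∨ AntitoneOn (fun j => (u j).2) (Set.Iic n))

/-- A diagonal is excellent if both coordinates are monotonic along one of the two boundary arcs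
between its endpoints. -/
def IsExcellent : Prop := ∃ σ, δ.IsExcellentOn σ

end Diagonal

/-- `P` is a (possibly empty) disjoint union of boards, any two of which have at most a single
vertex in common. (As boards are connected through common sides, these boards are determined by
`P`.) -/
def IsUnionOfBoards (P : Finset (ℤ × ℤ)) : Prop :=
  ∃ F : Finset (Finset (ℤ × ℤ)), (∀ B ∈ F, IsBoard B) ∧
    (∀ A ∈ F, ∀ B ∈ F, A ≠ B → (vertexSet A ∩ vertexSet B).card ≤ 1) ∧
    F.biUnion id = P

end Quad

/-! Topology is traded for combinatorics: a finite set of squares is a board exactly when it is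
nonempty, connected through sides and without holes (`IsSimple`). For `IsBoard.isSimple`, a disk
stays connected after deletion of the countably many lattice points, and away from these two squares
that meet have a common side; if a square outside the board could not escape to infinity, the
position relative to its centre would have a continuous logarithm on the board, and counting branch
jumps around the hole refutes this. For `IsSimple.isBoard`, squares are deleted one at a time
(`exists_removable`), each deletion being a radial homeomorphism, until one square is left.

All separation arguments of Jordan type use winding numbers of integer flows between adjacent
squares. They change across a side by the flow through it and vanish at the vertices of squares
outside a set without holes that carries the flow. This gives `no_pinch`, the bound on common
vertices (`vertex_unique_of_escapes`) and the fact that a diagonal separates its two sides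
(`IsStdDiagonal.disjoint`).

Cut and paste: in standard position the diagonal has the vertices (i, i) and the monotonic arc is a
staircase below it. The squares between diagonal and staircase all belong to Δ, and their translates
by (-1, 1) again lie in Δ. Comparing what is removed with what is filled again, the result is Δ
without a ribbon, the squares whose lower right corner is a vertex of the staircase other than its
start (`Diagonal.IsStd.mem_cutPaste`). The ribbon is a path of adjacent squares that starts beside a
square outside Δ, so its deletion creates no hole, even for a union of components of what is left.
Hence the components are boards, and two of them share at most one vertex.

Existence is a descent on the number of squares to the right of a diagonal. If rows and columns lead
inside Δ from all of these squares back to the rest, the boundary there is a staircase. Otherwise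
some maximal row or column segment on that side yields an acute corner, from which a parallel
diagonal starts; it stays on the right of the old one and has a smaller side, to which the induction
applies. -/

namespace Quad

/-! ### Connectivity of sets of squares through common sides -/

theorem shareSide_iff {c d : ℤ × ℤ} : ShareSide c d ↔
    (d.1 = c.1 + 1 ∧ d.2 = c.2) ∨ (d.1 = c.1 - 1 ∧ d.2 = c.2) ∨
      (d.1 = c.1 ∧ d.2 = c.2 + 1) ∨ (d.1 = c.1 ∧ d.2 = c.2 - 1) := by
  unfold ShareSide IsSegment
  rcases abs_cases (d.1 - c.1) with h | h <;> rcases abs_cases (d.2 - c.2) with h' | h' <;> omega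

theorem ShareSide.symm {c d : ℤ × ℤ} (h : ShareSide c d) : ShareSide d c := by
  rw [shareSide_iff] at *; omega

theorem mem_vertices {c p : ℤ × ℤ} :
    p ∈ vertices c ↔ (p.1 = c.1 ∨ p.1 = c.1 + 1) ∧ (p.2 = c.2 ∨ p.2 = c.2 + 1) := by
  obtain ⟨a, b⟩ := c
  obtain ⟨x, y⟩ := p
  simp only [vertices, Finset.mem_insert, Finset.mem_singleton, Prod.mk_add_mk, Prod.mk.injEq]
  omega

/-- `b` can be reached from `a` by steps through common sides, every step ending in `P`. -/
def Reach (P : Set (ℤ × ℤ)) (a b : ℤ × ℤ) : Prop :=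
  Relation.ReflTransGen (fun x y => y ∈ P ∧ ShareSide x y) a b

namespace Reach

variable {P Q : Set (ℤ × ℤ)} {a b c : ℤ × ℤ}

theorem refl (P : Set (ℤ × ℤ)) (a : ℤ × ℤ) : Reach P a a := Relation.ReflTransGen.refl

theorem trans (h : Reach P a b) (h' : Reach P b c) : Reach P a c := Relation.ReflTransGen.trans h h'

theorem tail (h : Reach P a b) (hc : c ∈ P) (hs : ShareSide b c) : Reach P a c :=
  Relation.ReflTransGen.tail h ⟨hc, hs⟩

theorem single (hc : b ∈ P) (hs : ShareSide a b) : Reach P a b := (refl P a).tail hc hs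

/-- `Reach` constrains only the targets of the steps, so the start has to be placed in `P`
separately; the same holds for `symm`. -/
theorem mem (h : Reach P a b) (ha : a ∈ P) : b ∈ P := by
  induction h with
  | refl => exact ha
  | tail _ h _ => exact h.1

theorem mono (h : Reach P a b) (hPQ : P ⊆ Q) : Reach Q a b :=
  by
  induction h with
  | refl => exact refl _ _
  | tail _ h ih => exact ih.tail (hPQ h.1) h.2

theorem symm (h : Reach P a b) (ha : a ∈ P) : Reach P b a := by
  induction h with
  | refl => exact refl _ _
  | tail hab hbc ih => exact (single (Reach.mem (P := P) hab ha) hbc.2.symm).trans ih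

/-- A set of squares containing `a` that cannot be left inside `P` contains what can be reached. -/
theorem invariant (h : Reach P a b) {R : Set (ℤ × ℤ)} (ha : a ∈ R)
    (hR : ∀ x ∈ R, ∀ y ∈ P, ShareSide x y → y ∈ R) : b ∈ R := by
  induction h with
  | refl => exact ha
  | tail _ hbc ih => exact hR _ ih _ hbc.1 hbc.2

theorem restrict (h : Reach P a b) {R : Set (ℤ × ℤ)} (ha : a ∈ R)
    (hR : ∀ x ∈ R, ∀ y ∈ P, ShareSide x y → y ∈ R) : Reach (P ∩ R) a b := by
  induction h with
  | refl => exact refl _ _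
  | tail hab hbc ih => exact ih.tail ⟨hbc.1, hR _ (Reach.invariant (P := P) hab ha hR) _ hbc.1 hbc.2⟩ hbc.2

/-- A path that ends outside `R` or stays in `R`. -/
theorem first_exit (h : Reach P a b) {R : Set (ℤ × ℤ)} (ha : a ∈ R) (hb : b ∉ R) :
    ∃ x y, Reach (P ∩ R) a x ∧ x ∈ R ∧ y ∈ P ∧ y ∉ R ∧ ShareSide x y := by
  by_contra hcon
  push Not at hcon
  have key : Reach (P ∩ R) a b ∧ b ∈ R := by
    clear hb
    induction h with
    | refl => exact ⟨refl _ _, ha⟩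
    | @tail x y hab hbc ih =>
      by_cases hy : y ∈ R
      · exact ⟨ih.1.tail ⟨hbc.1, hy⟩ hbc.2, hy⟩
      · exact absurd hbc.2 (hcon x y ih.1 ih.2 hbc.1 hy)
  exact hb key.2

end Reach

/-- Straight-line connection along a row. -/
theorem reach_row {P : Set (ℤ × ℤ)} (y x : ℤ) (n : ℕ) (h : ∀ i : ℤ, 0 < i → i ≤ n → (x + i, y) ∈ P) :
    Reach P (x, y) (x + n, y) := by
  induction n with
  | zero => simpa using Reach.refl P (x, y)
  | succ n ih =>
    refine (ih fun i h0 h1 => h i h0 (by push_cast; omega)).tail (by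
      simpa using h (n + 1) (by omega) (by push_cast; omega)) ?_
    rw [shareSide_iff]; push_cast; left; constructor <;> ring

theorem reach_col {P : Set (ℤ × ℤ)} (x y : ℤ) (n : ℕ) (h : ∀ i : ℤ, 0 < i → i ≤ n → (x, y + i) ∈ P) :
    Reach P (x, y) (x, y + n) := by
  induction n with
  | zero => simpa using Reach.refl P (x, y)
  | succ n ih =>
    refine (ih fun i h0 h1 => h i h0 (by push_cast; omega)).tail (by
      simpa using h (n + 1) (by omega) (by push_cast; omega)) ?_
    rw [shareSide_iff]; push_cast; right; right; left; constructor <;> ring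

/-- Squares of a horizontal segment contained in `P` are connected in `P`. -/
theorem reach_row_of_between {P : Set (ℤ × ℤ)} {y x x' : ℤ}
    (h : ∀ i, min x x' ≤ i → i ≤ max x x' → (i, y) ∈ P) : Reach P (x, y) (x', y) := by
  rcases le_total x x' with hx | hx
  · obtain ⟨n, rfl⟩ := Int.le.dest hx
    exact reach_row y x n fun i h0 h1 => h _ (by omega) (by omega)
  · obtain ⟨n, rfl⟩ := Int.le.dest hx
    exact (reach_row y x' n fun i h0 h1 => h _ (by omega) (by omega)).symm (h _ (by omega) (by omega))

theorem reach_col_of_between {P : Set (ℤ × ℤ)} {x y y' : ℤ}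
    (h : ∀ i, min y y' ≤ i → i ≤ max y y' → (x, i) ∈ P) : Reach P (x, y) (x, y') := by
  rcases le_total y y' with hx | hx
  · obtain ⟨n, rfl⟩ := Int.le.dest hx
    exact reach_col x y n fun i h0 h1 => h _ (by omega) (by omega)
  · obtain ⟨n, rfl⟩ := Int.le.dest hx
    exact (reach_col x y' n fun i h0 h1 => h _ (by omega) (by omega)).symm (h _ (by omega) (by omega))

/-- Any two squares of `P` are connected in `P`. -/
def IsConn (P : Set (ℤ × ℤ)) : Prop := ∀ a ∈ P, ∀ b ∈ P, Reach P a b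

/-- From every square outside `P` one can leave every finite set without entering `P`. -/
def Escapes (P : Set (ℤ × ℤ)) : Prop :=
  ∀ c ∉ P, ∀ F : Finset (ℤ × ℤ), ∃ d ∉ F, Reach Pᶜ c d

/-- The combinatorial counterpart of a board: a nonempty finite set of squares, connected through
common sides and without holes. -/
structure IsSimple (D : Finset (ℤ × ℤ)) : Prop where
  nonempty : D.Nonempty
  conn : IsConn (D : Set (ℤ × ℤ))
  escapes : Escapes (D : Set (ℤ × ℤ))

/-- Absence of holes passes to a smaller set: escape routes outside `P` also avoid `Q`, so only the
deleted squares need a way out of `P`. -/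
theorem Escapes.of_reach {P Q : Set (ℤ × ℤ)} (hP : Escapes P) (hQP : Q ⊆ P)
    (h : ∀ c ∈ P, c ∉ Q → ∃ d ∉ P, Reach Qᶜ c d) : Escapes Q := by
  intro c hc F
  have hsub : Pᶜ ⊆ Qᶜ := Set.compl_subset_compl.2 hQP
  by_cases hcP : c ∈ P
  · obtain ⟨d, hd, hcd⟩ := h c hcP hc
    obtain ⟨e, he, hde⟩ := hP d hd F
    exact ⟨e, he, hcd.trans (hde.mono hsub)⟩
  · obtain ⟨e, he, hde⟩ := hP c hcP F
    exact ⟨e, he, hde.mono hsub⟩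

theorem isConn_of_reach {P : Set (ℤ × ℤ)} (a : ℤ × ℤ) (ha : a ∈ P) (h : ∀ b ∈ P, Reach P a b) :
    IsConn P := fun b hb c hc => ((h b hb).symm ha).trans (h c hc)

end Quad

namespace Quad

/-! ### Flows and winding numbers -/

/-- A unit flow of steps between squares of `P` with a common side, from `a` to `b`: `m s t` is the
net number of steps from `s` to `t`. -/
structure IsFlow (P : Set (ℤ × ℤ)) (m : ℤ × ℤ → ℤ × ℤ → ℤ) (a b : ℤ × ℤ) : Prop where
  antisymm : ∀ s t, m s t = - m t s
  mem : ∀ s t, m s t ≠ 0 → s ∈ P ∧ t ∈ P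
  div : ∀ x y : ℤ, m (x, y) (x + 1, y) + m (x, y) (x - 1, y) + m (x, y) (x, y + 1) +
    m (x, y) (x, y - 1) = (if (x, y) = a then 1 else 0) - (if (x, y) = b then 1 else 0)

/-- The flow consisting of a single step. -/
def stepFlow (a b s t : ℤ × ℤ) : ℤ :=
  (if s = a ∧ t = b then 1 else 0) - (if s = b ∧ t = a then 1 else 0)

theorem stepFlow_isFlow {a b : ℤ × ℤ} (h : ShareSide a b) : IsFlow {a, b} (stepFlow a b) a b where
  antisymm s t := by unfold stepFlow; simp only [and_comm]; ring
  mem s t hst := by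
    unfold stepFlow at hst
    by_contra hcon
    apply hst
    have h1 : ¬ (s = a ∧ t = b) := fun h => hcon (by simp [h.1, h.2])
    have h2 : ¬ (s = b ∧ t = a) := fun h => hcon (by simp [h.1, h.2])
    simp [h1, h2]
  div x y := by
    have hne : a ≠ b := by
      rintro rfl
      rw [shareSide_iff] at h
      omega
    by_cases h1 : (x, y) = a
    · have h0 : ∀ t, stepFlow a b (x, y) t = if t = b then 1 else 0 := fun t => by
        simp [stepFlow, h1, hne]
      rw [if_pos h1, if_neg (h1 ▸ hne)]
      simp only [h0]
      subst h1
      obtain ⟨b1, b2⟩ := b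
      rw [shareSide_iff] at h
      simp only [Prod.mk.injEq] at h ⊢
      split_ifs <;> omega
    · by_cases h2 : (x, y) = b
      · have h0 : ∀ t, stepFlow a b (x, y) t = - if t = a then 1 else 0 := fun t => by
          simp [stepFlow, h2, hne.symm]
        rw [if_neg h1, if_pos h2]
        simp only [h0]
        subst h2
        obtain ⟨a1, a2⟩ := a
        rw [shareSide_iff] at h
        simp only [Prod.mk.injEq] at h ⊢
        split_ifs <;> omega
      · simp [stepFlow, h1, h2]

theorem IsFlow.mono {P Q : Set (ℤ × ℤ)} {m : ℤ × ℤ → ℤ × ℤ → ℤ} {a b : ℤ × ℤ} (h : IsFlow P m a b)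
    (hPQ : P ⊆ Q) : IsFlow Q m a b :=
  ⟨h.antisymm, fun s t hst => ⟨hPQ (h.mem s t hst).1, hPQ (h.mem s t hst).2⟩, h.div⟩

/-- Concatenation of paths becomes addition: the sink of one flow cancels the source of the next.
Repeated squares are harmless, so paths need not be simple. -/
theorem IsFlow.add {P Q : Set (ℤ × ℤ)} {m m' : ℤ × ℤ → ℤ × ℤ → ℤ} {a b c : ℤ × ℤ}
    (h : IsFlow P m a b) (h' : IsFlow Q m' b c) :
    IsFlow (P ∪ Q) (fun s t => m s t + m' s t) a c where
  antisymm s t := by have := h.antisymm s t; have := h'.antisymm s t; omega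
  mem s t hst := by
    by_cases h0 : m s t = 0
    · have := h'.mem s t (by intro h1; apply hst; omega)
      exact ⟨Or.inr this.1, Or.inr this.2⟩
    · exact ⟨Or.inl (h.mem s t h0).1, Or.inl (h.mem s t h0).2⟩
  div x y := by have := h.div x y; have := h'.div x y; omega

theorem zeroFlow_isFlow (P : Set (ℤ × ℤ)) (a : ℤ × ℤ) : IsFlow P (fun _ _ => 0) a a where
  antisymm _ _ := rfl
  mem _ _ h := absurd rfl h
  div _ _ := by simp

theorem Reach.exists_flow {P : Set (ℤ × ℤ)} {a b : ℤ × ℤ} (h : Reach P a b) (ha : a ∈ P) :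
    ∃ m, IsFlow P m a b := by
  induction h with
  | refl => exact ⟨_, zeroFlow_isFlow P a⟩
  | @tail x y hab hbc ih =>
    obtain ⟨m, hm⟩ := ih
    refine ⟨_, (hm.add (stepFlow_isFlow hbc.2)).mono ?_⟩
    have hx : x ∈ P := Reach.mem (P := P) hab ha
    rintro z (hz | rfl | rfl)
    exacts [hz, hx, hbc.1]

theorem exists_box {P : Set (ℤ × ℤ)} (hP : P.Finite) :
    ∃ B : ℤ, 0 < B ∧ ∀ c ∈ P, -B < c.1 ∧ c.1 < B ∧ -B < c.2 ∧ c.2 < B := by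
  refine ⟨∑ c ∈ hP.toFinset, (|c.1| + |c.2|) + 1, ?_, fun c hc => ?_⟩
  · have : 0 ≤ ∑ c ∈ hP.toFinset, (|c.1| + |c.2|) := Finset.sum_nonneg fun c _ => by positivity
    omega
  · have := Finset.single_le_sum (f := fun c : ℤ × ℤ => |c.1| + |c.2|)
      (fun c _ => by positivity) (hP.mem_toFinset.2 hc)
    have h1 := abs_nonneg c.1
    have h2 := abs_nonneg c.2
    have h3 := neg_abs_le c.1
    have h4 := neg_abs_le c.2
    have h5 := le_abs_self c.1
    have h6 := le_abs_self c.2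
    omega

/-- The winding numbers of a closed flow around the vertices of the lattice. -/
structure IsWinding (m : ℤ × ℤ → ℤ × ℤ → ℤ) (w : ℤ × ℤ → ℤ) : Prop where
  fst : ∀ x y : ℤ, w (x, y) - w (x + 1, y) = m (x, y - 1) (x, y)
  snd : ∀ x y : ℤ, w (x, y + 1) - w (x, y) = m (x - 1, y) (x, y)
  finite : ∃ F : Finset (ℤ × ℤ), ∀ p ∉ F, w p = 0

/-- A discrete Poincaré lemma: a flow without divergence is the coboundary of a function on the
vertices, and this function has finite support because the flow does. -/
theorem IsFlow.exists_winding {P : Set (ℤ × ℤ)} {m : ℤ × ℤ → ℤ × ℤ → ℤ} {a : ℤ × ℤ}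
    (h : IsFlow P m a a) (hP : P.Finite) : ∃ w, IsWinding m w := by
  obtain ⟨B, hB0, hB⟩ := exists_box hP
  have hz : ∀ s t : ℤ × ℤ, (s.1 ≤ -B ∨ B ≤ s.1 ∨ s.2 ≤ -B ∨ B ≤ s.2) → m s t = 0 := by
    intro s t hs
    by_contra hne
    have := hB s (h.mem s t hne).1
    omega
  have hz' : ∀ s t : ℤ × ℤ, (t.1 ≤ -B ∨ B ≤ t.1 ∨ t.2 ≤ -B ∨ B ≤ t.2) → m s t = 0 := by
    intro s t hs
    rw [h.antisymm, hz t s hs, neg_zero]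
  -- The total upward flow across the horizontal ray from `p` to the right, cut off beyond the box.
  -- Horizontal differences telescope by definition, vertical ones by vanishing divergence.
  let w : ℤ × ℤ → ℤ := fun p =>
    ∑ i ∈ Finset.range (B + 1 - p.1).toNat, m (p.1 + i, p.2 - 1) (p.1 + i, p.2)
  have hfst : ∀ x y : ℤ, w (x, y) - w (x + 1, y) = m (x, y - 1) (x, y) := by
    intro x y
    rcases le_or_gt (B + 1) x with hx | hx
    · have h1 : (B + 1 - x).toNat = 0 := by omega
      have h2 : (B + 1 - (x + 1)).toNat = 0 := by omega
      simp only [w, h1, h2, Finset.range_zero, Finset.sum_empty]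
      rw [hz _ _ (by simp only; omega)]; rfl
    · obtain ⟨n, hn⟩ : ∃ n : ℕ, (B + 1 - x).toNat = n + 1 := ⟨(B - x).toNat, by omega⟩
      have h2 : (B + 1 - (x + 1)).toNat = n := by omega
      simp only [w, hn, h2]
      rw [Finset.sum_range_succ']
      have : ∀ i : ℕ, x + ((i + 1 : ℕ) : ℤ) = x + 1 + i := fun i => by push_cast; ring
      simp only [this]
      simp
  have hsnd : ∀ x y : ℤ, w (x, y + 1) - w (x, y) = m (x - 1, y) (x, y) := by
    intro x y
    simp only [w]
    rw [← Finset.sum_sub_distrib]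
    have key : ∀ i ∈ Finset.range (B + 1 - x).toNat,
        m (x + i, y + 1 - 1) (x + i, y + 1) - m (x + i, y - 1) (x + i, y) =
          m (x + i - 1, y) (x + i, y) - m (x + (i + 1 : ℕ) - 1, y) (x + (i + 1 : ℕ), y) := by
      intro i _
      have hd := h.div (x + i) y
      have e1 : y + 1 - 1 = y := by ring
      have e2 : x + ((i + 1 : ℕ) : ℤ) - 1 = x + i := by push_cast; ring
      have e3 : x + ((i + 1 : ℕ) : ℤ) = x + i + 1 := by push_cast; ring
      rw [e1, e2, e3]
      have h1 := h.antisymm (x + i, y) (x + i - 1, y)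
      have h2 := h.antisymm (x + i, y) (x + i, y - 1)
      simp only [sub_self] at hd
      omega
    rw [Finset.sum_congr rfl key, Finset.sum_range_sub'
      (fun i : ℕ => m (x + i - 1, y) (x + i, y))]
    have : m (x + ((B + 1 - x).toNat : ℤ) - 1, y) (x + ((B + 1 - x).toNat : ℤ), y) = 0 :=
      hz' _ _ (by simp only; omega)
    simp only [Nat.cast_zero, add_zero]
    rw [this, sub_zero]
  have hrow : ∀ x y : ℤ, (y ≤ -B ∨ B ≤ y) → w (x, y) = 0 := by
    intro x y hy
    exact Finset.sum_eq_zero fun i _ => hz' _ _ (by simp only; omega)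
  refine ⟨w, hfst, hsnd, Finset.Icc (-B) (B + 1) ×ˢ Finset.Icc (-B) B, fun p hp => ?_⟩
  obtain ⟨x, y⟩ := p
  simp only [Finset.mem_product, Finset.mem_Icc] at hp
  by_cases hy : y ≤ -B ∨ B ≤ y
  · exact hrow x y hy
  rcases le_or_gt (B + 1) x with hx | hx
  · have h1 : (B + 1 - x).toNat = 0 := by omega
    simp only [w, h1, Finset.range_zero, Finset.sum_empty]
  -- To the left of the box no flow crosses the column, so `w` can be carried up to a row where it
  -- vanishes.
  · have hcol : ∀ n : ℕ, w (x, y + n) = w (x, y) := by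
      intro n
      induction n with
      | zero => simp
      | succ n ih =>
        have := hsnd x (y + n)
        rw [hz _ _ (by simp only; omega)] at this
        push_cast
        rw [← add_assoc]
        omega
    rw [← hcol (B - y).toNat]
    exact hrow _ _ (by omega)

/-- The winding numbers around the endpoints of a side differ by the flow through it. -/
theorem IsWinding.side {m : ℤ × ℤ → ℤ × ℤ → ℤ} {w : ℤ × ℤ → ℤ} (hw : IsWinding m w)
    (hm : ∀ s t, m s t = - m t s) {s t p q : ℤ × ℤ} (hst : ShareSide s t) (hpq : p ≠ q)
    (hps : p ∈ vertices s) (hpt : p ∈ vertices t) (hqs : q ∈ vertices s) (hqt : q ∈ vertices t) :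
    w p - w q = m s t ∨ w q - w p = m s t := by
  obtain ⟨a, b⟩ := s
  obtain ⟨a', b'⟩ := t
  obtain ⟨x, y⟩ := p
  obtain ⟨x', y'⟩ := q
  rw [mem_vertices] at *
  rw [shareSide_iff] at hst
  simp only [ne_eq, Prod.mk.injEq] at *
  rcases hst with ⟨rfl, rfl⟩ | ⟨rfl, rfl⟩ | ⟨rfl, rfl⟩ | ⟨rfl, rfl⟩
  · have h := hw.snd (a + 1) b'
    rw [add_sub_cancel_right] at h
    obtain ⟨rfl, rfl⟩ : x = a + 1 ∧ x' = a + 1 := by omega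
    rcases (show (y = b' ∧ y' = b' + 1) ∨ (y = b' + 1 ∧ y' = b') by omega) with
      ⟨rfl, rfl⟩ | ⟨rfl, rfl⟩ <;> omega
  · have h := hw.snd a b'
    rw [hm] at h
    obtain ⟨rfl, rfl⟩ : x = a ∧ x' = a := by omega
    rcases (show (y = b' ∧ y' = b' + 1) ∨ (y = b' + 1 ∧ y' = b') by omega) with
      ⟨rfl, rfl⟩ | ⟨rfl, rfl⟩ <;> omega
  · have h := hw.fst a' (b + 1)
    rw [add_sub_cancel_right] at h
    obtain ⟨rfl, rfl⟩ : y = b + 1 ∧ y' = b + 1 := by omega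
    rcases (show (x = a' ∧ x' = a' + 1) ∨ (x = a' + 1 ∧ x' = a') by omega) with
      ⟨rfl, rfl⟩ | ⟨rfl, rfl⟩ <;> omega
  · have h := hw.fst a' b
    rw [hm] at h
    obtain ⟨rfl, rfl⟩ : y = b ∧ y' = b := by omega
    rcases (show (x = a' ∧ x' = a' + 1) ∨ (x = a' + 1 ∧ x' = a') by omega) with
      ⟨rfl, rfl⟩ | ⟨rfl, rfl⟩ <;> omega

/-- Reflection in the vertical line through `p` sends the square with abscissa `e.1` to the one with
abscissa `2 * p.1 - 1 - e.1`, and likewise for ordinates; a neighbour of `e` at `p` is one of the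
two mirror images. -/
theorem side_at {e y p : ℤ × ℤ} (h : ShareSide e y) (he : p ∈ vertices e) (hy : p ∈ vertices y) :
    y = (2 * p.1 - 1 - e.1, e.2) ∨ y = (e.1, 2 * p.2 - 1 - e.2) := by
  rw [mem_vertices] at *
  rw [shareSide_iff] at *
  simp only [Prod.ext_iff]
  omega

theorem eq_or_eq_of_side_at {e c c' y p : ℤ × ℤ} (hcc : c ≠ c') (hec : ShareSide e c)
    (hec' : ShareSide e c') (hpc : p ∈ vertices c) (hpc' : p ∈ vertices c') (hpe : p ∈ vertices e)
    (hy : ShareSide e y) (hpy : p ∈ vertices y) : y = c ∨ y = c' := by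
  rcases side_at hec hpe hpc with h | h <;> rcases side_at hec' hpe hpc' with h' | h' <;>
    rcases side_at hy hpe hpy with h'' | h'' <;> simp_all

theorem opposite_at {c c' p : ℤ × ℤ} (hpc : p ∈ vertices c) (hpc' : p ∈ vertices c')
    (h : ¬ ShareSide c c') (h' : c ≠ c') :
    c' = (2 * p.1 - 1 - c.1, 2 * p.2 - 1 - c.2) := by
  rw [shareSide_iff] at *
  simp only [mem_vertices, ne_eq, Prod.ext_iff] at *
  grind

theorem side_of_opposite_at {c c' e p : ℤ × ℤ} (hpc : p ∈ vertices c)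
    (h : c' = (2 * p.1 - 1 - c.1, 2 * p.2 - 1 - c.2)) (hpe : p ∈ vertices e) (h1 : e ≠ c)
    (h2 : e ≠ c') : ShareSide e c ∧ ShareSide e c' := by
  subst h
  simp only [shareSide_iff, mem_vertices, ne_eq, Prod.ext_iff] at *
  grind
theorem eq_of_mem_side {s t p q v : ℤ × ℤ} (hst : ShareSide s t) (hpq : p ≠ q)
    (hps : p ∈ vertices s) (hpt : p ∈ vertices t) (hqs : q ∈ vertices s) (hqt : q ∈ vertices t)
    (hvs : v ∈ vertices s) (hvt : v ∈ vertices t) : v = p ∨ v = q := by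
  rw [mem_vertices] at *
  rw [shareSide_iff] at hst
  simp only [ne_eq, Prod.ext_iff] at *
  grind

/-- The flow through `z` uses only sides that end at `ex z`; every other side carries none, so its
ends have equal winding numbers. -/
theorem IsWinding.side_eq {P : Set (ℤ × ℤ)} {m : ℤ × ℤ → ℤ × ℤ → ℤ}
    {w : ℤ × ℤ → ℤ} (hw : IsWinding m w) (hm : ∀ s t, m s t = - m t s)
    {ex : ℤ × ℤ → ℤ × ℤ}
    (hflow : ∀ z ∉ P, ∀ y, m z y ≠ 0 → ex z ∈ vertices z ∧ ex z ∈ vertices y)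
    {z y v v' : ℤ × ℤ} (hz : z ∉ P) (hzy : ShareSide z y) (h1 : v ∈ vertices z)
    (h2 : v ∈ vertices y) (h3 : v' ∈ vertices z) (h4 : v' ∈ vertices y) (hv : v ≠ ex z)
    (hv' : v' ≠ ex z) : w v = w v' := by
  by_cases hvv : v = v'
  · rw [hvv]
  by_cases h0 : m z y = 0
  · rcases hw.side hm hzy hvv h1 h2 h3 h4 with h | h <;> omega
  · obtain ⟨h5, h6⟩ := hflow z hz y h0
    rcases eq_of_mem_side hzy hvv h1 h2 h3 h4 h5 h6 with h | h
    exacts [absurd h.symm hv, absurd h.symm hv']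

/-- Opposite vertices are compared by going round `z` on the side that avoids the exceptional
vertex. -/
theorem IsWinding.square_eq {P : Set (ℤ × ℤ)} {m : ℤ × ℤ → ℤ × ℤ → ℤ}
    {w : ℤ × ℤ → ℤ} (hw : IsWinding m w) (hm : ∀ s t, m s t = - m t s)
    {ex : ℤ × ℤ → ℤ × ℤ}
    (hflow : ∀ z ∉ P, ∀ y, m z y ≠ 0 → ex z ∈ vertices z ∧ ex z ∈ vertices y)
    {z v v' : ℤ × ℤ} (hz : z ∉ P) (h1 : v ∈ vertices z) (h3 : v' ∈ vertices z) (hv : v ≠ ex z)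
    (hv' : v' ≠ ex z) : w v = w v' := by
  have key : ∀ v v', v ∈ vertices z → v' ∈ vertices z → (v.1 = v'.1 ∨ v.2 = v'.2) → v ≠ ex z →
      v' ≠ ex z → w v = w v' := by
    intro v v' h1 h3 hvv hv hv'
    rw [mem_vertices] at h1 h3
    rcases hvv with h | h
    · refine hw.side_eq hm hflow (y := (2 * v.1 - z.1 - 1, z.2)) hz ?_ ?_ ?_ ?_ ?_ hv hv' <;>
        simp only [mem_vertices, shareSide_iff] <;> grind
    · refine hw.side_eq hm hflow (y := (z.1, 2 * v.2 - z.2 - 1)) hz ?_ ?_ ?_ ?_ ?_ hv hv' <;>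
        simp only [mem_vertices, shareSide_iff] <;> grind
  by_cases hvv : v.1 = v'.1 ∨ v.2 = v'.2
  · exact key v v' h1 h3 hvv hv hv'
  by_cases h : (v.1, v'.2) = ex z
  · have h' : (v'.1, v.2) ≠ ex z := by
      rw [← h]; intro h'; simp only [Prod.mk.injEq] at h'; omega
    have hmem : (v'.1, v.2) ∈ vertices z := by
      rw [mem_vertices] at *; exact ⟨h3.1, h1.2⟩
    exact (key _ _ h1 hmem (Or.inr rfl) hv h').trans (key _ _ hmem h3 (Or.inl rfl) h' hv')
  · have hmem : (v.1, v'.2) ∈ vertices z := by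
      rw [mem_vertices] at *; exact ⟨h1.1, h3.2⟩
    exact (key _ _ h1 hmem (Or.inl rfl) hv h).trans (key _ _ hmem h3 (Or.inr rfl) h hv')

/-- Winding numbers around the vertices of squares outside `P`, when the flow enters such a square
`z` only around one exceptional vertex `ex z`. -/
theorem IsWinding.eq_zero_of_exceptions {P : Set (ℤ × ℤ)} {m : ℤ × ℤ → ℤ × ℤ → ℤ}
    {w : ℤ × ℤ → ℤ} (hw : IsWinding m w) (hm : ∀ s t, m s t = - m t s) (hP : Escapes P)
    {ex : ℤ × ℤ → ℤ × ℤ}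
    (hflow : ∀ z ∉ P, ∀ y, m z y ≠ 0 → ex z ∈ vertices z ∧ ex z ∈ vertices y)
    (hex : ∀ z ∉ P, ∀ y, ShareSide z y → ex z ∈ vertices z → ex z ∈ vertices y → y ∈ P)
    {z v : ℤ × ℤ} (hz : z ∉ P) (hv : v ∈ vertices z) (hve : v ≠ ex z) : w v = 0 := by
  -- Neither end of a side between two squares outside `P` is exceptional, since `hex` would put one
  -- of them into `P`; so the common value passes from square to square.
  have hstep : ∀ x ∈ Pᶜ, ∀ y ∈ Pᶜ, ShareSide x y →
      ∃ v, v ∈ vertices x ∧ v ∈ vertices y ∧ v ≠ ex x ∧ v ≠ ex y := by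
    intro x hx y hy hxy
    have h := hxy
    rw [shareSide_iff] at h
    refine ⟨(max x.1 y.1, max x.2 y.2), ?_, ?_, ?_, ?_⟩
    · rw [mem_vertices]; simp only; omega
    · rw [mem_vertices]; simp only; omega
    · intro h'
      refine hy (hex x hx y hxy ?_ ?_) <;> rw [← h', mem_vertices] <;> simp only <;> omega
    · intro h'
      refine hx (hex y hy x hxy.symm ?_ ?_) <;> rw [← h', mem_vertices] <;> simp only <;> omega
  obtain ⟨F, hF⟩ := hw.finite
  -- The final square is chosen so that both its lower vertices lie outside the support of `w`; at
  -- least one of them is not exceptional.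
  obtain ⟨d, hdF, hd⟩ := hP z hz
    (F ∪ (F.image (· - (1, 0))))
  have hconst : ∀ v' ∈ vertices d, v' ≠ ex d → w v = w v' := by
    clear hdF
    induction hd with
    | refl => exact fun v' hv' hne => hw.square_eq hm hflow hz hv hv' hve hne
    | @tail x y hx hxy ih =>
      have hxP : x ∈ Pᶜ := Reach.mem (P := Pᶜ) hx hz
      obtain ⟨u, hux, huy, hu1, hu2⟩ := hstep x hxP y hxy.1 hxy.2
      intro v' hv' hne
      exact (ih u hux hu1).trans (hw.square_eq hm hflow hxy.1 huy hv' hu2 hne)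
  have h1 : d ∈ vertices d := by rw [mem_vertices]; omega
  have h2 : (d + (1, 0) : ℤ × ℤ) ∈ vertices d := by rw [mem_vertices]; simp
  by_cases hd1 : d = ex d
  · rw [hconst _ h2 (by rw [← hd1]; simp)]
    refine hF _ fun h => hdF ?_
    exact Finset.mem_union_right _ (Finset.mem_image.2 ⟨_, h, by simp⟩)
  · rw [hconst _ h1 hd1]
    exact hF _ fun h => hdF (Finset.mem_union_left _ h)

/-- The case without exceptions: `(z.1 + 2, z.2)` is a dummy value that is never a vertex of `z`. -/
theorem IsWinding.eq_zero {P : Set (ℤ × ℤ)} {m : ℤ × ℤ → ℤ × ℤ → ℤ}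
    {w : ℤ × ℤ → ℤ} {a : ℤ × ℤ} (hw : IsWinding m w) (hm : IsFlow P m a a) (hP : Escapes P)
    {z v : ℤ × ℤ} (hz : z ∉ P) (hv : v ∈ vertices z) : w v = 0 := by
  have hn : ∀ x : ℤ × ℤ, ((x.1 + 2, x.2) : ℤ × ℤ) ∉ vertices x := fun x h => by
    rw [mem_vertices] at h; simp only at h; omega
  refine hw.eq_zero_of_exceptions hm.antisymm hP (ex := fun z => (z.1 + 2, z.2))
    (fun z hz y hne => absurd (hm.mem z y hne).1 hz) (fun z _ y _ h => absurd h (hn z)) hz hv ?_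
  rintro rfl
  exact hn z hv

/-- In a finite set of squares without holes the squares `c` and `c'`, opposite at a vertex `p`
whose other squares `e` and `f` are missing, are not connected. -/
theorem not_reach_of_pinch {P : Set (ℤ × ℤ)} (hfin : P.Finite) (hP : Escapes P)
    {c c' e f p : ℤ × ℤ} (hc : c ∈ P) (he : e ∉ P) (hf : f ∉ P) (hcc : c ≠ c')
    (hef : e ≠ f) (hec : ShareSide e c) (hec' : ShareSide e c') (hpc : p ∈ vertices c)
    (hpc' : p ∈ vertices c') (hpe : p ∈ vertices e) (hpf : p ∈ vertices f) : ¬ Reach P c c' := by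
  intro hreach
  have hc' : c' ∈ P := hreach.mem hc
  obtain ⟨m, hm⟩ := hreach.exists_flow hc
  -- The path from `c` to `c'` is closed through `e`, which it crosses only around `p`. The other
  -- end `p'` of the side between `e` and `c` has winding number 0 because of `e`, and `p` has
  -- because of `f`; but one unit flows through that side.
  have hM := (hm.add (stepFlow_isFlow hec'.symm)).add (stepFlow_isFlow hec)
  obtain ⟨w, hw⟩ := hM.exists_winding
    (((hfin.union ((Set.finite_singleton _).insert _))).union ((Set.finite_singleton _).insert _))
  classical
  let ex : ℤ × ℤ → ℤ × ℤ := fun z => if z = e then p else (z.1 + 2, z.2)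
  have hn : ∀ x : ℤ × ℤ, ((x.1 + 2, x.2) : ℤ × ℤ) ∉ vertices x := fun x h => by
    rw [mem_vertices] at h; simp only at h; omega
  have hnbr : ∀ y, ShareSide e y → p ∈ vertices y → y = c ∨ y = c' := fun y =>
    eq_or_eq_of_side_at hcc hec hec' hpc hpc' hpe
  have hflow : ∀ z ∉ P, ∀ y, m z y + stepFlow c' e z y + stepFlow e c z y ≠ 0 →
      ex z ∈ vertices z ∧ ex z ∈ vertices y := by
    intro z hz y hne
    have h0 : m z y = 0 := by by_contra h; exact hz (hm.mem z y h).1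
    have h1 : z ≠ c := fun h => hz (h ▸ hc)
    have h2 : z ≠ c' := fun h => hz (h ▸ hc')
    simp only [h0, stepFlow, h1, h2, false_and, if_false] at hne
    by_cases hze : z = e
    · subst hze
      have : y = c ∨ y = c' := by
        by_contra hcon
        push Not at hcon
        simp [hcon.1, hcon.2] at hne
      simp only [ex, if_true]
      rcases this with rfl | rfl
      exacts [⟨hpe, hpc⟩, ⟨hpe, hpc'⟩]
    · simp [hze] at hne
  have hex : ∀ z ∉ P, ∀ y, ShareSide z y → ex z ∈ vertices z → ex z ∈ vertices y → y ∈ P := by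
    intro z hz y hzy h1 h2
    by_cases hze : z = e
    · subst hze
      simp only [ex, if_true] at h2
      rcases hnbr y hzy h2 with rfl | rfl
      exacts [hc, hc']
    · simp only [ex, if_neg hze] at h1
      exact absurd h1 (hn z)
  have hwp : w p = 0 := by
    refine hw.eq_zero_of_exceptions hM.antisymm hP hflow hex hf hpf ?_
    simp only [ex, if_neg hef.symm]
    rintro h
    exact hn f (h ▸ hpf)
  obtain ⟨p', hp', hpe', hpc1⟩ : ∃ p', p' ≠ p ∧ p' ∈ vertices e ∧ p' ∈ vertices c := by
    have h := hec
    rw [shareSide_iff] at h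
    clear * - h hpe hpc
    rcases h with h | h | h | h
    · exact ⟨(c.1, 2 * e.2 + 1 - p.2), by simp only [mem_vertices, ne_eq, Prod.ext_iff] at *; grind⟩
    · exact ⟨(e.1, 2 * e.2 + 1 - p.2), by simp only [mem_vertices, ne_eq, Prod.ext_iff] at *; grind⟩
    · exact ⟨(2 * e.1 + 1 - p.1, c.2), by simp only [mem_vertices, ne_eq, Prod.ext_iff] at *; grind⟩
    · exact ⟨(2 * e.1 + 1 - p.1, e.2), by simp only [mem_vertices, ne_eq, Prod.ext_iff] at *; grind⟩
  have hwp' : w p' = 0 := by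
    refine hw.eq_zero_of_exceptions hM.antisymm hP hflow hex he hpe' ?_
    simpa only [ex, if_true] using hp'
  have hval : m e c + stepFlow c' e e c + stepFlow e c e c = 1 := by
    have h0 : m e c = 0 := by by_contra h; exact he (hm.mem e c h).1
    have h1 : e ≠ c := fun h => he (h ▸ hc)
    have h2 : e ≠ c' := fun h => he (h ▸ hc')
    simp [h0, stepFlow, h1, h2, hcc]
  rcases hw.side hM.antisymm hec hp' hpe' hpc1 hpe hpc with h | h <;> omega

/-- Two disjoint connected sets of squares without common sides, whose union has no holes, have at
most one vertex in common. -/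
theorem vertex_unique_of_escapes {C C' : Set (ℤ × ℤ)} (hfin : C.Finite) (hfin' : C'.Finite)
    (hC : IsConn C) (hC' : IsConn C') (hdisj : ∀ x ∈ C, x ∉ C')
    (hadj : ∀ x ∈ C, ∀ y ∈ C', ¬ ShareSide x y) (hP : Escapes (C ∪ C')) {c c' d d' p q : ℤ × ℤ}
    (hc : c ∈ C) (hc' : c' ∈ C') (hd : d ∈ C) (hd' : d' ∈ C') (hpc : p ∈ vertices c)
    (hpc' : p ∈ vertices c') (hqd : q ∈ vertices d) (hqd' : q ∈ vertices d') : p = q := by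
  by_contra hpq
  -- squares of the two sets with a common vertex are opposite at this vertex
  have hopp : ∀ c ∈ C, ∀ c' ∈ C', ∀ p, p ∈ vertices c → p ∈ vertices c' →
      c' = (2 * p.1 - 1 - c.1, 2 * p.2 - 1 - c.2) := fun c hc c' hc' p h h' =>
    opposite_at h h' (hadj c hc c' hc') fun h => hdisj c hc (h ▸ hc')
  have hmid : ∀ c ∈ C, ∀ c' ∈ C', ∀ p, p ∈ vertices c → p ∈ vertices c' → ∀ e, p ∈ vertices e →
      e ≠ c → e ≠ c' → ShareSide e c ∧ ShareSide e c' ∧ e ∉ C ∪ C' := by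
    intro c hc c' hc' p h h' e he h1 h2
    have hs := side_of_opposite_at h (hopp c hc c' hc' p h h') he h1 h2
    refine ⟨hs.1, hs.2, ?_⟩
    rintro (h | h)
    exacts [hadj e h c' hc' hs.2, hadj c hc e h hs.1.symm]
  have hother : ∀ c ∈ C, ∀ c' ∈ C', ∀ p, p ∈ vertices c → p ∈ vertices c' → ∃ e f,
      e ≠ f ∧ p ∈ vertices e ∧ p ∈ vertices f ∧ e ≠ c ∧ e ≠ c' ∧ f ≠ c ∧ f ≠ c' := by
    intro c hc c' hc' p h h'
    have h3 := hopp c hc c' hc' p h h'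
    refine ⟨(c.1, c'.2), (c'.1, c.2), ?_⟩
    subst h3
    clear * - h
    simp only [mem_vertices, ne_eq, Prod.ext_iff] at *
    grind
  obtain ⟨e, f, hef, hpe, hpf, hec, hec', hfc, hfc'⟩ := hother c hc c' hc' p hpc hpc'
  -- Two missing squares are available at `q`; one different from `e` is needed so that each missing
  -- square on the cycle has a single exceptional vertex.
  obtain ⟨g, hge, hqg, hgd, hgd'⟩ : ∃ g, g ≠ e ∧ q ∈ vertices g ∧ g ≠ d ∧ g ≠ d' := by
    obtain ⟨g, h, hgh, hqg, hqh, h1, h2, h3, h4⟩ := hother d hd d' hd' q hqd hqd'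
    by_cases hge : g = e
    · exact ⟨h, fun h' => hgh (hge.trans h'.symm), hqh, h3, h4⟩
    · exact ⟨g, hge, hqg, h1, h2⟩
  obtain ⟨sec, sec', heP⟩ := hmid c hc c' hc' p hpc hpc' e hpe hec hec'
  obtain ⟨-, -, hfP⟩ := hmid c hc c' hc' p hpc hpc' f hpf hfc hfc'
  obtain ⟨sgd, sgd', hgP⟩ := hmid d hd d' hd' q hqd hqd' g hqg hgd hgd'
  obtain ⟨m, hm⟩ := (hC c hc d hd).exists_flow hc
  obtain ⟨m', hm'⟩ := (hC' d' hd' c' hc').exists_flow hd'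
  -- A cycle from `c` to `d` in `C`, across `g` to `d'`, back to `c'` in `C'` and across `e` to `c`.
  -- The contradiction arises on the side between `e` and `c` as for a pinched vertex; if `f = g`,
  -- its exceptional vertex is `q`, and `p ≠ q` is what is used.
  have hM := ((((hm.add (stepFlow_isFlow sgd.symm)).add (stepFlow_isFlow sgd')).add hm').add
    (stepFlow_isFlow sec'.symm)).add (stepFlow_isFlow sec)
  have hpair : ∀ x y : ℤ × ℤ, ({x, y} : Set (ℤ × ℤ)).Finite := fun x y =>
    (Set.finite_singleton _).insert _
  obtain ⟨w, hw⟩ := hM.exists_winding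
    (((((hfin.union (hpair _ _)).union (hpair _ _)).union hfin').union (hpair _ _)).union
      (hpair _ _))
  classical
  let ex : ℤ × ℤ → ℤ × ℤ := fun z => if z = e then p else if z = g then q else (z.1 + 2, z.2)
  have hn : ∀ x : ℤ × ℤ, ((x.1 + 2, x.2) : ℤ × ℤ) ∉ vertices x := fun x h => by
    rw [mem_vertices] at h; simp only at h; omega
  have hnbr : ∀ c ∈ C, ∀ c' ∈ C', ∀ p, p ∈ vertices c → p ∈ vertices c' → ∀ e, p ∈ vertices e →
      e ≠ c → e ≠ c' → ∀ y, ShareSide e y → p ∈ vertices y → y = c ∨ y = c' := by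
    intro c hc c' hc' p h h' e he h1 h2 y hy hpy
    have hs := side_of_opposite_at h (hopp c hc c' hc' p h h') he h1 h2
    exact eq_or_eq_of_side_at (fun h => hdisj c hc (h ▸ hc')) hs.1 hs.2 h h' he hy hpy
  have hzero : ∀ z ∉ C ∪ C', ∀ y, m z y = 0 ∧ m' z y = 0 := by
    intro z hz y
    constructor <;> by_contra h
    exacts [hz (Or.inl (hm.mem z y h).1), hz (Or.inr (hm'.mem z y h).1)]
  have hne : ∀ z ∉ C ∪ C', z ≠ c ∧ z ≠ c' ∧ z ≠ d ∧ z ≠ d' := by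
    intro z hz
    refine ⟨?_, ?_, ?_, ?_⟩ <;> rintro rfl
    exacts [hz (Or.inl hc), hz (Or.inr hc'), hz (Or.inl hd), hz (Or.inr hd')]
  have hflow : ∀ z ∉ C ∪ C', ∀ y, m z y + stepFlow d g z y + stepFlow g d' z y + m' z y +
      stepFlow c' e z y + stepFlow e c z y ≠ 0 → ex z ∈ vertices z ∧ ex z ∈ vertices y := by
    intro z hz y hne0
    obtain ⟨h1, h2, h3, h4⟩ := hne z hz
    simp only [hzero z hz y, stepFlow, h1, h2, h3, h4, false_and, if_false] at hne0
    by_cases hze : z = e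
    · subst hze
      have : y = c ∨ y = c' := by
        by_contra hcon
        push Not at hcon
        simp [hcon.1, hcon.2, hge.symm] at hne0
      simp only [ex, if_true]
      rcases this with rfl | rfl
      exacts [⟨hpe, hpc⟩, ⟨hpe, hpc'⟩]
    · by_cases hzg : z = g
      · subst hzg
        have : y = d ∨ y = d' := by
          by_contra hcon
          push Not at hcon
          simp [hcon.1, hcon.2, hge] at hne0
        simp only [ex, if_neg hze, if_true]
        rcases this with rfl | rfl
        exacts [⟨hqg, hqd⟩, ⟨hqg, hqd'⟩]
      · simp [hze, hzg] at hne0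
  have hex : ∀ z ∉ C ∪ C', ∀ y, ShareSide z y → ex z ∈ vertices z → ex z ∈ vertices y →
      y ∈ C ∪ C' := by
    intro z hz y hzy h1 h2
    by_cases hze : z = e
    · subst hze
      simp only [ex, if_true] at h2
      rcases hnbr c hc c' hc' p hpc hpc' _ hpe hec hec' y hzy h2 with rfl | rfl
      exacts [Or.inl hc, Or.inr hc']
    · by_cases hzg : z = g
      · subst hzg
        simp only [ex, if_neg hze, if_true] at h2
        rcases hnbr d hd d' hd' q hqd hqd' _ hqg hgd hgd' y hzy h2 with rfl | rfl
        exacts [Or.inl hd, Or.inr hd']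
      · simp only [ex, if_neg hze, if_neg hzg] at h1
        exact absurd h1 (hn z)
  have hwp : w p = 0 := by
    refine hw.eq_zero_of_exceptions hM.antisymm hP hflow hex hfP hpf ?_
    simp only [ex, if_neg hef.symm]
    split_ifs
    · exact hpq
    · rintro h
      exact hn f (h ▸ hpf)
  obtain ⟨p', hp', hpe', hpc1⟩ : ∃ p', p' ≠ p ∧ p' ∈ vertices e ∧ p' ∈ vertices c := by
    have h := sec
    rw [shareSide_iff] at h
    clear * - h hpe hpc
    rcases h with h | h | h | h
    · exact ⟨(c.1, 2 * e.2 + 1 - p.2), by simp only [mem_vertices, ne_eq, Prod.ext_iff] at *; grind⟩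
    · exact ⟨(e.1, 2 * e.2 + 1 - p.2), by simp only [mem_vertices, ne_eq, Prod.ext_iff] at *; grind⟩
    · exact ⟨(2 * e.1 + 1 - p.1, c.2), by simp only [mem_vertices, ne_eq, Prod.ext_iff] at *; grind⟩
    · exact ⟨(2 * e.1 + 1 - p.1, e.2), by simp only [mem_vertices, ne_eq, Prod.ext_iff] at *; grind⟩
  have hwp' : w p' = 0 := by
    refine hw.eq_zero_of_exceptions hM.antisymm hP hflow hex heP hpe' ?_
    simpa only [ex, if_true] using hp'
  have hval : m e c + stepFlow d g e c + stepFlow g d' e c + m' e c + stepFlow c' e e c +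
      stepFlow e c e c = 1 := by
    obtain ⟨h1, h2, h3, h4⟩ := hne e heP
    have h5 : c ≠ c' := fun h => hdisj c hc (h ▸ hc')
    simp [hzero e heP c, stepFlow, h1, h2, h3, h4, h5, hge.symm]
  rcases hw.side hM.antisymm sec hp' hpe' hpc1 hpe hpc with h | h <;> omega

/-- A connected finite set of squares without holes has no pinched vertex. -/
theorem no_pinch {P : Set (ℤ × ℤ)} (hfin : P.Finite) (hconn : IsConn P) (hP : Escapes P) (x y : ℤ) :
    ((x, y) ∈ P → (x + 1, y + 1) ∈ P → (x + 1, y) ∈ P ∨ (x, y + 1) ∈ P) ∧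
      ((x + 1, y) ∈ P → (x, y + 1) ∈ P → (x, y) ∈ P ∨ (x + 1, y + 1) ∈ P) := by
  constructor <;> intro h1 h2 <;> by_contra hcon <;> push Not at hcon <;>
    refine not_reach_of_pinch hfin hP (p := (x + 1, y + 1)) h1 hcon.1 hcon.2 ?_ ?_ ?_ ?_ ?_ ?_ ?_ ?_
      (hconn _ h1 _ h2) <;>
    simp only [mem_vertices, shareSide_iff, ne_eq, Prod.mk.injEq] <;> grind

theorem IsSimple.no_pinch {D : Finset (ℤ × ℤ)} (h : IsSimple D) (x y : ℤ) :
    ((x, y) ∈ D → (x + 1, y + 1) ∈ D → (x + 1, y) ∈ D ∨ (x, y + 1) ∈ D) ∧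
      ((x + 1, y) ∈ D → (x, y + 1) ∈ D → (x, y) ∈ D ∨ (x + 1, y + 1) ∈ D) := by
  simpa using Quad.no_pinch D.finite_toSet h.conn h.escapes x y

end Quad

namespace Quad

/-! ### Shelling -/

/-- From a square outside `Q` one leaves `D` by walking in the direction `t`, provided this walk
does not enter `Q`. -/
theorem exists_reach_of_walk {D : Finset (ℤ × ℤ)} {Q : Set (ℤ × ℤ)} {t : ℤ × ℤ}
    (ht : ShareSide 0 t) (hstep : ∀ z ∈ D, z ∉ Q → z + t ∈ D → z + t ∉ Q) (hQ : Q ⊆ D)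
    {z : ℤ × ℤ} (hz : z ∉ Q) : ∃ d ∉ D, Reach Qᶜ z d := by
  obtain ⟨B, hB0, hB⟩ := exists_box D.finite_toSet
  have ht' : ∀ z, ShareSide z (z + t) := fun z => by
    rw [shareSide_iff] at *
    simp only [Prod.fst_zero, Prod.snd_zero, Prod.fst_add, Prod.snd_add] at *
    omega
  -- The inner product with `t` grows by one at each step and is bounded on `D` by the box, so the
  -- walk leaves `D`.
  have key : ∀ n : ℕ, ∀ z ∉ Q, 2 * B - (t.1 * z.1 + t.2 * z.2) ≤ n → ∃ d ∉ D, Reach Qᶜ z d := by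
    intro n
    induction n with
    | zero =>
      intro z hz hn
      refine ⟨z, fun hzD => ?_, Reach.refl _ _⟩
      have := hB z hzD
      rw [shareSide_iff] at ht
      simp only [Prod.fst_zero, Prod.snd_zero] at ht
      rcases ht with ⟨h1, h2⟩ | ⟨h1, h2⟩ | ⟨h1, h2⟩ | ⟨h1, h2⟩ <;> rw [h1, h2] at hn <;>
        push_cast at hn <;> omega
    | succ n ih =>
      intro z hz hn
      by_cases hzD : z ∈ D
      · have hzt : z + t ∉ Q := by
          by_cases h : z + t ∈ D
          · exact hstep z hzD hz h
          · exact fun h' => h (hQ h')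
        obtain ⟨d, hd, hr⟩ := ih (z + t) hzt (by
          rw [shareSide_iff] at ht
          simp only [Prod.fst_zero, Prod.snd_zero, Prod.fst_add, Prod.snd_add] at *
          rcases ht with ⟨h1, h2⟩ | ⟨h1, h2⟩ | ⟨h1, h2⟩ | ⟨h1, h2⟩ <;> rw [h1, h2] at hn ⊢ <;>
            push_cast at hn ⊢ <;> omega)
        exact ⟨d, hd, (Reach.single hzt (ht' z)).trans hr⟩
      · exact ⟨z, hzD, Reach.refl _ _⟩
  exact key (2 * B - (t.1 * z.1 + t.2 * z.2)).toNat z hz (Int.self_le_toNat _)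

/-- Removing a square whose neighbours remain connected does not disconnect. -/
theorem IsConn.erase {D : Finset (ℤ × ℤ)} (hD : IsConn (D : Set (ℤ × ℤ))) {x : ℤ × ℤ}
    (h : ∀ s ∈ D, ∀ t ∈ D, ShareSide x s → ShareSide x t →
      Reach (D.erase x : Finset (ℤ × ℤ)) s t) :
    IsConn (D.erase x : Finset (ℤ × ℤ)) := by
  intro a ha b hb
  simp only [Finset.coe_erase, Set.mem_sdiff, Finset.mem_coe, Set.mem_singleton_iff] at ha hb
  have key : ∀ z, Reach D a z → (z ≠ x → Reach (D.erase x : Finset (ℤ × ℤ)) a z) ∧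
      (z = x → ∃ s ∈ D, ShareSide x s ∧ Reach (D.erase x : Finset (ℤ × ℤ)) a s) := by
    intro z hz
    induction hz with
    | refl => exact ⟨fun _ => Reach.refl _ _, fun h => absurd h ha.2⟩
    | @tail y z hy hyz ih =>
      have hyD : y ∈ D := Reach.mem (P := (D : Set (ℤ × ℤ))) hy ha.1
      constructor
      · intro hzx
        by_cases hyx : y = x
        · obtain ⟨s, hs, hxs, hr⟩ := ih.2 hyx
          exact hr.trans (h s hs z hyz.1 hxs (hyx ▸ hyz.2))
        · exact (ih.1 hyx).tail (by simpa using ⟨hyz.1, hzx⟩) hyz.2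
      · rintro rfl
        have hyx : y ≠ z := by
          rintro rfl
          have := hyz.2
          rw [shareSide_iff] at this
          omega
        exact ⟨y, hyD, hyz.2.symm, ih.1 hyx⟩
  exact (key b (hD a ha.1 b hb.1)).1 hb.2

theorem IsSimple.erase {D : Finset (ℤ × ℤ)} (hD : IsSimple D) {x y : ℤ × ℤ}
    (hne : (D.erase x).Nonempty) (hconn : IsConn (D.erase x : Finset (ℤ × ℤ)))
    (hxy : ShareSide x y) (hy : y ∉ D) : IsSimple (D.erase x) := by
  refine ⟨hne, hconn, hD.escapes.of_reach (by simp) fun c hc hcx => ?_⟩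
  have : c = x := by
    by_contra h
    exact hcx (by simpa using ⟨hc, h⟩)
  subst this
  exact ⟨y, hy, Reach.single (by simp [hy]) hxy⟩

/-- Squares that can be removed from a board by a deformation: they have a single neighbour, or two
adjacent neighbours that are completed to a block of four squares. Only the positions that occur
in the shelling are considered. -/
def Removable (D : Finset (ℤ × ℤ)) (x : ℤ × ℤ) : Prop :=
  (∃ β : ℤ, (β = 1 ∨ β = -1) ∧ (x.1, x.2 + β) ∈ D ∧ (x.1, x.2 - β) ∉ D ∧ (x.1 + 1, x.2) ∉ D ∧
    (x.1 - 1, x.2) ∉ D ∧ (x.1 + 1, x.2 - β) ∉ D ∧ (x.1 - 1, x.2 - β) ∉ D) ∨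
  (∃ α : ℤ, (α = 1 ∨ α = -1) ∧ (x.1 + α, x.2) ∈ D ∧ (x.1 - α, x.2) ∉ D ∧ (x.1, x.2 + 1) ∉ D ∧
    (x.1, x.2 - 1) ∉ D ∧ (x.1 - α, x.2 + 1) ∉ D ∧ (x.1 - α, x.2 - 1) ∉ D) ∨
  ∃ α : ℤ, (α = 1 ∨ α = -1) ∧ (x.1 + α, x.2) ∈ D ∧ (x.1, x.2 - 1) ∈ D ∧ (x.1 + α, x.2 - 1) ∈ D ∧
    (x.1 - α, x.2) ∉ D ∧ (x.1, x.2 + 1) ∉ D ∧ (x.1 - α, x.2 + 1) ∉ D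

theorem Removable.exists_free {D : Finset (ℤ × ℤ)} {x : ℤ × ℤ} (h : Removable D x) :
    ∃ y ∉ D, ShareSide x y := by
  rcases h with ⟨β, hβ, -, h, -⟩ | ⟨α, hα, -, h, -⟩ | ⟨α, hα, -, -, -, h, -⟩ <;>
    refine ⟨_, h, ?_⟩ <;> rw [shareSide_iff] <;> grind

/-- A removable square of a smaller set remains removable in `D` if no new square blocks it. -/
theorem Removable.of_subset {D E : Finset (ℤ × ℤ)} {x : ℤ × ℤ} (h : Removable E x) (hED : E ⊆ D)
    (hnew : ∀ i j : ℤ, (i, j) ∈ D → (i, j) ∉ E → x.1 - 1 ≤ i → i ≤ x.1 + 1 → x.2 - 1 ≤ j →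
      j ≤ x.2 + 1 → i ≠ x.1 ∧ j ≠ x.2 ∧ ((x.1, j) ∈ E ∨ (i, x.2) ∈ E)) : Removable D x := by
  have key : ∀ i j : ℤ, (i, j) ∉ E → x.1 - 1 ≤ i → i ≤ x.1 + 1 → x.2 - 1 ≤ j → j ≤ x.2 + 1 →
      ((x.1, j) ∉ E ∧ (i, x.2) ∉ E ∨ i = x.1 ∨ j = x.2) → (i, j) ∉ D := by
    intro i j h0 h1 h2 h3 h4 h5 h6
    have := hnew i j h6 h0 h1 h2 h3 h4
    tauto
  rcases h with ⟨β, hβ, h1, h2, h3, h4, h5, h6⟩ | ⟨α, hα, h1, h2, h3, h4, h5, h6⟩ |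
    ⟨α, hα, h1, h2, h3, h4, h5, h6⟩
  · refine Or.inl ⟨β, hβ, hED h1, key _ _ h2 ?_ ?_ ?_ ?_ ?_, key _ _ h3 ?_ ?_ ?_ ?_ ?_,
      key _ _ h4 ?_ ?_ ?_ ?_ ?_, key _ _ h5 ?_ ?_ ?_ ?_ (Or.inl ⟨h2, h3⟩),
      key _ _ h6 ?_ ?_ ?_ ?_ (Or.inl ⟨h2, h4⟩)⟩ <;> clear * - hβ <;> grind
  · refine Or.inr (Or.inl ⟨α, hα, hED h1, key _ _ h2 ?_ ?_ ?_ ?_ ?_, key _ _ h3 ?_ ?_ ?_ ?_ ?_,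
      key _ _ h4 ?_ ?_ ?_ ?_ ?_, key _ _ h5 ?_ ?_ ?_ ?_ (Or.inl ⟨h3, h2⟩),
      key _ _ h6 ?_ ?_ ?_ ?_ (Or.inl ⟨h4, h2⟩)⟩) <;> clear * - hα <;> grind
  · refine Or.inr (Or.inr ⟨α, hα, hED h1, hED h2, hED h3, key _ _ h4 ?_ ?_ ?_ ?_ ?_,
      key _ _ h5 ?_ ?_ ?_ ?_ ?_, key _ _ h6 ?_ ?_ ?_ ?_ (Or.inl ⟨h5, h4⟩)⟩) <;> clear * - hα <;> grind

/-- Gluing: if removing `c` separates `A` from the rest, a square that can be removed from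
`A ∪ {c}` can be removed from `D`. -/
theorem removable_of_part {D A : Finset (ℤ × ℤ)} (hD : IsSimple D) {c x : ℤ × ℤ} (hc : c ∈ D)
    (hcA : c ∉ A) (hAD : A ⊆ D) (hxA : x ∈ A)
    (hclosed : ∀ s ∈ A, ∀ t ∈ D, ShareSide s t → t = c ∨ t ∈ A)
    (hB : ∀ s ∈ D, s ∉ A → Reach (D \ A : Finset (ℤ × ℤ)) c s)
    (hx : Removable (insert c A) x) (hE : IsSimple ((insert c A).erase x)) :
    Removable D x ∧ IsSimple (D.erase x) := by
  have hxc : c ≠ x := fun h => hcA (h ▸ hxA)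
  have hclosed' : ∀ s ∈ D, s ∉ A → s ≠ c → ∀ t ∈ A, ¬ ShareSide s t := by
    intro s hs hsA hsc t ht hst
    rcases hclosed t ht s hs hst.symm with h | h
    exacts [hsc h, hsA h]
  have hrem : Removable D x := by
    refine hx.of_subset (Finset.insert_subset hc hAD) ?_
    intro i j hyD hyE h1 h2 h3 h4
    simp only [Finset.mem_insert, not_or] at hyE
    have hns := hclosed' _ hyD hyE.2 hyE.1 x hxA
    have hne : (i, j) ≠ x := fun h => hyE.2 (h ▸ hxA)
    have hij : i ≠ x.1 ∧ j ≠ x.2 := by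
      rw [shareSide_iff] at hns
      simp only [ne_eq, Prod.ext_iff] at hns hne
      omega
    refine ⟨hij.1, hij.2, ?_⟩
    have hxD : x ∈ D := hAD hxA
    have hpin : (x.1, j) ∈ D ∨ (i, x.2) ∈ D := by
      obtain ⟨x1, x2⟩ := x
      simp only at *
      rcases (show i = x1 + 1 ∨ x1 = i + 1 by omega) with rfl | rfl <;>
        rcases (show j = x2 + 1 ∨ x2 = j + 1 by omega) with rfl | rfl
      · have := (hD.no_pinch x1 x2).1 hxD hyD; tauto
      · have := (hD.no_pinch x1 j).2 hyD hxD; tauto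
      · have := (hD.no_pinch i x2).2 hxD hyD; tauto
      · have := (hD.no_pinch i j).1 hyD hxD; tauto
    have hcase : ∀ z ∈ D, ShareSide x z → ShareSide (i, j) z → z ∈ insert c A := by
      intro z hz h5 h6
      rcases hclosed x hxA z hz h5 with h | h
      · exact Finset.mem_insert.2 (Or.inl h)
      · exact Finset.mem_insert.2 (Or.inr h)
    rcases hpin with h | h
    · left; refine hcase _ h ?_ ?_ <;> rw [shareSide_iff] <;> grind
    · right; refine hcase _ h ?_ ?_ <;> rw [shareSide_iff] <;> grind
  refine ⟨hrem, ?_⟩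
  obtain ⟨y, hy, hxy⟩ := hrem.exists_free
  have hcD : c ∈ D.erase x := Finset.mem_erase.2 ⟨hxc, hc⟩
  refine hD.erase ⟨c, hcD⟩ ?_ hxy hy
  refine isConn_of_reach c (Finset.mem_coe.2 hcD) fun z hz => ?_
  simp only [Finset.coe_erase, Set.mem_sdiff, Finset.mem_coe, Set.mem_singleton_iff] at hz
  by_cases hzA : z ∈ A
  · refine (hE.conn c ?_ z ?_).mono ?_
    · simp [hxc]
    · simp [hzA, hz.2]
    · intro s hs
      simp only [Finset.coe_erase, Finset.coe_insert, Set.mem_sdiff, Set.mem_insert_iff,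
        Finset.mem_coe, Set.mem_singleton_iff] at hs ⊢
      refine ⟨?_, hs.2⟩
      rcases hs.1 with rfl | h
      exacts [hc, hAD h]
  · refine (hB z hz.1 hzA).mono ?_
    intro s hs
    simp only [Finset.coe_erase, Finset.coe_sdiff, Set.mem_sdiff, Finset.mem_coe,
      Set.mem_singleton_iff] at hs ⊢
    exact ⟨hs.1, fun h => hs.2 (h ▸ hxA)⟩

/-- From a square of `D` outside `A` and different from `c` one walks downwards: closedness of `A`
prevents entering `A`, and `c` cannot be entered from above since nothing of `D` lies there. -/
theorem IsSimple.insert_part {D A : Finset (ℤ × ℤ)} (hD : IsSimple D) {c n : ℤ × ℤ}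
    (hAD : A ⊆ D) (hc : c ∈ D) (hn : n ∈ A) (hcn : ShareSide c n) (hA : ∀ s ∈ A, Reach A n s)
    (hclosed : ∀ s ∈ A, ∀ t ∈ D, ShareSide s t → t = c ∨ t ∈ A) (hup : c + (0, 1) ∉ D) :
    IsSimple (insert c A) := by
  refine ⟨⟨c, by simp⟩, isConn_of_reach c (by simp) fun z hz => ?_, ?_⟩
  · simp only [Finset.coe_insert, Set.mem_insert_iff, Finset.mem_coe] at hz
    rcases hz with rfl | hz
    · exact Reach.refl _ _
    · exact (Reach.single (by simp [hn]) hcn).trans ((hA z hz).mono (by simp))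
  · refine hD.escapes.of_reach (Finset.coe_subset.2 (Finset.insert_subset hc hAD)) fun z hz hzE => ?_
    refine exists_reach_of_walk (D := D) (Q := ((insert c A : Finset (ℤ × ℤ)) :
      Set (ℤ × ℤ))) (t := (0, -1)) (by rw [shareSide_iff]; simp) (fun z hz hzE hzt hzt' => ?_)
      (Finset.coe_subset.2 (Finset.insert_subset hc hAD)) hzE
    simp only [Finset.coe_insert, Set.mem_insert_iff, Finset.mem_coe, not_or] at hzE hzt'
    rcases hzt' with h | h
    · refine hup ?_
      rw [← h]
      simpa [add_assoc, Prod.mk_zero_zero] using hz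
    · rcases hclosed _ h z hz (by rw [shareSide_iff]; simp) with h' | h'
      exacts [hzE.1 h', hzE.2 h']

theorem IsSimple.eq_singleton {D : Finset (ℤ × ℤ)} (hD : IsSimple D) {c : ℤ × ℤ} (hc : c ∈ D)
    (h : ∀ s ∈ D, ¬ ShareSide c s) : D = {c} := by
  refine Finset.eq_singleton_iff_unique_mem.2 ⟨hc, fun z hz => ?_⟩
  by_contra hne
  obtain ⟨x, y, -, hx, hy, -, hxy⟩ := (hD.conn c hc z hz).first_exit (R := {c}) rfl hne
  exact h y hy (hx ▸ hxy)

/-- The part of `D` without `c` that is connected to `n`. -/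
theorem exists_part {D : Finset (ℤ × ℤ)} (hD : IsSimple D) {c : ℤ × ℤ} (hc : c ∈ D) (n : ℤ × ℤ)
    (hn : n ∈ D.erase c) : ∃ A : Finset (ℤ × ℤ), A ⊆ D ∧ c ∉ A ∧ n ∈ A ∧
      (∀ s ∈ A, Reach A n s) ∧ (∀ s ∈ A, ∀ t ∈ D, ShareSide s t → t = c ∨ t ∈ A) ∧
      (∀ s, s ∈ A ↔ s ∈ D.erase c ∧ Reach (D.erase c : Finset (ℤ × ℤ)) n s) ∧
      (∀ s ∈ D, s ∉ A → Reach (D \ A : Finset (ℤ × ℤ)) c s) := by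
  classical
  let A := (D.erase c).filter fun s => Reach (D.erase c : Finset (ℤ × ℤ)) n s
  have hA : ∀ s, s ∈ A ↔ s ∈ D.erase c ∧ Reach (D.erase c : Finset (ℤ × ℤ)) n s := fun s =>
    Finset.mem_filter
  have hcl : ∀ s ∈ A, ∀ t ∈ D, ShareSide s t → t = c ∨ t ∈ A := by
    intro s hs t ht hst
    by_cases htc : t = c
    · exact Or.inl htc
    · have ht' : t ∈ D.erase c := Finset.mem_erase.2 ⟨htc, ht⟩
      exact Or.inr ((hA t).2 ⟨ht', ((hA s).1 hs).2.tail ht' hst⟩)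
  refine ⟨A, fun s hs => (Finset.mem_erase.1 ((hA s).1 hs).1).2, fun h => ?_, ?_, ?_, hcl, hA, ?_⟩
  · simpa using ((hA c).1 h).1
  · exact (hA n).2 ⟨hn, Reach.refl _ _⟩
  · intro s hs
    refine (((hA s).1 hs).2.restrict (R := (A : Set (ℤ × ℤ))) ((hA n).2 ⟨hn, Reach.refl _ _⟩)
      fun x hx y hy hxy => ?_).mono Set.inter_subset_right
    rcases hcl x hx y (Finset.mem_erase.1 hy).2 hxy with h | h
    exacts [absurd h (Finset.mem_erase.1 hy).1, h]
  · intro s hs hsA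
    by_cases hsc : s = c
    · rw [hsc]; exact Reach.refl _ _
    -- a path from `s` to `c` in `D` cannot enter `A` before reaching `c`
    obtain ⟨x, y, hr, hx, hy, hyR, hxy⟩ := (hD.conn s hs c hc).first_exit
      (R := {z | z ∈ D ∧ z ∉ A ∧ z ≠ c}) ⟨hs, hsA, hsc⟩ (fun h => h.2.2 rfl)
    have hyc : y = c := by
      by_contra hyc
      refine hyR ⟨hy, fun hyA => ?_, hyc⟩
      rcases hcl y hyA x hx.1 hxy.symm with h | h
      exacts [hx.2.2 h, hx.2.1 h]
    have h1 : Reach (D \ A : Finset (ℤ × ℤ)) s x := hr.mono (by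
      rintro z ⟨hz, hz1, hz2, -⟩
      simpa using ⟨hz, hz2⟩)
    have hcA : c ∉ A := fun h => by simpa using ((hA c).1 h).1
    refine Reach.symm (h1.tail (by simpa using ⟨hc, hcA⟩) (hyc ▸ hxy)) (by simpa using ⟨hs, hsA⟩)

/-- Removing one part of a board of which the top left or top right square `c` is a cut square. -/
theorem exists_removable_of_part {D : Finset (ℤ × ℤ)} (hD : IsSimple D)
    (IH : ∀ E : Finset (ℤ × ℤ), E.card < D.card → IsSimple E → ∀ c ∈ E, E ≠ {c} →
      ∃ x ∈ E, x ≠ c ∧ Removable E x ∧ IsSimple (E.erase x))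
    {c n n' c₀ : ℤ × ℤ} (hc : c ∈ D) (hn : n ∈ D) (hn' : n' ∈ D) (hcn : ShareSide c n)
    (hcn' : ShareSide c n') (hup : c + (0, 1) ∉ D)
    (hsep : ¬ Reach (D.erase c : Finset (ℤ × ℤ)) n n')
    (hc₀ : ¬ Reach (D.erase c : Finset (ℤ × ℤ)) n c₀) :
    ∃ x ∈ D, x ≠ c₀ ∧ Removable D x ∧ IsSimple (D.erase x) := by
  have hne : ∀ m, ShareSide c m → m ≠ c := by
    rintro m h rfl
    rw [shareSide_iff] at h
    omega
  obtain ⟨A, hAD, hcA, hnA, hconn, hcl, hA, hB⟩ :=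
    exists_part hD hc n (Finset.mem_erase.2 ⟨hne n hcn, hn⟩)
  have hn'A : n' ∉ A := fun h => hsep ((hA _).1 h).2
  have hE := hD.insert_part hAD hc hnA hcn hconn hcl hup
  obtain ⟨x, hxE, hxc, hx, hxs⟩ := IH (insert c A)
    (Finset.card_lt_card ⟨Finset.insert_subset hc hAD, fun h => by
      have := h hn'
      rw [Finset.mem_insert] at this
      rcases this with h | h
      exacts [hne n' hcn' h, hn'A h]⟩) hE c (by simp) (fun h => by
      have : n ∈ ({c} : Finset (ℤ × ℤ)) := h ▸ Finset.mem_insert_of_mem hnA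
      exact hne n hcn (by simpa using this))
  have hxA : x ∈ A := Finset.mem_of_mem_insert_of_ne hxE hxc
  obtain ⟨h1, h2⟩ := removable_of_part hD hc hcA hAD hxA hcl hB hx hxs
  refine ⟨x, hAD hxA, ?_, h1, h2⟩
  rintro rfl
  exact hc₀ ((hA _).1 hxA).2

/-- The top left (`h = 1`) or top right (`h = -1`) square of a board leads to a removable square. -/
theorem exists_removable_of_top {D : Finset (ℤ × ℤ)} (hD : IsSimple D)
    (IH : ∀ E : Finset (ℤ × ℤ), E.card < D.card → IsSimple E → ∀ c ∈ E, E ≠ {c} →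
      ∃ x ∈ E, x ≠ c ∧ Removable E x ∧ IsSimple (E.erase x))
    {a b h : ℤ} (hh : h = 1 ∨ h = -1) {c₀ : ℤ × ℤ} (hc₀ : c₀ ∈ D) (hc : (a, b) ∈ D)
    (hne : (a, b) ≠ c₀) (htop : ∀ z ∈ D, z.2 ≤ b) (hside : (a - h, b) ∉ D) :
    ∃ x ∈ D, x ≠ c₀ ∧ Removable D x ∧ IsSimple (D.erase x) := by
  have hup : ∀ i, (i, b + 1) ∉ D := fun i hi => by have := htop _ hi; simp only at this; omega
  have hc₀' : c₀ ∈ D.erase (a, b) := Finset.mem_erase.2 ⟨hne.symm, hc₀⟩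
  have hfree : ShareSide (a, b) (a - h, b) := by rw [shareSide_iff]; grind
  have hr : ShareSide (a, b) (a + h, b) := by rw [shareSide_iff]; grind
  have hb : ShareSide (a, b) (a, b - 1) := by rw [shareSide_iff]; grind
  have hnbr : ∀ s ∈ D, ShareSide (a, b) s → s = (a + h, b) ∨ s = (a, b - 1) := by
    intro s hs hcs
    obtain ⟨s1, s2⟩ := s
    rw [shareSide_iff] at hcs
    have h1 := hup s1
    simp only [Prod.mk.injEq] at *
    rcases hcs with ⟨rfl, rfl⟩ | ⟨rfl, rfl⟩ | ⟨rfl, rfl⟩ | ⟨rfl, rfl⟩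
    · rcases hh with rfl | rfl
      · simp
      · exact absurd hs (by simpa using hside)
    · rcases hh with rfl | rfl
      · exact absurd hs (by simpa using hside)
      · simp [sub_eq_add_neg]
    · exact absurd hs h1
    · simp
  have herase : (D.erase (a, b)).Nonempty := ⟨c₀, hc₀'⟩
  by_cases hrD : (a + h, b) ∈ D <;> by_cases hbD : (a, b - 1) ∈ D
  · by_cases hmD : (a + h, b - 1) ∈ D
    · -- two neighbours completed to a block
      refine ⟨(a, b), hc, hne, Or.inr (Or.inr ⟨h, hh, hrD, hbD, hmD, hside, hup _, hup _⟩),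
        hD.erase herase (hD.conn.erase fun s hs t ht hcs hct => ?_) hfree hside⟩
      have key : Reach (D.erase (a, b) : Finset (ℤ × ℤ)) (a + h, b) (a, b - 1) := by
        refine ((Reach.refl _ _).tail (b := (a + h, b)) (c := (a + h, b - 1)) ?_ ?_).tail ?_ ?_
        · simpa using hmD
        · rw [shareSide_iff]; grind
        · simpa using hbD
        · rw [shareSide_iff]; grind
      have key' := key.symm (by simp [hrD]; omega)
      rcases hnbr s hs hcs with rfl | rfl <;> rcases hnbr t ht hct with rfl | rfl
      exacts [Reach.refl _ _, key, key', Reach.refl _ _]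
    · -- a cut square
      have hsep : ¬ Reach (D.erase (a, b) : Finset (ℤ × ℤ)) (a + h, b) (a, b - 1) := by
        intro key
        have hr' : (a + h, b) ∈ ((D.erase (a, b) : Finset (ℤ × ℤ)) : Set (ℤ × ℤ)) := by
          simp [hrD]; omega
        have key' := key.symm hr'
        -- If the two neighbours were connected without `(a, b)`, its removal would leave a simple
        -- set with a pinched vertex, the fourth square of the block being absent.
        have hconn : IsConn (D.erase (a, b) : Finset (ℤ × ℤ)) :=
          hD.conn.erase fun s hs t ht hcs hct => by
            rcases hnbr s hs hcs with rfl | rfl <;> rcases hnbr t ht hct with rfl | rfl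
            exacts [Reach.refl _ _, key, key', Reach.refl _ _]
        have hs := hD.erase herase hconn hfree hside
        rcases hh with rfl | rfl
        · have := (hs.no_pinch a (b - 1)).1
          simp [hrD, hbD, hmD] at this
        · have := (hs.no_pinch (a - 1) (b - 1)).2
          simp only [← sub_eq_add_neg] at hrD hmD
          simp [hrD, hbD, hmD] at this
      have hsep' : ¬ Reach (D.erase (a, b) : Finset (ℤ × ℤ)) (a, b - 1) (a + h, b) := fun key =>
        hsep (key.symm (by simp [hbD]))
      -- The induction is applied to the part that does not contain the marked square `c₀`.
      by_cases hcase : Reach (D.erase (a, b) : Finset (ℤ × ℤ)) (a + h, b) c₀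
      · refine exists_removable_of_part hD IH hc hbD hrD hb hr (by simpa using hup a) hsep'
          fun h' => hsep (hcase.trans (h'.symm (by simp [hbD])))
      · exact exists_removable_of_part hD IH hc hrD hbD hr hb (by simpa using hup a) hsep hcase
  · -- only a neighbour in the top row
    refine ⟨(a, b), hc, hne, Or.inr (Or.inl ⟨h, hh, hrD, hside, hup _, hbD, hup _, ?_⟩),
        hD.erase herase (hD.conn.erase fun s hs t ht hcs hct => ?_) hfree hside⟩
    · intro hd
      rcases hh with rfl | rfl
      · have := (hD.no_pinch (a - 1) (b - 1)).1
        simp [hd, hc, hbD, hside] at this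
      · have := (hD.no_pinch a (b - 1)).2
        simp only [sub_neg_eq_add] at hd hside
        simp [hd, hc, hbD, hside] at this
    · rcases hnbr s hs hcs with rfl | rfl
      · rcases hnbr t ht hct with rfl | rfl
        · exact Reach.refl _ _
        · exact absurd ht hbD
      · exact absurd hs hbD
  · -- only a neighbour below
    refine ⟨(a, b), hc, hne, Or.inl ⟨-1, Or.inr rfl, hbD, ?_, ?_, ?_, ?_, ?_⟩,
        hD.erase herase (hD.conn.erase fun s hs t ht hcs hct => ?_) hfree hside⟩
    · simpa using hup a
    · rcases hh with rfl | rfl <;> simpa using ‹_›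
    · rcases hh with rfl | rfl <;> simpa [← sub_eq_add_neg] using ‹_›
    · simpa using hup (a + 1)
    · simpa using hup (a - 1)
    · rcases hnbr s hs hcs with rfl | rfl
      · exact absurd hs hrD
      · rcases hnbr t ht hct with rfl | rfl
        · exact absurd ht hrD
        · exact Reach.refl _ _
  · exfalso
    have := hD.eq_singleton hc fun s hs hcs => by
      rcases hnbr s hs hcs with rfl | rfl
      exacts [hrD hs, hbD hs]
    rw [this, Finset.mem_singleton] at hc₀
    exact hne hc₀.symm

/-- A protected square is built into the induction because, at a cut square `c`, one part is treated
together with `c`, and `c` must survive for the removal to be valid in `D`. An end of the top row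
other than `c₀` is used; if `c₀` is the whole top row, it is set aside and the square below it is
protected instead. -/
theorem exists_removable (D : Finset (ℤ × ℤ)) (hD : IsSimple D) (c₀ : ℤ × ℤ) (hc₀ : c₀ ∈ D)
    (hne : D ≠ {c₀}) : ∃ x ∈ D, x ≠ c₀ ∧ Removable D x ∧ IsSimple (D.erase x) := by
  induction hn : D.card using Nat.strong_induction_on generalizing D c₀ with
  | _ n ih =>
  subst hn
  have IH : ∀ E : Finset (ℤ × ℤ), E.card < D.card → IsSimple E → ∀ c ∈ E, E ≠ {c} →
      ∃ x ∈ E, x ≠ c ∧ Removable E x ∧ IsSimple (E.erase x) :=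
    fun E hE hEs c hc hcE => ih _ hE E hEs c hc hcE rfl
  obtain ⟨⟨a₀, b⟩, hc1, htop⟩ := D.exists_max_image Prod.snd hD.nonempty
  simp only at htop
  have hrow : (D.filter fun z => z.2 = b).Nonempty := ⟨_, Finset.mem_filter.2 ⟨hc1, rfl⟩⟩
  obtain ⟨⟨l, b1⟩, hl, hlmin⟩ := Finset.exists_min_image _ Prod.fst hrow
  obtain ⟨⟨r, b2⟩, hr, hrmax⟩ := Finset.exists_max_image _ Prod.fst hrow
  simp only [Finset.mem_filter, and_imp] at hl hr hlmin hrmax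
  obtain ⟨hl, rfl⟩ := hl
  obtain ⟨hr, rfl⟩ := hr
  have hl' : (l - 1, b2) ∉ D := fun h => by have := hlmin _ h rfl; simp only at this; omega
  have hr' : (r + 1, b2) ∉ D := fun h => by have := hrmax _ h rfl; simp only at this; omega
  by_cases h1 : (l, b2) ≠ c₀
  · exact exists_removable_of_top hD IH (Or.inl rfl) hc₀ hl h1 htop hl'
  by_cases h2 : (r, b2) ≠ c₀
  · exact exists_removable_of_top hD IH (Or.inr rfl) hc₀ hr h2 htop (by simpa using hr')
  push Not at h1 h2
  obtain rfl : r = l := by rw [← h1] at h2; simpa using h2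
  subst h1
  -- the marked square is alone in the top row
  have hup : ∀ i, (i, b2 + 1) ∉ D := fun i hi => by have := htop _ hi; simp only at this; omega
  have hnbr : ∀ s ∈ D, ShareSide (r, b2) s → s = (r, b2 - 1) := by
    intro s hs hcs
    obtain ⟨s1, s2⟩ := s
    rw [shareSide_iff] at hcs
    have h1 := hup s1
    simp only [Prod.mk.injEq] at *
    rcases hcs with ⟨rfl, rfl⟩ | ⟨rfl, rfl⟩ | ⟨rfl, rfl⟩ | ⟨rfl, rfl⟩
    exacts [absurd hs hr', absurd hs hl', absurd hs h1, ⟨rfl, rfl⟩]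
  have hbD : (r, b2 - 1) ∈ D := by
    by_contra hbD
    exact hne (hD.eq_singleton hl fun s hs hcs => hbD (hnbr s hs hcs ▸ hs))
  have hE : IsSimple (D.erase (r, b2)) :=
    hD.erase ⟨(r, b2 - 1), by simp [hbD]⟩ (hD.conn.erase fun s hs t ht hcs hct => by
      rw [hnbr s hs hcs, hnbr t ht hct]; exact Reach.refl _ _)
      (show ShareSide (r, b2) (r + 1, b2) by rw [shareSide_iff]; simp) hr'
  by_cases hEb : D.erase (r, b2) = {(r, b2 - 1)}
  · have hmem : ∀ z, z ∈ D → z = (r, b2) ∨ z = (r, b2 - 1) := by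
      intro z hz
      by_cases hzc : z = (r, b2)
      · exact Or.inl hzc
      · right
        have : z ∈ D.erase (r, b2) := Finset.mem_erase.2 ⟨hzc, hz⟩
        rw [hEb] at this
        simpa using this
    have hn : ∀ i j, (i ≠ r ∨ (j ≠ b2 ∧ j ≠ b2 - 1)) → (i, j) ∉ D := fun i j hij h => by
      have := hmem _ h
      simp only [Prod.mk.injEq] at this
      omega
    refine ⟨(r, b2 - 1), hbD, by simp, Or.inl ⟨1, Or.inl rfl, by simpa using hl, hn _ _ ?_,
      hn _ _ ?_, hn _ _ ?_, hn _ _ ?_, hn _ _ ?_⟩, ?_⟩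
    · right; constructor <;> simp only <;> omega
    · left; simp
    · left; simp
    · left; simp
    · left; simp
    · refine hD.erase ⟨(r, b2), by simp [hl]; omega⟩ (hD.conn.erase fun s hs t ht hcs hct => ?_)
        (show ShareSide (r, b2 - 1) (r + 1, b2 - 1) by rw [shareSide_iff]; simp)
        (hn _ _ (Or.inl (by simp)))
      have hcase : ∀ s ∈ D, ShareSide (r, b2 - 1) s → s = (r, b2) := by
        intro s hs hcs
        rcases hmem s hs with h | h
        · exact h
        · rw [h, shareSide_iff] at hcs
          simp only at hcs; omega
      rw [hcase s hs hcs, hcase t ht hct]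
      exact Reach.refl _ _
  · obtain ⟨x, hxE, hxb, hx, hxs⟩ := IH _ (Finset.card_erase_lt_of_mem hl) hE (r, b2 - 1)
      (by simp [hbD]) hEb
    obtain ⟨hxc, hxD⟩ := Finset.mem_erase.1 hxE
    have hcx : ¬ ShareSide (r, b2) x := fun h => hxb (hnbr x hxD h)
    -- The restored square can touch `x` only at a vertex, and then the protected square below it is
    -- adjacent to both, so it blocks nothing.
    have hrem : Removable D x := by
      refine hx.of_subset (Finset.erase_subset _ _) ?_
      intro i j hyD hyE h1 h2 h3 h4
      have hij : (i, j) = (r, b2) := by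
        by_contra h
        exact hyE (Finset.mem_erase.2 ⟨h, hyD⟩)
      simp only [Prod.mk.injEq] at hij
      obtain ⟨rfl, rfl⟩ := hij
      have h5 := htop _ hxD
      have h6 : i ≠ x.1 ∧ j ≠ x.2 := by
        rw [shareSide_iff] at hcx
        simp only [ne_eq, Prod.ext_iff] at hcx hxc
        omega
      refine ⟨h6.1, h6.2, Or.inr ?_⟩
      have : x.2 = j - 1 := by omega
      rw [this]
      simp [hbD]
    obtain ⟨y, hy, hxy⟩ := hrem.exists_free
    refine ⟨x, hxD, hxc, hrem, hD.erase ⟨(r, b2), by simp [hl, hxc.symm]⟩ ?_ hxy hy⟩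
    have hbx : (r, b2 - 1) ∈ D.erase x := Finset.mem_erase.2 ⟨hxb.symm, hbD⟩
    refine isConn_of_reach _ (Finset.mem_coe.2 hbx) fun z hz => ?_
    have hz' := Finset.mem_erase.1 (Finset.mem_coe.1 hz)
    by_cases hzc : z = (r, b2)
    · subst hzc
      exact Reach.single hz (by rw [shareSide_iff]; simp)
    · refine (hxs.conn (r, b2 - 1) ?_ z ?_).mono ?_
      · simp [hbD, hxb.symm]
      · simp [hzc, hz'.1, hz'.2]
      · exact Finset.coe_subset.2 (Finset.erase_subset_erase _ (Finset.erase_subset _ _))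

end Quad

namespace Quad

/-! ### Removing a removable square is a homeomorphism -/

/-- Continuous positively homogeneous functions, positive away from the origin. -/
structure IsGauge (N : ℝ × ℝ → ℝ) : Prop where
  continuous : Continuous N
  smul : ∀ (c : ℝ) (v : ℝ × ℝ), 0 ≤ c → N (c • v) = c * N v
  pos : ∀ v, v ≠ 0 → 0 < N v

theorem IsGauge.zero {N : ℝ × ℝ → ℝ} (h : IsGauge N) : N 0 = 0 := by
  simpa using h.smul 0 0 le_rfl

/-- The quotient is homogeneous of degree 0, hence controlled by its values on the compact unit
sphere; at the origin it is 0 / 0 = 0. -/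
theorem IsGauge.bound {N M : ℝ × ℝ → ℝ} (hN : IsGauge N) (hM : IsGauge M) :
    ∃ C, ∀ v, |N v / M v| ≤ C := by
  have hS : IsCompact (Metric.sphere (0 : ℝ × ℝ) 1) := isCompact_sphere _ _
  have hne : ∀ v ∈ Metric.sphere (0 : ℝ × ℝ) 1, M v ≠ 0 := fun v hv =>
    (hM.pos v (by rintro rfl; simp at hv)).ne'
  obtain ⟨C, hC⟩ := hS.exists_bound_of_continuousOn
    (hN.continuous.continuousOn.div hM.continuous.continuousOn hne)
  refine ⟨max C 0, fun v => ?_⟩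
  by_cases hv : v = 0
  · simp [hv, hN.zero]
  · have hv' : 0 < ‖v‖ := norm_pos_iff.2 hv
    have h1 := hC (‖v‖⁻¹ • v) (by simp [norm_smul, hv'.ne'])
    rw [Pi.div_apply, hN.smul _ _ (by positivity), hM.smul _ _ (by positivity),
      mul_div_mul_left _ _ (by positivity), Real.norm_eq_abs] at h1
    exact h1.trans (le_max_left _ _)

/-- The only delicate point is the origin, where the factor is discontinuous in general but bounded.
-/
theorem IsGauge.continuous_rescale {N M : ℝ × ℝ → ℝ} (hN : IsGauge N) (hM : IsGauge M) :
    Continuous fun v => (N v / M v) • v := by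
  obtain ⟨C, hC⟩ := hN.bound hM
  rw [continuous_iff_continuousAt]
  intro v
  by_cases hv : v = 0
  · subst hv
    rw [ContinuousAt, smul_zero]
    refine squeeze_zero_norm (a := fun v : ℝ × ℝ => C * ‖v‖) (fun v => ?_) ?_
    · rw [norm_smul, Real.norm_eq_abs]
      exact mul_le_mul_of_nonneg_right (hC v) (norm_nonneg _)
    · have : Filter.Tendsto (fun v : ℝ × ℝ => C * ‖v‖) (nhds 0) (nhds (C * ‖(0 : ℝ × ℝ)‖)) :=
        (continuous_const.mul continuous_norm).tendsto _
      simpa using this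
  · exact (hN.continuous.continuousAt.div hM.continuous.continuousAt (hM.pos v hv).ne').smul
      continuousAt_id

theorem IsGauge.rescale_rescale {N M : ℝ × ℝ → ℝ} (hN : IsGauge N) (hM : IsGauge M) (v : ℝ × ℝ) :
    (M ((N v / M v) • v) / N ((N v / M v) • v)) • ((N v / M v) • v) = v := by
  by_cases hv : v = 0
  · simp [hv]
  · have h1 := hN.pos v hv
    have h2 := hM.pos v hv
    have h3 : 0 ≤ N v / M v := by positivity
    rw [hM.smul _ _ h3, hN.smul _ _ h3, smul_smul]
    have : N v / M v * M v / (N v / M v * N v) * (N v / M v) = 1 := by field_simp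
    rw [this, one_smul]

/-- The radial homeomorphism that takes the unit ball of `N` to the unit ball of `M`. -/
noncomputable def rescale {N M : ℝ × ℝ → ℝ} (hN : IsGauge N) (hM : IsGauge M) (o : ℝ × ℝ) :
    ℝ × ℝ ≃ₜ ℝ × ℝ where
  toFun p := o + (N (p - o) / M (p - o)) • (p - o)
  invFun p := o + (M (p - o) / N (p - o)) • (p - o)
  left_inv p := by simp only [add_sub_cancel_left]; rw [hN.rescale_rescale hM]; abel
  right_inv p := by simp only [add_sub_cancel_left]; rw [hM.rescale_rescale hN]; abel
  continuous_toFun := continuous_const.add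
    ((hN.continuous_rescale hM).comp (continuous_id.sub continuous_const))
  continuous_invFun := continuous_const.add
    ((hM.continuous_rescale hN).comp (continuous_id.sub continuous_const))

theorem continuousOn_piecewise_id {K R : Set (ℝ × ℝ)} [DecidablePred (· ∈ K)] (hK : IsClosed K)
    (hR : IsClosed R) {f : ℝ × ℝ → ℝ × ℝ} (hf : Continuous f) (hfix : ∀ p ∈ K, p ∈ R → f p = p) :
    ContinuousOn (K.piecewise f id) (K ∪ R) := by
  refine ContinuousOn.union_of_isClosed ?_ ?_ hK hR
  · exact hf.continuousOn.congr fun p hp => Set.piecewise_eq_of_mem _ _ _ hp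
  · refine continuousOn_id.congr fun p hp => ?_
    by_cases hpK : p ∈ K
    · rw [Set.piecewise_eq_of_mem _ _ _ hpK]; exact hfix p hpK hp
    · rw [Set.piecewise_eq_of_notMem _ _ _ hpK]

/-- The map `f` on `K` is glued with the identity on `R`; all sets are closed and the two maps agree
on the overlap, and so do their inverses because `K' ⊆ K`. -/
theorem nonempty_homeomorph_union {K K' R : Set (ℝ × ℝ)} (hK : IsClosed K) (hK' : IsClosed K')
    (hR : IsClosed R) (hKK : K' ⊆ K) (f : ℝ × ℝ ≃ₜ ℝ × ℝ) (hf : ∀ p, p ∈ K ↔ f p ∈ K')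
    (hfix : ∀ p ∈ K, p ∈ R → f p = p) :
    Nonempty ((K ∪ R : Set (ℝ × ℝ)) ≃ₜ (K' ∪ R : Set (ℝ × ℝ))) := by
  classical
  have hf' : ∀ q, q ∈ K' ↔ f.symm q ∈ K := fun q => by rw [hf, f.apply_symm_apply]
  have hfix' : ∀ q ∈ K', q ∈ R → f.symm q = q := fun q hq hqR => by
    conv_lhs => rw [← hfix q (hKK hq) hqR]
    exact f.symm_apply_apply q
  have hF := continuousOn_piecewise_id hK hR f.continuous hfix
  have hG := continuousOn_piecewise_id hK' hR f.symm.continuous hfix'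
  have hFm : Set.MapsTo (K.piecewise f id) (K ∪ R) (K' ∪ R) := by
    intro p hp
    by_cases hpK : p ∈ K
    · rw [Set.piecewise_eq_of_mem _ _ _ hpK]; exact Or.inl ((hf p).1 hpK)
    · rw [Set.piecewise_eq_of_notMem _ _ _ hpK]; exact Or.inr (hp.resolve_left hpK)
  have hGm : Set.MapsTo (K'.piecewise f.symm id) (K' ∪ R) (K ∪ R) := by
    intro p hp
    by_cases hpK : p ∈ K'
    · rw [Set.piecewise_eq_of_mem _ _ _ hpK]; exact Or.inl ((hf' p).1 hpK)
    · rw [Set.piecewise_eq_of_notMem _ _ _ hpK]; exact Or.inr (hp.resolve_left hpK)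
  refine ⟨⟨⟨hFm.restrict, hGm.restrict, ?_, ?_⟩, hF.mapsToRestrict hFm, hG.mapsToRestrict hGm⟩⟩
  · rintro ⟨p, hp⟩
    refine Subtype.ext ?_
    simp only [Set.MapsTo.val_restrict_apply]
    by_cases hpK : p ∈ K
    · rw [Set.piecewise_eq_of_mem _ _ _ hpK, Set.piecewise_eq_of_mem _ _ _ ((hf p).1 hpK),
        f.symm_apply_apply]
    · rw [Set.piecewise_eq_of_notMem _ _ _ hpK, id,
        Set.piecewise_eq_of_notMem _ _ _ fun h => hpK (hKK h), id]
  · rintro ⟨p, hp⟩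
    refine Subtype.ext ?_
    simp only [Set.MapsTo.val_restrict_apply]
    by_cases hpK : p ∈ K'
    · rw [Set.piecewise_eq_of_mem _ _ _ hpK, Set.piecewise_eq_of_mem _ _ _ ((hf' p).1 hpK),
        f.apply_symm_apply]
    · have hpR := hp.resolve_left hpK
      rw [Set.piecewise_eq_of_notMem _ _ _ hpK, id]
      refine Set.piecewise_eq_of_notMem _ _ _ fun h => hpK ?_
      rw [← hfix p h hpR]
      exact (hf p).1 h

theorem mem_closedSquare {c : ℤ × ℤ} {p : ℝ × ℝ} : p ∈ closedSquare c ↔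
    ((c.1 : ℝ) ≤ p.1 ∧ p.1 ≤ c.1 + 1) ∧ ((c.2 : ℝ) ≤ p.2 ∧ p.2 ≤ c.2 + 1) := Iff.rfl

theorem mem_region {D : Finset (ℤ × ℤ)} {p : ℝ × ℝ} :
    p ∈ region D ↔ ∃ c ∈ D, p ∈ closedSquare c := by simp [region]

theorem isClosed_closedSquare (c : ℤ × ℤ) : IsClosed (closedSquare c) :=
  isClosed_Icc.prod isClosed_Icc

theorem isClosed_region (D : Finset (ℤ × ℤ)) : IsClosed (region D) :=
  Set.Finite.isClosed_biUnion D.finite_toSet fun c _ => isClosed_closedSquare c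

theorem region_union (D E : Finset (ℤ × ℤ)) : region (D ∪ E) = region D ∪ region E := by
  ext p
  simp only [Set.mem_union, mem_region, Finset.mem_union, or_and_right, exists_or]

theorem region_mono {D E : Finset (ℤ × ℤ)} (h : D ⊆ E) : region D ⊆ region E := by
  intro p
  rw [mem_region, mem_region]
  rintro ⟨c, hc, hp⟩
  exact ⟨c, h hc, hp⟩

/-- If a block `K` of squares of `D` and the block without its square `x` are starlike domains with
the same centre `o`, described by gauges that agree on the other squares of `D`, then the removal
of `x` does not change the homeomorphism type. -/
theorem nonempty_homeomorph_erase {D K : Finset (ℤ × ℤ)} {x : ℤ × ℤ} (hKD : K ⊆ D) (hxK : x ∈ K)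
    {N M : ℝ × ℝ → ℝ} (hN : IsGauge N) (hM : IsGauge M) (o : ℝ × ℝ) {C : Set (ℝ × ℝ)}
    (hC : ∀ (c : ℝ) (v : ℝ × ℝ), 0 < c → (v ∈ C ↔ c • v ∈ C))
    (h1 : ∀ p, p ∈ region K ↔ p - o ∈ C ∧ N (p - o) ≤ 1)
    (h2 : ∀ p, p ∈ region (K.erase x) ↔ p - o ∈ C ∧ M (p - o) ≤ 1)
    (h3 : ∀ p ∈ region K, ∀ y ∈ D, y ∉ K → p ∈ closedSquare y → N (p - o) = M (p - o)) :
    Nonempty (region D ≃ₜ region (D.erase x)) := by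
  have e1 : region D = region K ∪ region (D \ K) := by
    rw [← region_union, Finset.union_sdiff_of_subset hKD]
  have e2 : region (D.erase x) = region (K.erase x) ∪ region (D \ K) := by
    rw [← region_union]
    congr 1
    ext z
    have := @hKD z
    by_cases hz : z = x
    · subst hz; simp [hxK]
    · simp only [Finset.mem_erase, Finset.mem_union, Finset.mem_sdiff]; tauto
  rw [e1, e2]
  have hval : ∀ p, rescale hN hM o p = o + (N (p - o) / M (p - o)) • (p - o) := fun p => rfl
  refine nonempty_homeomorph_union (isClosed_region _) (isClosed_region _) (isClosed_region _)
    (region_mono (Finset.erase_subset _ _)) (rescale hN hM o) (fun p => ?_) fun p hp hpR => ?_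
  · rw [h1, h2, hval, add_sub_cancel_left]
    by_cases hv : p - o = 0
    · simp [hv, hN.zero, hM.zero]
    · have hn := hN.pos _ hv
      have hm := hM.pos _ hv
      rw [← hC _ _ (div_pos hn hm), hM.smul _ _ (div_pos hn hm).le, div_mul_cancel₀ _ hm.ne']
  · obtain ⟨y, hy, hpy⟩ := mem_region.1 hpR
    rw [Finset.mem_sdiff] at hy
    rw [hval, h3 p hp y hy.1 hy.2 hpy]
    by_cases hv : p - o = 0
    · rw [hv, smul_zero, add_zero]; exact (sub_eq_zero.1 hv).symm
    · rw [div_self (hM.pos _ hv).ne', one_smul]; abel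

end Quad

namespace Quad

/-! ### Symmetries of the lattice -/

/-- Both coordinates are monotonic along `u`. -/
def BothMonotone (s : Set ℕ) (u : ℕ → ℤ × ℤ) : Prop :=
  (MonotoneOn (fun j => (u j).1) s ∨ AntitoneOn (fun j => (u j).1) s) ∧
    (MonotoneOn (fun j => (u j).2) s ∨ AntitoneOn (fun j => (u j).2) s)

/-- A symmetry of the square lattice, acting on squares, on vertices and on the two sides of an
oriented diagonal. -/
structure LatticeIso where
  /-- the action on squares -/
  cell : ℤ × ℤ ≃ ℤ × ℤ
  /-- the action on vertices -/
  pt : ℤ × ℤ ≃ ℤ × ℤ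
  /-- the action on sides -/
  side : Side ≃ Side
  mem : ∀ p c, pt p ∈ vertices (cell c) ↔ p ∈ vertices c
  adj : ∀ c d, ShareSide (cell c) (cell d) ↔ ShareSide c d
  seg : ∀ p q, IsSegment (pt p) (pt q) ↔ IsSegment p q
  opposite : ∀ p q, AreOpposite (pt p) (pt q) ↔ AreOpposite p q
  squareOn_eq : ∀ p q, AreOpposite p q → squareOn (pt p) (pt q) = cell (squareOn p q)
  sideVertex_eq : ∀ σ p q, AreOpposite p q →
    sideVertex (side σ) (pt p) (pt q) = pt (sideVertex σ p q)
  side_opp : ∀ σ, side σ.opp = (side σ).opp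
  cell_add : ∀ c p q, cell (c + (p - q)) = cell c + (pt p - pt q)
  pt_add : ∀ r p q, pt (r + (p - q)) = pt r + (pt p - pt q)
  mono : ∀ s u, BothMonotone s (fun j => pt (u j)) ↔ BothMonotone s u
  homeo : ∃ G : ℝ × ℝ ≃ₜ ℝ × ℝ, ∀ c p, G p ∈ closedSquare (cell c) ↔ p ∈ closedSquare c

theorem areOpposite_iff {p q : ℤ × ℤ} : AreOpposite p q ↔
    (q.1 = p.1 + 1 ∨ q.1 = p.1 - 1) ∧ (q.2 = p.2 + 1 ∨ q.2 = p.2 - 1) := by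
  unfold AreOpposite
  rcases abs_cases (q.1 - p.1) with h | h <;> rcases abs_cases (q.2 - p.2) with h' | h' <;> omega

theorem Side.opp_opp (σ : Side) : σ.opp.opp = σ := by cases σ <;> rfl

namespace LatticeIso

/-- Composition of symmetries. -/
def trans (g h : LatticeIso) : LatticeIso where
  cell := g.cell.trans h.cell
  pt := g.pt.trans h.pt
  side := g.side.trans h.side
  mem p c := by simp [h.mem, g.mem]
  adj c d := by simp [h.adj, g.adj]
  seg p q := by simp [h.seg, g.seg]
  opposite p q := by simp [h.opposite, g.opposite]
  squareOn_eq p q hpq := by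
    simp [h.squareOn_eq _ _ ((g.opposite p q).2 hpq), g.squareOn_eq p q hpq]
  sideVertex_eq σ p q hpq := by
    simp [h.sideVertex_eq _ _ _ ((g.opposite p q).2 hpq), g.sideVertex_eq σ p q hpq]
  side_opp σ := by simp [g.side_opp, h.side_opp]
  cell_add c p q := by simp [g.cell_add, h.cell_add]
  pt_add c p q := by simp [g.pt_add, h.pt_add]
  mono s u := (h.mono s fun j => g.pt (u j)).trans (g.mono s u)
  homeo := by
    obtain ⟨G, hG⟩ := g.homeo
    obtain ⟨H, hH⟩ := h.homeo
    exact ⟨G.trans H, fun c p => by simp [hH, hG]⟩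

/-- Translations. -/
def translation (t : ℤ × ℤ) : LatticeIso where
  cell := Equiv.addRight t
  pt := Equiv.addRight t
  side := Equiv.refl _
  mem p c := by simp only [Equiv.coe_addRight, mem_vertices, Prod.fst_add, Prod.snd_add]; grind
  adj c d := by simp only [Equiv.coe_addRight, shareSide_iff, Prod.fst_add, Prod.snd_add]; grind
  seg p q := by simp [IsSegment]
  opposite p q := by simp [AreOpposite]
  squareOn_eq p q _ := by simp [squareOn, Prod.ext_iff, min_add_add_right]
  sideVertex_eq σ p q _ := by
    cases σ <;> simp [sideVertex, rightVertex] <;> split_ifs <;> simp [Prod.ext_iff]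
  side_opp _ := rfl
  cell_add c p q := by simp only [Equiv.coe_addRight]; abel
  pt_add c p q := by simp only [Equiv.coe_addRight]; abel
  mono s u := by simp [BothMonotone, MonotoneOn, AntitoneOn]
  homeo := by
    refine ⟨Homeomorph.addRight ((t.1 : ℝ), (t.2 : ℝ)), fun c p => ?_⟩
    simp only [closedSquare, Equiv.coe_addRight, Homeomorph.coe_addRight, Set.mem_prod,
      Set.mem_Icc, Prod.fst_add, Prod.snd_add]
    push_cast
    constructor <;> rintro ⟨⟨h1, h2⟩, h3, h4⟩ <;> refine ⟨⟨?_, ?_⟩, ?_, ?_⟩ <;> linarith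

/-- The reflection exchanging the coordinates. -/
def swap : LatticeIso where
  cell := Equiv.prodComm ℤ ℤ
  pt := Equiv.prodComm ℤ ℤ
  side := ⟨Side.opp, Side.opp, Side.opp_opp, Side.opp_opp⟩
  mem p c := by simp [mem_vertices, and_comm]
  adj c d := by simp only [Equiv.prodComm_apply, shareSide_iff, Prod.fst_swap, Prod.snd_swap]; grind
  seg p q := by simp [IsSegment, add_comm]
  opposite p q := by simp [AreOpposite, and_comm]
  squareOn_eq p q _ := by simp [squareOn]
  sideVertex_eq σ p q h := by
    rw [areOpposite_iff] at h
    obtain ⟨a, b⟩ := p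
    obtain ⟨a', b'⟩ := q
    simp only at h
    obtain ⟨rfl | rfl, rfl | rfl⟩ := h <;> cases σ <;>
      simp [sideVertex, rightVertex, Side.opp]
  side_opp _ := rfl
  cell_add c p q := by simp
  pt_add c p q := by simp
  mono s u := by simp [BothMonotone, and_comm]
  homeo := by
    refine ⟨Homeomorph.prodComm ℝ ℝ, fun c p => ?_⟩
    simp [closedSquare]

/-- The reflection changing the sign of the first coordinate. -/
def reflect : LatticeIso where
  -- The mirror image of [a, a + 1] is [-a - 1, -a]: lower left corners are not carried to lower
  -- left corners, which is why squares and vertices have separate actions.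
  cell := ⟨fun c => (-c.1 - 1, c.2), fun c => (-c.1 - 1, c.2), fun c => by simp, fun c => by simp⟩
  pt := ⟨fun c => (-c.1, c.2), fun c => (-c.1, c.2), fun c => by simp, fun c => by simp⟩
  side := ⟨Side.opp, Side.opp, Side.opp_opp, Side.opp_opp⟩
  mem p c := by simp only [Equiv.coe_fn_mk, mem_vertices]; grind
  adj c d := by simp only [Equiv.coe_fn_mk, shareSide_iff]; grind
  seg p q := by
    change ShareSide _ _ ↔ ShareSide _ _
    simp only [Equiv.coe_fn_mk, shareSide_iff]; grind
  opposite p q := by simp only [Equiv.coe_fn_mk, areOpposite_iff]; grind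
  squareOn_eq p q h := by
    rw [areOpposite_iff] at h
    simp only [Equiv.coe_fn_mk, squareOn, Prod.mk.injEq, and_true]
    grind
  sideVertex_eq σ p q h := by
    rw [areOpposite_iff] at h
    obtain ⟨a, b⟩ := p
    obtain ⟨a', b'⟩ := q
    simp only at h
    obtain ⟨rfl | rfl, rfl | rfl⟩ := h <;> cases σ <;>
      simp [sideVertex, rightVertex, Side.opp]
  side_opp _ := rfl
  cell_add c p q := by simp [Prod.ext_iff]; ring
  pt_add c p q := by simp [Prod.ext_iff]; ring
  mono s u := by
    simp only [BothMonotone, MonotoneOn, AntitoneOn, Equiv.coe_fn_mk, neg_le_neg_iff]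
    rw [or_comm (a := ∀ ⦃a : ℕ⦄, a ∈ s → ∀ ⦃b : ℕ⦄, b ∈ s → a ≤ b → (u b).1 ≤ (u a).1)]
  homeo := by
    refine ⟨(Homeomorph.neg ℝ).prodCongr (Homeomorph.refl ℝ), fun c p => ?_⟩
    change (_ ≤ -p.1 ∧ -p.1 ≤ _) ∧ (_ ≤ p.2 ∧ p.2 ≤ _) ↔ (_ ≤ p.1 ∧ p.1 ≤ _) ∧ _ ≤ p.2 ∧ p.2 ≤ _
    simp only [Equiv.coe_fn_mk]
    push_cast
    constructor <;> rintro ⟨⟨h1, h2⟩, h3, h4⟩ <;> refine ⟨⟨?_, ?_⟩, ?_, ?_⟩ <;> linarith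

/-- The inverse symmetry. -/
def symm (g : LatticeIso) : LatticeIso where
  cell := g.cell.symm
  pt := g.pt.symm
  side := g.side.symm
  mem p c := by rw [← g.mem]; simp
  adj c d := by rw [← g.adj]; simp
  seg p q := by rw [← g.seg]; simp
  opposite p q := by rw [← g.opposite]; simp
  squareOn_eq p q h := by
    rw [Equiv.eq_symm_apply, ← g.squareOn_eq _ _ (by rw [← g.opposite]; simpa using h)]
    simp
  sideVertex_eq σ p q h := by
    rw [Equiv.eq_symm_apply, ← g.sideVertex_eq _ _ _ (by rw [← g.opposite]; simpa using h)]
    simp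
  side_opp σ := by rw [Equiv.symm_apply_eq, g.side_opp]; simp
  cell_add c p q := by rw [Equiv.symm_apply_eq, g.cell_add]; simp
  pt_add c p q := by rw [Equiv.symm_apply_eq, g.pt_add]; simp
  mono s u := by rw [← g.mono]; simp
  homeo := by
    obtain ⟨G, hG⟩ := g.homeo
    exact ⟨G.symm, fun c p => by rw [← hG]; simp⟩

end LatticeIso

end Quad

/-! ### Gauges for the two elementary removals -/

namespace Quad

theorem isGauge_max {α β : ℝ} (hα : 0 < α) (hβ : 0 < β) :
    IsGauge fun v => max (α * |v.1|) (β * |v.2|) where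
  continuous := by fun_prop
  smul c v hc := by
    simp only [Prod.smul_fst, Prod.smul_snd, smul_eq_mul, abs_mul, abs_of_nonneg hc]
    rw [mul_max_of_nonneg _ _ hc]
    congr 1 <;> ring
  pos v hv := by
    by_cases h : v.1 = 0
    · have h' : v.2 ≠ 0 := fun h' => hv (Prod.ext h h')
      exact lt_max_of_lt_right (by positivity)
    · exact lt_max_of_lt_left (by positivity)

/-- The unit ball is a square of half-side 2 without its four corner unit squares; within a quadrant
this is a block of four squares without the far one. -/
theorem isGauge_notch :
    IsGauge fun v => max (max (1 / 2 * |v.1|) (1 / 2 * |v.2|)) (min |v.1| |v.2|) where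
  continuous := by fun_prop
  smul c v hc := by
    simp only [Prod.smul_fst, Prod.smul_snd, smul_eq_mul, abs_mul, abs_of_nonneg hc]
    rw [mul_max_of_nonneg _ _ hc, mul_max_of_nonneg _ _ hc, mul_min_of_nonneg _ _ hc]
    congr 2 <;> ring
  pos v hv := lt_max_of_lt_left
    ((isGauge_max (α := 1 / 2) (β := 1 / 2) (by norm_num) (by norm_num)).pos v hv)

theorem region_column {X Y : ℝ} : (X, Y) ∈ region {(0, 0), (0, -1)} ↔
    (0 ≤ X ∧ X ≤ 1) ∧ -1 ≤ Y ∧ Y ≤ 1 := by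
  rw [mem_region]
  simp only [Finset.mem_insert, Finset.mem_singleton, exists_eq_or_imp, exists_eq_left,
    mem_closedSquare]
  push_cast
  constructor
  · rintro (⟨⟨h1, h2⟩, h3, h4⟩ | ⟨⟨h1, h2⟩, h3, h4⟩) <;> refine ⟨⟨?_, ?_⟩, ?_, ?_⟩ <;> linarith
  · rintro ⟨⟨h1, h2⟩, h3, h4⟩
    rcases le_total 0 Y with h | h
    · left; refine ⟨⟨?_, ?_⟩, ?_, ?_⟩ <;> linarith
    · right; refine ⟨⟨?_, ?_⟩, ?_, ?_⟩ <;> linarith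

theorem region_block {X Y : ℝ} : (X, Y) ∈ region {(0, 0), (1, 0), (0, -1), (1, -1)} ↔
    (0 ≤ X ∧ X ≤ 2) ∧ -1 ≤ Y ∧ Y ≤ 1 := by
  rw [mem_region]
  simp only [Finset.mem_insert, Finset.mem_singleton, exists_eq_or_imp, exists_eq_left,
    mem_closedSquare]
  push_cast
  constructor
  · rintro (⟨⟨h1, h2⟩, h3, h4⟩ | ⟨⟨h1, h2⟩, h3, h4⟩ | ⟨⟨h1, h2⟩, h3, h4⟩ | ⟨⟨h1, h2⟩, h3, h4⟩) <;>
      refine ⟨⟨?_, ?_⟩, ?_, ?_⟩ <;> linarith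
  · rintro ⟨⟨h1, h2⟩, h3, h4⟩
    rcases le_total 0 Y with h | h <;> rcases le_total X 1 with h' | h'
    · left; refine ⟨⟨?_, ?_⟩, ?_, ?_⟩ <;> linarith
    · right; left; refine ⟨⟨?_, ?_⟩, ?_, ?_⟩ <;> linarith
    · right; right; left; refine ⟨⟨?_, ?_⟩, ?_, ?_⟩ <;> linarith
    · right; right; right; refine ⟨⟨?_, ?_⟩, ?_, ?_⟩ <;> linarith

theorem region_notched_block {X Y : ℝ} : (X, Y) ∈ region {(1, 0), (0, -1), (1, -1)} ↔
    ((0 ≤ X ∧ X ≤ 2) ∧ -1 ≤ Y ∧ Y ≤ 1) ∧ (1 ≤ X ∨ Y ≤ 0) := by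
  rw [mem_region]
  simp only [Finset.mem_insert, Finset.mem_singleton, exists_eq_or_imp, exists_eq_left,
    mem_closedSquare]
  push_cast
  constructor
  · rintro (⟨⟨h1, h2⟩, h3, h4⟩ | ⟨⟨h1, h2⟩, h3, h4⟩ | ⟨⟨h1, h2⟩, h3, h4⟩)
    · exact ⟨⟨⟨by linarith, by linarith⟩, by linarith, by linarith⟩, Or.inl h1⟩
    · exact ⟨⟨⟨by linarith, by linarith⟩, by linarith, by linarith⟩, Or.inr (by linarith)⟩
    · exact ⟨⟨⟨by linarith, by linarith⟩, by linarith, by linarith⟩, Or.inr (by linarith)⟩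
  · rintro ⟨⟨⟨h1, h2⟩, h3, h4⟩, h5⟩
    rcases le_total 0 Y with h | h <;> rcases le_total X 1 with h' | h'
    · rcases h5 with h5 | h5
      · left; refine ⟨⟨?_, ?_⟩, ?_, ?_⟩ <;> linarith
      · right; left; refine ⟨⟨?_, ?_⟩, ?_, ?_⟩ <;> linarith
    · left; refine ⟨⟨?_, ?_⟩, ?_, ?_⟩ <;> linarith
    · right; left; refine ⟨⟨?_, ?_⟩, ?_, ?_⟩ <;> linarith
    · right; right; refine ⟨⟨?_, ?_⟩, ?_, ?_⟩ <;> linarith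

/-- Seen from the midpoint (1/2, -1) of its lower side, the column of two squares and its lower
square are unit balls, in the upper half plane, of the larger of 2|x| and |y|/2, respectively |y|.
These agree where |y| ≤ 2|x|, which holds wherever the column meets other squares of `D`. -/
theorem nonempty_homeomorph_erase_column {D : Finset (ℤ × ℤ)} (hx : ((0, 0) : ℤ × ℤ) ∈ D)
    (h1 : ((0, -1) : ℤ × ℤ) ∈ D) (h2 : ((0, 1) : ℤ × ℤ) ∉ D)
    (h3 : ((1, 0) : ℤ × ℤ) ∉ D) (h4 : ((-1, 0) : ℤ × ℤ) ∉ D) (h5 : ((1, 1) : ℤ × ℤ) ∉ D)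
    (h6 : ((-1, 1) : ℤ × ℤ) ∉ D) : Nonempty (region D ≃ₜ region (D.erase (0, 0))) := by
  have herase : ({(0, 0), (0, -1)} : Finset (ℤ × ℤ)).erase (0, 0) = {(0, -1)} := by decide
  refine nonempty_homeomorph_erase (K := {(0, 0), (0, -1)}) (by simp [Finset.insert_subset_iff, *])
    (by simp) (isGauge_max (α := 2) (β := 1 / 2) (by norm_num) (by norm_num))
    (isGauge_max (α := 2) (β := 1) (by norm_num) (by norm_num))
    (1 / 2, -1) (C := {v | 0 ≤ v.2}) (fun c v hc => ?_) ?_ ?_ ?_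
  · simp [hc]
  · rintro ⟨X, Y⟩
    rw [region_column]
    simp only [Set.mem_ofPred_eq, Prod.mk_sub_mk, sup_le_iff]
    constructor
    · rintro ⟨⟨h1, h2⟩, h3, h4⟩
      have : |X - 1 / 2| ≤ 1 / 2 := abs_le.2 ⟨by linarith, by linarith⟩
      have : |Y - -1| ≤ 2 := abs_le.2 ⟨by linarith, by linarith⟩
      exact ⟨by linarith, by linarith, by linarith⟩
    · rintro ⟨h1, h2, h3⟩
      have e1 : |X - 1 / 2| ≤ 1 / 2 := by linarith
      have e2 : |Y - -1| ≤ 2 := by linarith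
      rw [abs_le] at e1 e2
      exact ⟨⟨by linarith, by linarith⟩, by linarith, by linarith⟩
  · rintro ⟨X, Y⟩
    rw [herase, mem_region]
    simp only [Finset.mem_singleton, exists_eq_left, mem_closedSquare, Set.mem_ofPred_eq,
      Prod.mk_sub_mk, sup_le_iff]
    push_cast
    constructor
    · rintro ⟨⟨h1, h2⟩, h3, h4⟩
      have : |X - 1 / 2| ≤ 1 / 2 := abs_le.2 ⟨by linarith, by linarith⟩
      have : |Y - -1| ≤ 1 := abs_le.2 ⟨by linarith, by linarith⟩
      exact ⟨by linarith, by linarith, by linarith⟩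
    · rintro ⟨h1, h2, h3⟩
      have e1 : |X - 1 / 2| ≤ 1 / 2 := by linarith
      have e2 : |Y - -1| ≤ 1 := by linarith
      rw [abs_le] at e1 e2
      exact ⟨⟨by linarith, by linarith⟩, by linarith, by linarith⟩
  · rintro ⟨X, Y⟩ hp ⟨i, j⟩ hy hyK hpy
    rw [region_column] at hp
    obtain ⟨⟨p1, p2⟩, p3, p4⟩ := hp
    rw [mem_closedSquare] at hpy
    simp only at hpy
    obtain ⟨⟨q1, q2⟩, q3, q4⟩ := hpy
    simp only [Finset.mem_insert, Finset.mem_singleton, not_or] at hyK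
    have i1 : (-1 : ℤ) ≤ i := by exact_mod_cast (by linarith : (-1 : ℝ) ≤ i)
    have i2 : i ≤ 1 := by exact_mod_cast (by linarith : (i : ℝ) ≤ 1)
    have j1 : (-2 : ℤ) ≤ j := by exact_mod_cast (by linarith : (-2 : ℝ) ≤ j)
    have j2 : j ≤ 1 := by exact_mod_cast (by linarith : (j : ℝ) ≤ 1)
    have key : |Y - -1| ≤ 2 * |X - 1 / 2| := by
      obtain rfl | rfl | rfl : i = -1 ∨ i = 0 ∨ i = 1 := by omega
      · have hj : j ≤ -1 := by
          by_contra hj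
          obtain rfl | rfl : j = 0 ∨ j = 1 := by omega
          exacts [h4 hy, h6 hy]
        have hj' : (j : ℝ) ≤ -1 := by exact_mod_cast hj
        push_cast at q2
        rw [abs_of_nonneg (by linarith), abs_of_nonpos (by linarith)]
        linarith
      · have hj : j = -2 := by
          by_contra hj
          obtain rfl | rfl | rfl : j = -1 ∨ j = 0 ∨ j = 1 := by omega
          exacts [hyK.2 rfl, hyK.1 rfl, h2 hy]
        subst hj
        push_cast at q4
        rw [show Y - -1 = 0 by linarith, abs_zero]
        positivity
      · have hj : j ≤ -1 := by
          by_contra hj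
          obtain rfl | rfl : j = 0 ∨ j = 1 := by omega
          exacts [h3 hy, h5 hy]
        have hj' : (j : ℝ) ≤ -1 := by exact_mod_cast hj
        push_cast at q1
        rw [abs_of_nonneg (by linarith), abs_of_nonneg (by linarith)]
        linarith
    simp only [Prod.mk_sub_mk]
    have := abs_nonneg (Y - -1)
    rw [max_eq_left (by linarith), max_eq_left (by linarith)]

/-- The centre (2, -1) is the corner of the block opposite to the removed square, and the block
fills a quadrant of a ball around it. The two gauges agree where the smaller of |x|, |y| is at most
half the larger, in particular where other squares of `D` can touch the block. -/
theorem nonempty_homeomorph_erase_block {D : Finset (ℤ × ℤ)} (hx : ((0, 0) : ℤ × ℤ) ∈ D)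
    (h1 : ((1, 0) : ℤ × ℤ) ∈ D) (h2 : ((0, -1) : ℤ × ℤ) ∈ D) (h3 : ((1, -1) : ℤ × ℤ) ∈ D)
    (h4 : ((-1, 0) : ℤ × ℤ) ∉ D) (h5 : ((0, 1) : ℤ × ℤ) ∉ D) (h6 : ((-1, 1) : ℤ × ℤ) ∉ D) :
    Nonempty (region D ≃ₜ region (D.erase (0, 0))) := by
  have herase : ({(0, 0), (1, 0), (0, -1), (1, -1)} : Finset (ℤ × ℤ)).erase (0, 0) =
    {(1, 0), (0, -1), (1, -1)} := by decide
  refine nonempty_homeomorph_erase (K := {(0, 0), (1, 0), (0, -1), (1, -1)})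
    (by simp [Finset.insert_subset_iff, *])
    (by simp) (isGauge_max (α := 1 / 2) (β := 1 / 2) (by norm_num) (by norm_num))
    isGauge_notch (2, -1) (C := {v | v.1 ≤ 0 ∧ 0 ≤ v.2}) (fun c v hc => ?_) ?_ ?_ ?_
  · simp only [Set.mem_ofPred_eq, Prod.smul_fst, Prod.smul_snd, smul_eq_mul]
    rw [mul_nonneg_iff_of_pos_left hc, mul_nonpos_iff_pos_imp_nonpos]
    constructor
    · exact fun h => ⟨⟨fun _ => h.1, fun h' => by linarith⟩, h.2⟩
    · exact fun h => ⟨h.1.1 hc, h.2⟩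
  · rintro ⟨X, Y⟩
    rw [region_block]
    simp only [Set.mem_ofPred_eq, Prod.mk_sub_mk, sup_le_iff]
    constructor
    · rintro ⟨⟨h1, h2⟩, h3, h4⟩
      rw [abs_of_nonpos (by linarith), abs_of_nonneg (by linarith)]
      exact ⟨⟨by linarith, by linarith⟩, by linarith, by linarith⟩
    · rintro ⟨⟨h0, h1⟩, h2⟩
      rw [abs_of_nonpos (by linarith), abs_of_nonneg (by linarith)] at h2
      exact ⟨⟨by linarith, by linarith⟩, by linarith, by linarith⟩
  · rintro ⟨X, Y⟩
    rw [herase, region_notched_block]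
    simp only [Set.mem_ofPred_eq, Prod.mk_sub_mk, sup_le_iff, inf_le_iff]
    constructor
    · rintro ⟨⟨⟨h1, h2⟩, h3, h4⟩, h5⟩
      rw [abs_of_nonpos (by linarith), abs_of_nonneg (by linarith)]
      exact ⟨⟨by linarith, by linarith⟩, ⟨by linarith, by linarith⟩,
        h5.imp (fun h => by linarith) fun h => by linarith⟩
    · rintro ⟨⟨h0, h1⟩, h2, h3⟩
      rw [abs_of_nonpos (by linarith), abs_of_nonneg (by linarith)] at h2 h3
      exact ⟨⟨⟨by linarith, by linarith⟩, by linarith, by linarith⟩,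
        h3.imp (fun h => by linarith) fun h => by linarith⟩
  · rintro ⟨X, Y⟩ hp ⟨i, j⟩ hy hyK hpy
    rw [region_block] at hp
    obtain ⟨⟨p1, p2⟩, p3, p4⟩ := hp
    rw [mem_closedSquare] at hpy
    simp only at hpy
    obtain ⟨⟨q1, q2⟩, q3, q4⟩ := hpy
    simp only [Finset.mem_insert, Finset.mem_singleton, not_or] at hyK
    have i1 : (-1 : ℤ) ≤ i := by exact_mod_cast (by linarith : (-1 : ℝ) ≤ i)
    have i2 : i ≤ 2 := by exact_mod_cast (by linarith : (i : ℝ) ≤ 2)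
    have j1 : (-2 : ℤ) ≤ j := by exact_mod_cast (by linarith : (-2 : ℝ) ≤ j)
    have j2 : j ≤ 1 := by exact_mod_cast (by linarith : (j : ℝ) ≤ 1)
    have hcase : i = 2 ∨ j = -2 ∨ i = -1 ∧ j = -1 ∨ i = 1 ∧ j = 1 := by
      by_contra hcon
      have : i = -1 ∧ j = 0 ∨ i = -1 ∧ j = 1 ∨ i = 0 ∧ j = -1 ∨ i = 0 ∧ j = 0 ∨ i = 0 ∧ j = 1 ∨
        i = 1 ∧ j = -1 ∨ i = 1 ∧ j = 0 := by omega
      rcases this with ⟨rfl, rfl⟩ | ⟨rfl, rfl⟩ | ⟨rfl, rfl⟩ | ⟨rfl, rfl⟩ | ⟨rfl, rfl⟩ |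
        ⟨rfl, rfl⟩ | ⟨rfl, rfl⟩
      exacts [h4 hy, h6 hy, hyK.2.2.1 rfl, hyK.1 rfl, h5 hy, hyK.2.2.2 rfl, hyK.2.1 rfl]
    simp only [Prod.mk_sub_mk]
    rw [abs_of_nonpos (by linarith : X - 2 ≤ 0), abs_of_nonneg (by linarith : 0 ≤ Y - -1)]
    symm
    refine max_eq_left ?_
    rcases hcase with rfl | rfl | ⟨rfl, rfl⟩ | ⟨rfl, rfl⟩ <;> push_cast at *
    · exact (min_le_left _ _).trans (le_max_of_le_left (by linarith))
    · exact (min_le_right _ _).trans (le_max_of_le_right (by linarith))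
    · exact (min_le_right _ _).trans (le_max_of_le_left (by linarith))
    · exact (min_le_left _ _).trans (le_max_of_le_right (by linarith))

/-- The removal of `x` from `D` does not change the homeomorphism type of the region. -/
def Collapsible (D : Finset (ℤ × ℤ)) (x : ℤ × ℤ) : Prop :=
  Nonempty (region D ≃ₜ region (D.erase x))

theorem LatticeIso.nonempty_homeomorph (g : LatticeIso) (D : Finset (ℤ × ℤ)) :
    Nonempty (region D ≃ₜ region (D.map g.cell.toEmbedding)) := by
  obtain ⟨G, hG⟩ := g.homeo
  have : region (D.map g.cell.toEmbedding) = G '' region D := by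
    ext p
    rw [← G.preimage_symm, Set.mem_preimage, mem_region, mem_region]
    simp only [Finset.mem_map_equiv]
    constructor
    · rintro ⟨c, hc, hp⟩
      exact ⟨_, hc, by rw [← hG]; simpa using hp⟩
    · rintro ⟨c, hc, hp⟩
      refine ⟨g.cell c, by simpa using hc, ?_⟩
      rw [← hG] at hp
      simpa using hp
  rw [this]
  exact ⟨G.image _⟩

theorem Collapsible.of_map {D : Finset (ℤ × ℤ)} {x : ℤ × ℤ} (g : LatticeIso)
    (h : Collapsible (D.map g.cell.toEmbedding) (g.cell x)) : Collapsible D x := by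
  obtain ⟨e⟩ := g.nonempty_homeomorph D
  obtain ⟨e'⟩ := g.nonempty_homeomorph (D.erase x)
  obtain ⟨f⟩ := h
  have : (D.map g.cell.toEmbedding).erase (g.cell x) = (D.erase x).map g.cell.toEmbedding := by
    rw [Finset.map_erase]; rfl
  rw [this] at f
  exact ⟨e.trans (f.trans e'.symm)⟩

end Quad

/-! ### Combinatorial boards are topological disks -/

namespace Quad

/-- Translations, the swap and the reflection carry all six positions to the two model removals at
the origin. -/
theorem Removable.collapsible {D : Finset (ℤ × ℤ)} {x : ℤ × ℤ} (hx : x ∈ D)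
    (h : Removable D x) : Collapsible D x := by
  obtain ⟨a, b⟩ := x
  have hcol : ∀ (E : Finset (ℤ × ℤ)) (a b : ℤ), (a, b) ∈ E → (a, b - 1) ∈ E → (a, b + 1) ∉ E →
      (a + 1, b) ∉ E → (a - 1, b) ∉ E → (a + 1, b + 1) ∉ E → (a - 1, b + 1) ∉ E →
      Collapsible E (a, b) := by
    intro E a b h0 h1 h2 h3 h4 h5 h6
    refine Collapsible.of_map (LatticeIso.translation (-a, -b)) ?_
    have e : (LatticeIso.translation (-a, -b)).cell (a, b) = (0, 0) := by
      simp [LatticeIso.translation]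
    rw [e]
    refine nonempty_homeomorph_erase_column ?_ ?_ ?_ ?_ ?_ ?_ ?_ <;>
      rw [Finset.mem_map_equiv] <;> simp only [LatticeIso.translation, Equiv.addRight_symm,
        Equiv.coe_addRight, neg_neg, Prod.neg_mk, Prod.mk_add_mk, zero_add] <;>
      first | assumption | (rw [add_comm (1 : ℤ) a]; assumption) | skip
    all_goals simpa [add_comm, sub_eq_add_neg] using by assumption
  have hblock : ∀ (E : Finset (ℤ × ℤ)) (a b : ℤ), (a, b) ∈ E → (a + 1, b) ∈ E → (a, b - 1) ∈ E →
      (a + 1, b - 1) ∈ E → (a - 1, b) ∉ E → (a, b + 1) ∉ E → (a - 1, b + 1) ∉ E →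
      Collapsible E (a, b) := by
    intro E a b h0 h1 h2 h3 h4 h5 h6
    refine Collapsible.of_map (LatticeIso.translation (-a, -b)) ?_
    have e : (LatticeIso.translation (-a, -b)).cell (a, b) = (0, 0) := by
      simp [LatticeIso.translation]
    rw [e]
    refine nonempty_homeomorph_erase_block ?_ ?_ ?_ ?_ ?_ ?_ ?_ <;>
      rw [Finset.mem_map_equiv] <;> simp only [LatticeIso.translation, Equiv.addRight_symm,
        Equiv.coe_addRight, neg_neg, Prod.neg_mk, Prod.mk_add_mk, zero_add] <;>
      first | assumption | (rw [add_comm (1 : ℤ) a]; assumption) | skip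
    all_goals simpa [add_comm, sub_eq_add_neg] using by assumption
  have hflip : ∀ (E : Finset (ℤ × ℤ)) (a b : ℤ), (a, b) ∈ E → (a - 1, b) ∈ E → (a + 1, b) ∉ E →
      (a, b + 1) ∉ E → (a, b - 1) ∉ E → (a + 1, b + 1) ∉ E → (a + 1, b - 1) ∉ E →
      Collapsible E (a, b) := by
    intro E a b h0 h1 h2 h3 h4 h5 h6
    refine Collapsible.of_map LatticeIso.swap (hcol _ b a ?_ ?_ ?_ ?_ ?_ ?_ ?_) <;>
      rw [Finset.mem_map_equiv] <;> simpa [LatticeIso.swap]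
  have hrow : ∀ (E : Finset (ℤ × ℤ)) (a b : ℤ), (a, b) ∈ E → (a + 1, b) ∈ E → (a - 1, b) ∉ E →
      (a, b + 1) ∉ E → (a, b - 1) ∉ E → (a - 1, b + 1) ∉ E → (a - 1, b - 1) ∉ E →
      Collapsible E (a, b) := by
    intro E a b h0 h1 h2 h3 h4 h5 h6
    refine Collapsible.of_map LatticeIso.reflect (hflip _ (-a - 1) b ?_ ?_ ?_ ?_ ?_ ?_ ?_) <;>
      rw [Finset.mem_map_equiv] <;> simpa [LatticeIso.reflect, add_comm, sub_eq_add_neg]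
  have hcol' : ∀ (E : Finset (ℤ × ℤ)) (a b : ℤ), (a, b) ∈ E → (a, b + 1) ∈ E → (a, b - 1) ∉ E →
      (a + 1, b) ∉ E → (a - 1, b) ∉ E → (a + 1, b - 1) ∉ E → (a - 1, b - 1) ∉ E →
      Collapsible E (a, b) := by
    intro E a b h0 h1 h2 h3 h4 h5 h6
    refine Collapsible.of_map LatticeIso.swap (hrow _ b a ?_ ?_ ?_ ?_ ?_ ?_ ?_) <;>
      rw [Finset.mem_map_equiv] <;> simpa [LatticeIso.swap]
  have hblock' : ∀ (E : Finset (ℤ × ℤ)) (a b : ℤ), (a, b) ∈ E → (a - 1, b) ∈ E → (a, b - 1) ∈ E →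
      (a - 1, b - 1) ∈ E → (a + 1, b) ∉ E → (a, b + 1) ∉ E → (a + 1, b + 1) ∉ E →
      Collapsible E (a, b) := by
    intro E a b h0 h1 h2 h3 h4 h5 h6
    refine Collapsible.of_map LatticeIso.reflect (hblock _ (-a - 1) b ?_ ?_ ?_ ?_ ?_ ?_ ?_) <;>
      rw [Finset.mem_map_equiv] <;> simpa [LatticeIso.reflect, add_comm, sub_eq_add_neg]
  rcases h with ⟨β, rfl | rfl, h1, h2, h3, h4, h5, h6⟩ | ⟨α, rfl | rfl, h1, h2, h3, h4, h5, h6⟩ |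
    ⟨α, rfl | rfl, h1, h2, h3, h4, h5, h6⟩ <;>
    simp only [sub_neg_eq_add, ← sub_eq_add_neg] at *
  · exact hcol' _ _ _ hx h1 h2 h3 h4 h5 h6
  · exact hcol _ _ _ hx h1 h2 h3 h4 h5 h6
  · exact hrow _ _ _ hx h1 h2 h3 h4 h5 h6
  · exact hflip _ _ _ hx h1 h2 h3 h4 h5 h6
  · exact hblock _ _ _ hx h1 h2 h3 h4 h5 h6
  · exact hblock' _ _ _ hx h1 h2 h3 h4 h5 h6

/-- A square and the image of the round disk are bounded convex sets with interior points, so a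
homeomorphism of the plane takes one to the other. -/
theorem isBoard_singleton (c : ℤ × ℤ) : IsBoard {c} := by
  have hr : region {c} = closedSquare c := by simp [region]
  rw [IsBoard, hr]
  let e : EuclideanSpace ℝ (Fin 2) ≃L[ℝ] ℝ × ℝ :=
    (EuclideanSpace.equiv (Fin 2) ℝ).trans (ContinuousLinearEquiv.finTwoArrow ℝ ℝ)
  have hconv : Convex ℝ (closedSquare c) := (convex_Icc _ _).prod (convex_Icc _ _)
  have hcomp : IsCompact (closedSquare c) := isCompact_Icc.prod isCompact_Icc
  have hint : (interior (closedSquare c)).Nonempty := by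
    refine ⟨((c.1 : ℝ) + 1 / 2, (c.2 : ℝ) + 1 / 2), ?_⟩
    rw [closedSquare, interior_prod_eq, interior_Icc, interior_Icc]
    constructor <;> constructor <;> simp <;> norm_num
  have hb : (interior (e '' Metric.closedBall 0 1)).Nonempty := by
    refine ⟨e 0, ?_⟩
    have := e.toHomeomorph.image_interior (Metric.closedBall (0 : EuclideanSpace ℝ (Fin 2)) 1)
    change e 0 ∈ interior (e.toHomeomorph '' _)
    rw [← this]
    exact ⟨0, Metric.ball_subset_interior_closedBall (by simp), rfl⟩
  have hbcomp : IsCompact (e '' Metric.closedBall 0 1) :=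
    (isCompact_closedBall _ _).image e.continuous
  have hbconv : Convex ℝ (e '' Metric.closedBall 0 1) :=
    (convex_closedBall _ _).linear_image e.toLinearEquiv.toLinearMap
  obtain ⟨f, -, hf, -⟩ := exists_homeomorph_image_eq hconv hint
    (NormedSpace.isVonNBounded_of_isBounded ℝ hcomp.isBounded) hbconv hb
    (NormedSpace.isVonNBounded_of_isBounded ℝ hbcomp.isBounded)
  rw [hcomp.isClosed.closure_eq, hbcomp.isClosed.closure_eq] at hf
  exact ⟨(f.image _).trans ((Homeomorph.setCongr hf).trans (e.toHomeomorph.image _).symm)⟩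

theorem IsSimple.isBoard {D : Finset (ℤ × ℤ)} (hD : IsSimple D) : IsBoard D := by
  induction hn : D.card using Nat.strong_induction_on generalizing D with
  | _ n ih =>
    obtain ⟨c, hc⟩ := hD.nonempty
    by_cases hs : D = {c}
    · rw [hs]; exact isBoard_singleton c
    · obtain ⟨x, hx, -, hr, hsimple⟩ := exists_removable D hD c hc hs
      obtain ⟨f⟩ := hr.collapsible hx
      obtain ⟨f'⟩ := ih _ (by rw [← hn]; exact Finset.card_erase_lt_of_mem hx) hsimple rfl
      exact ⟨f.trans f'⟩

end Quad

namespace Quad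

/-! ### Boards are connected and have no holes -/

/-- The open ball is homeomorphic to the whole space, where complements of countable sets are
connected; the closed ball without `F` lies between the open ball without `F` and its closure. -/
theorem isPreconnected_closedBall_diff {E : Type*} [NormedAddCommGroup E] [NormedSpace ℝ E]
    (hE : 1 < Module.rank ℝ E) {F : Set E} (hF : F.Countable) :
    IsPreconnected (Metric.closedBall (0 : E) 1 \ F) := by
  have hnt : Nontrivial E := (rank_pos_iff_nontrivial (R := ℝ)).1 (zero_lt_one.trans hE)
  have h1 : IsPreconnected (Metric.ball (0 : E) 1 \ F) := by
    set G : Set E := {v | ((Homeomorph.unitBall v : Metric.ball (0 : E) 1) : E) ∈ F}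
    have hG : G.Countable := hF.preimage
      (Subtype.val_injective.comp (Homeomorph.unitBall (E := E)).injective)
    have h := (hG.isConnected_compl_of_one_lt_rank hE).isPreconnected.image
      (fun v => ((Homeomorph.unitBall v : Metric.ball (0 : E) 1) : E))
      (continuous_subtype_val.comp (Homeomorph.unitBall (E := E)).continuous).continuousOn
    convert h using 1
    ext x
    constructor
    · rintro ⟨hx, hxF⟩
      exact ⟨Homeomorph.unitBall.symm ⟨x, hx⟩, by simpa [G] using hxF, by simp⟩
    · rintro ⟨v, hv, rfl⟩
      exact ⟨(Homeomorph.unitBall v).2, hv⟩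
  have hdense : Dense Fᶜ := hF.dense_compl ℝ
  refine h1.subset_closure (Set.sdiff_subset_sdiff_left Metric.ball_subset_closedBall) ?_
  rw [Set.sdiff_eq]
  have h2 := hdense.open_subset_closure_inter (Metric.isOpen_ball (x := (0 : E)) (ε := 1))
  refine Set.sdiff_subset.trans ?_
  rw [← closure_ball (0 : E) one_ne_zero]
  exact closure_minimal h2 isClosed_closure

theorem IsBoard.isPreconnected_diff {D : Finset (ℤ × ℤ)} (hD : IsBoard D) {F : Set (ℝ × ℝ)}
    (hF : F.Countable) : IsPreconnected (region D \ F) := by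
  obtain ⟨e⟩ := hD
  have hE : 1 < Module.rank ℝ (EuclideanSpace ℝ (Fin 2)) :=
    Module.one_lt_rank_of_one_lt_finrank (by simp)
  set G : Set (EuclideanSpace ℝ (Fin 2)) :=
    (fun x : region D => (e x : EuclideanSpace ℝ (Fin 2))) '' (Subtype.val ⁻¹' F)
  have hG : G.Countable := (hF.preimage Subtype.val_injective).image _
  have h := isPreconnected_closedBall_diff hE hG
  have h' : IsPreconnected ((Subtype.val ⁻¹' Gᶜ :
      Set (Metric.closedBall (0 : EuclideanSpace ℝ (Fin 2)) 1))) := by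
    rw [← Topology.IsInducing.subtypeVal.isPreconnected_image, Subtype.image_preimage_coe]
    rwa [Set.sdiff_eq] at h
  have h'' := (h'.image _ e.symm.continuous.continuousOn).image _
    continuous_subtype_val.continuousOn
  convert h'' using 1
  ext p
  constructor
  · rintro ⟨hp, hpF⟩
    refine ⟨⟨p, hp⟩, ⟨e ⟨p, hp⟩, ?_, by simp⟩, rfl⟩
    rintro ⟨⟨q, hq⟩, hqF, hqe⟩
    have := e.injective (Subtype.ext hqe)
    rw [this] at hqF
    exact hpF hqF
  · rintro ⟨q, ⟨b, hb, rfl⟩, rfl⟩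
    refine ⟨(e.symm b).2, fun hF => hb ⟨e.symm b, hF, by simp⟩⟩

/-- The lattice points of the plane. -/
def latticePoints : Set (ℝ × ℝ) := Set.range fun p : ℤ × ℤ => ((p.1 : ℝ), (p.2 : ℝ))

theorem shareSide_of_mem_of_mem {c d : ℤ × ℤ} {p : ℝ × ℝ} (hc : p ∈ closedSquare c)
    (hd : p ∈ closedSquare d) (hp : p ∉ latticePoints) : c = d ∨ ShareSide c d := by
  rw [mem_closedSquare] at hc hd
  obtain ⟨⟨c1, c2⟩, c3, c4⟩ := hc
  obtain ⟨⟨d1, d2⟩, d3, d4⟩ := hd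
  have e1 : c.1 ≤ d.1 + 1 := by exact_mod_cast c1.trans d2
  have e2 : d.1 ≤ c.1 + 1 := by exact_mod_cast d1.trans c2
  have e3 : c.2 ≤ d.2 + 1 := by exact_mod_cast c3.trans d4
  have e4 : d.2 ≤ c.2 + 1 := by exact_mod_cast d3.trans c4
  by_cases h1 : c.1 = d.1
  · by_cases h2 : c.2 = d.2
    · exact Or.inl (Prod.ext h1 h2)
    · right; rw [shareSide_iff]; omega
  · by_cases h2 : c.2 = d.2
    · right; rw [shareSide_iff]; omega
    · exfalso
      refine hp ⟨(max c.1 d.1, max c.2 d.2), Prod.ext ?_ ?_⟩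
      · rcases (show c.1 = d.1 + 1 ∨ d.1 = c.1 + 1 by omega) with h | h
        · rw [max_eq_left (a := c.1) (by omega)]
          rw [h] at c1 ⊢; push_cast at c1 ⊢; linarith
        · rw [max_eq_right (a := c.1) (by omega)]
          rw [h] at d1 ⊢; push_cast at d1 ⊢; linarith
      · rcases (show c.2 = d.2 + 1 ∨ d.2 = c.2 + 1 by omega) with h | h
        · rw [max_eq_left (a := c.2) (by omega)]
          rw [h] at c3 ⊢; push_cast at c3 ⊢; linarith
        · rw [max_eq_right (a := c.2) (by omega)]
          rw [h] at d3 ⊢; push_cast at d3 ⊢; linarith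

theorem exists_mem_closedSquare_notMem (c : ℤ × ℤ) : ∃ p ∈ closedSquare c, p ∉ latticePoints := by
  refine ⟨((c.1 : ℝ) + 1 / 2, c.2), ⟨⟨by simp, by norm_num⟩, by simp⟩, ?_⟩
  rintro ⟨q, hq⟩
  have h := congrArg Prod.fst hq
  simp only at h
  have h2 : ((2 * (q.1 - c.1) : ℤ) : ℝ) = (1 : ℤ) := by push_cast; linarith
  have := Int.cast_injective h2
  omega

/-- Squares that meet only at vertices are torn apart by deleting the lattice points. What remains
is still connected, whereas a component and its complement would cover it by two closed sets
disjoint there. -/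
theorem IsBoard.isConn {D : Finset (ℤ × ℤ)} (hD : IsBoard D) : IsConn (D : Set (ℤ × ℤ)) := by
  classical
  intro a ha b hb
  by_contra hab
  have hcount : latticePoints.Countable := Set.countable_range _
  have hconn := hD.isPreconnected_diff hcount
  rw [isPreconnected_closed_iff] at hconn
  set A := D.filter fun c => Reach (D : Set (ℤ × ℤ)) a c
  have hA : a ∈ A := Finset.mem_filter.2 ⟨ha, Reach.refl _ _⟩
  have hB : b ∈ D \ A := Finset.mem_sdiff.2 ⟨hb, fun h => hab (Finset.mem_filter.1 h).2⟩
  obtain ⟨p, hp, hpl⟩ := exists_mem_closedSquare_notMem a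
  obtain ⟨q, hq, hql⟩ := exists_mem_closedSquare_notMem b
  obtain ⟨r, ⟨-, hrl⟩, hrA, hrB⟩ := hconn (region A) (region (D \ A)) (isClosed_region _)
    (isClosed_region _) (by
      rw [← region_union, Finset.union_sdiff_of_subset (Finset.filter_subset _ _)]
      exact Set.sdiff_subset)
    ⟨p, ⟨mem_region.2 ⟨a, ha, hp⟩, hpl⟩, mem_region.2 ⟨a, hA, hp⟩⟩
    ⟨q, ⟨mem_region.2 ⟨b, hb, hq⟩, hql⟩, mem_region.2 ⟨b, hB, hq⟩⟩
  obtain ⟨c, hc, hrc⟩ := mem_region.1 hrA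
  obtain ⟨d, hd, hrd⟩ := mem_region.1 hrB
  rw [Finset.mem_sdiff] at hd
  rcases shareSide_of_mem_of_mem hrc hrd hrl with rfl | h
  · exact hd.2 hc
  · exact hd.2 (Finset.mem_filter.2 ⟨hd.1, (Finset.mem_filter.1 hc).2.tail hd.1 h⟩)

theorem IsBoard.nonempty {D : Finset (ℤ × ℤ)} (hD : IsBoard D) : D.Nonempty := by
  obtain ⟨e⟩ := hD
  obtain ⟨c, hc, -⟩ := mem_region.1 (e.symm ⟨0, by simp⟩).2
  exact ⟨c, hc⟩

/-- Continuous nonvanishing functions on a board have continuous logarithms. -/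
theorem IsBoard.exists_log {D : Finset (ℤ × ℤ)} (hD : IsBoard D) {g : ℝ × ℝ → ℂ}
    (hg : Continuous g) (h0 : ∀ p ∈ region D, g p ≠ 0) :
    ∃ L : ℝ × ℝ → ℂ, ContinuousOn L (region D) ∧ ∀ p ∈ region D, Complex.exp (L p) = g p := by
  classical
  obtain ⟨e⟩ := hD
  let E := EuclideanSpace ℝ (Fin 2)
  -- The radial retraction onto the disk extends the function to the whole plane, where it can be
  -- lifted through the exponential.
  let r : E → E := fun x => (max 1 ‖x‖)⁻¹ • x
  have hr : Continuous r := by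
    refine Continuous.smul (Continuous.inv₀ (continuous_const.max continuous_norm) fun x => ?_)
      continuous_id
    positivity
  have hrm : ∀ x, r x ∈ Metric.closedBall (0 : E) 1 := by
    intro x
    have : 0 < max 1 ‖x‖ := by positivity
    rw [mem_closedBall_zero_iff, norm_smul, norm_inv, Real.norm_of_nonneg this.le,
      inv_mul_le_iff₀ this, mul_one]
    exact le_max_right _ _
  have hrid : ∀ x ∈ Metric.closedBall (0 : E) 1, r x = x := by
    intro x hx
    rw [mem_closedBall_zero_iff] at hx
    simp [r, max_eq_left hx]
  let f : C(E, ℂ) := ⟨fun x => g (e.symm ⟨r x, hrm x⟩), by fun_prop⟩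
  have hf : ∀ x, f x ≠ 0 := fun x => h0 _ (e.symm ⟨r x, hrm x⟩).2
  obtain ⟨F, ⟨-, hF⟩, -⟩ := Complex.isCoveringMapOn_exp.existsUnique_continuousMap_lifts f
    (a₀ := 0) (Complex.exp_log (hf 0)) fun x => by simpa using hf x
  refine ⟨fun p => if hp : p ∈ region D then F (e ⟨p, hp⟩) else 0, ?_, fun p hp => ?_⟩
  · rw [continuousOn_iff_continuous_domRestrict]
    have : Continuous fun p : region D => F (e p) := by fun_prop
    convert this using 1
    ext p
    simp
  · have := congrFun hF (e ⟨p, hp⟩ : E)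
    simp only [dif_pos hp]
    simp only [Function.comp_apply] at this
    rw [this]
    change g (e.symm ⟨r _, _⟩) = g p
    have h2 : (⟨r (e ⟨p, hp⟩ : E), hrm _⟩ : Metric.closedBall (0 : E) 1) = e ⟨p, hp⟩ :=
      Subtype.ext (hrid _ (e ⟨p, hp⟩).2)
    rw [h2, e.symm_apply_apply]

end Quad

/-! ### No continuous logarithm around a hole -/

namespace Quad

/-- The sum telescopes along lines of direction `t`, and the hypotheses kill the terms at the ends.
Applied to both coordinate directions this is a discrete Stokes formula for `H`. -/
theorem sum_translate_sub_eq_zero {H : Finset (ℤ × ℤ)} {g : ℤ × ℤ → ℤ} {t : ℤ × ℤ}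
    (h1 : ∀ c ∈ H, c + t ∉ H → g (c + t) = 0) (h2 : ∀ c ∈ H, c - t ∉ H → g c = 0) :
    ∑ c ∈ H, (g (c + t) - g c) = 0 := by
  classical
  rw [Finset.sum_sub_distrib, sub_eq_zero]
  have e1 : ∑ c ∈ H, g (c + t) = ∑ c ∈ H.image (· + t), g c := by
    rw [Finset.sum_image fun a _ b _ h => add_right_cancel h]
  rw [e1, Finset.sum_subset (Finset.subset_union_left (s₂ := H)) fun c hc hc' => ?_]
  · symm
    refine Finset.sum_subset Finset.subset_union_right fun c hc hc' => ?_
    rcases Finset.mem_union.1 hc with h | h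
    · obtain ⟨d, hd, rfl⟩ := Finset.mem_image.1 h
      exact h1 d hd hc'
    · exact absurd h hc'
  · rcases Finset.mem_union.1 hc with h | h
    · exact absurd h hc'
    · refine h2 c h fun h' => hc' (Finset.mem_image.2 ⟨_, h', ?_⟩)
      abel

/-- The jump of the principal branch of the logarithm centred in the square `h` along the vertical
segment with lower end `p`. -/
def jump (h p : ℤ × ℤ) : ℤ := if p.2 = h.2 ∧ p.1 ≤ h.1 then -1 else 0

/-- There is no discrete logarithm on a set of squares that surrounds a hole. -/
theorem not_surrounded {D H : Finset (ℤ × ℤ)} {h : ℤ × ℤ} (hh : h ∈ H)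
    (hnbr : ∀ c ∈ H, ∀ d, ShareSide c d → d ∈ H ∨ d ∈ D) (n : ℤ × ℤ → ℤ)
    (hn : ∀ c ∈ D, n (c + (1, 0)) = n c ∧ n (c + (1, 1)) = n (c + (0, 1)) ∧
      n (c + (0, 1)) - n c = jump h c ∧ n (c + (1, 1)) - n (c + (1, 0)) = jump h (c + (1, 0))) :
    False := by
  have hadd : ∀ c : ℤ × ℤ, c + (1, 0) + (0, 1) = c + (1, 1) := fun c => by ext <;> simp
  have hadd' : ∀ c : ℤ × ℤ, c + (0, 1) + (1, 0) = c + (1, 1) := fun c => by ext <;> simp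
  -- `e1` concerns vertical sides and `e2` horizontal ones. In their sum the values of `n` cancel
  -- around every square, and the jumps leave 1 for the square `h` alone, although the boundary
  -- terms vanish.
  have e1 := sum_translate_sub_eq_zero (H := H)
    (g := fun p => jump h p - (n (p + (0, 1)) - n p)) (t := (1, 0)) (fun c hc hc' => by
      have hD := (hnbr c hc (c + (1, 0)) (by rw [shareSide_iff]; simp)).resolve_left hc'
      have := (hn _ hD).2.2.1
      omega) fun c hc hc' => by
      have hD := (hnbr c hc (c - (1, 0)) (by rw [shareSide_iff]; simp)).resolve_left hc'
      have := (hn _ hD).2.2.2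
      rw [← hadd, sub_add_cancel] at this
      omega
  have e2 := sum_translate_sub_eq_zero (H := H)
    (g := fun p => n (p + (1, 0)) - n p) (t := (0, 1)) (fun c hc hc' => by
      have hD := (hnbr c hc (c + (0, 1)) (by rw [shareSide_iff]; simp)).resolve_left hc'
      have := (hn _ hD).1
      omega) fun c hc hc' => by
      have hD := (hnbr c hc (c - (0, 1)) (by rw [shareSide_iff]; simp)).resolve_left hc'
      have := (hn _ hD).2.1
      rw [← hadd', sub_add_cancel] at this
      omega
  have e3 : ∑ c ∈ H, (if c = h then (1 : ℤ) else 0) = 0 := by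
    have e4 := congrArg₂ (· + ·) e1 e2
    simp only [add_zero] at e4
    rw [← Finset.sum_add_distrib] at e4
    refine Eq.trans ?_ e4
    refine Finset.sum_congr rfl fun c _ => ?_
    rw [hadd, hadd']
    have : jump h (c + (1, 0)) - jump h c = if c = h then 1 else 0 := by
      simp only [jump, Prod.ext_iff, Prod.fst_add, Prod.snd_add]
      split_ifs <;> omega
    rw [← this]
    ring
  rw [Finset.sum_ite_eq' H h, if_pos hh] at e3
  exact one_ne_zero e3

/-- The values of `f` are discrete, so continuity on a preconnected set makes them constant. -/
theorem exists_int_of_exp_eq_one {S : Set (ℝ × ℝ)} (hS : IsPreconnected S) {f : ℝ × ℝ → ℂ}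
    (hf : ContinuousOn f S) (h1 : ∀ p ∈ S, Complex.exp (f p) = 1) :
    ∃ m : ℤ, ∀ p ∈ S, f p = m * (2 * Real.pi * Complex.I) := by
  have hπ : (2 * Real.pi) ≠ 0 := by positivity
  have hval : ∀ p ∈ S, ∃ m : ℤ, f p = m * (2 * Real.pi * Complex.I) := fun p hp =>
    Complex.exp_eq_one_iff.1 (h1 p hp)
  have him : ∀ m : ℤ, ((m * (2 * Real.pi * Complex.I) : ℂ)).im / (2 * Real.pi) = m := by
    intro m
    simp only [Complex.mul_im, Complex.mul_re, Complex.intCast_re, Complex.intCast_im,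
      Complex.I_re, Complex.I_im, Complex.ofReal_re, Complex.ofReal_im, Complex.re_ofNat,
      Complex.im_ofNat]
    field_simp
    ring
  obtain ⟨y, ⟨m, rfl⟩, hy⟩ := hS.eqOn_const_of_mapsTo (T := Set.range ((↑) : ℤ → ℝ))
    (f := fun p => (f p).im / (2 * Real.pi)) Int.isClosedEmbedding_coe_real.isDiscrete_range
    ((Complex.continuous_im.comp_continuousOn hf).div_const _) (fun p hp => by
      obtain ⟨m, hm⟩ := hval p hp
      exact ⟨m, by simp only [hm]; rw [him]⟩) ⟨_, 0, rfl⟩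
  refine ⟨m, fun p hp => ?_⟩
  obtain ⟨m', hm'⟩ := hval p hp
  have := hy hp
  simp only [hm', Function.const_apply] at this
  rw [him] at this
  rw [hm']
  have h3 : m' = m := by exact_mod_cast this
  rw [h3]

theorem two_pi_I_cancel {z : ℂ} {m n : ℤ} (h : z + n * (2 * Real.pi * Complex.I) =
    z + m * (2 * Real.pi * Complex.I)) : n = m := by
  have := mul_right_cancel₀ Complex.two_pi_I_ne_zero (add_left_cancel h)
  exact_mod_cast this

/-- The position of a point of the plane with respect to the centre of the square `h`. -/
noncomputable def relPos (h : ℤ × ℤ) (p : ℝ × ℝ) : ℂ :=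
  ((p.1 - (h.1 + 1 / 2) : ℝ) : ℂ) + ((p.2 - (h.2 + 1 / 2) : ℝ) : ℂ) * Complex.I

theorem relPos_re (h : ℤ × ℤ) (p : ℝ × ℝ) : (relPos h p).re = p.1 - (h.1 + 1 / 2) := by
  simp only [relPos, Complex.add_re, Complex.mul_re, Complex.ofReal_re, Complex.ofReal_im,
    Complex.I_re, Complex.I_im]
  ring

theorem relPos_im (h : ℤ × ℤ) (p : ℝ × ℝ) : (relPos h p).im = p.2 - (h.2 + 1 / 2) := by
  simp only [relPos, Complex.add_im, Complex.mul_im, Complex.ofReal_re, Complex.ofReal_im,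
    Complex.I_re, Complex.I_im]
  ring

theorem continuous_relPos (h : ℤ × ℤ) : Continuous (relPos h) := by
  unfold relPos; fun_prop

theorem relPos_ne_zero {h c : ℤ × ℤ} (hch : c ≠ h) {p : ℝ × ℝ} (hp : p ∈ closedSquare c) :
    relPos h p ≠ 0 := by
  intro h0
  have h1 := relPos_re h p
  have h2 := relPos_im h p
  rw [h0] at h1 h2
  simp only [Complex.zero_re, Complex.zero_im] at h1 h2
  obtain ⟨⟨c1, c2⟩, c3, c4⟩ := mem_closedSquare.1 hp
  have e1 : c.1 < h.1 + 1 := by exact_mod_cast (by linarith : (c.1 : ℝ) < h.1 + 1)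
  have e2 : h.1 < c.1 + 1 := by exact_mod_cast (by linarith : (h.1 : ℝ) < c.1 + 1)
  have e3 : c.2 < h.2 + 1 := by exact_mod_cast (by linarith : (c.2 : ℝ) < h.2 + 1)
  have e4 : h.2 < c.2 + 1 := by exact_mod_cast (by linarith : (h.2 : ℝ) < c.2 + 1)
  exact hch (Prod.ext (by omega) (by omega))

/-- A lattice point as a point of the plane. -/
def toPlane (p : ℤ × ℤ) : ℝ × ℝ := (p.1, p.2)

theorem isPreconnected_closedSquare (c : ℤ × ℤ) : IsPreconnected (closedSquare c) :=
  isPreconnected_Icc.prod isPreconnected_Icc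

theorem log_eq_of_im_pos {z : ℂ} (h : 0 < z.im) :
    Complex.log z = Complex.log (-z) + Real.pi * Complex.I := by
  rw [Complex.log, Complex.log, norm_neg, Complex.arg_neg_eq_arg_sub_pi_of_im_pos h]
  push_cast; ring

theorem log_eq_of_im_neg {z : ℂ} (h : z.im < 0) :
    Complex.log z = Complex.log (-z) - Real.pi * Complex.I := by
  rw [Complex.log, Complex.log, norm_neg, Complex.arg_neg_eq_arg_add_pi_of_im_neg h]
  push_cast; ring

/-- The cut runs from the centre of `h` to the left, at half-integral height, so vertices never lie
on it. A square to the left of `h` in its row is cut; there the continuous branch log(-z) is used,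
and the integer falls by 1 from the lower to the upper vertices. On every other square the principal
branch is continuous and the integer constant. -/
theorem jump_of_log {h c : ℤ × ℤ} (hch : c ≠ h) {L : ℝ × ℝ → ℂ} (hL : ContinuousOn L (closedSquare c))
    (hexp : ∀ p ∈ closedSquare c, Complex.exp (L p) = relPos h p) {n : ℤ × ℤ → ℤ}
    (hn : ∀ p, toPlane p ∈ closedSquare c →
      L (toPlane p) = Complex.log (relPos h (toPlane p)) + n p * (2 * Real.pi * Complex.I)) :
    n (c + (1, 0)) = n c ∧ n (c + (1, 1)) = n (c + (0, 1)) ∧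
      n (c + (0, 1)) - n c = jump h c ∧ n (c + (1, 1)) - n (c + (1, 0)) = jump h (c + (1, 0)) := by
  have v0 : toPlane c ∈ closedSquare c := by simp [toPlane, mem_closedSquare]
  have v1 : toPlane (c + (1, 0)) ∈ closedSquare c := by simp [toPlane, mem_closedSquare]
  have v2 : toPlane (c + (1, 1)) ∈ closedSquare c := by simp [toPlane, mem_closedSquare]
  have v3 : toPlane (c + (0, 1)) ∈ closedSquare c := by simp [toPlane, mem_closedSquare]
  by_cases hcut : c.2 = h.2 ∧ c.1 < h.1
  · obtain ⟨hc2, hc1⟩ := hcut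
    have hc1' : (c.1 : ℝ) + 1 ≤ h.1 := by exact_mod_cast hc1
    have hc2' : (c.2 : ℝ) = h.2 := by exact_mod_cast hc2
    have hslit : ∀ p ∈ closedSquare c, -relPos h p ∈ Complex.slitPlane := by
      intro p hp
      obtain ⟨⟨p1, p2⟩, p3, p4⟩ := mem_closedSquare.1 hp
      refine Or.inl ?_
      rw [Complex.neg_re, relPos_re]
      linarith
    obtain ⟨m, hm⟩ := exists_int_of_exp_eq_one (isPreconnected_closedSquare c)
      (f := fun p => L p - Complex.log (-relPos h p) - Real.pi * Complex.I)
      ((hL.sub ((continuous_relPos h).neg.continuousOn.clog hslit)).sub continuousOn_const)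
      fun p hp => by
        have h0 := relPos_ne_zero hch hp
        rw [Complex.exp_sub, Complex.exp_sub, hexp p hp, Complex.exp_log (neg_ne_zero.2 h0),
          Complex.exp_pi_mul_I]
        field_simp
    have hup : ∀ q, toPlane q ∈ closedSquare c → q.2 = c.2 + 1 → n q = m := by
      intro q hq hq2
      have h1 := hn q hq
      have h2 := hm _ hq
      have h3 : 0 < (relPos h (toPlane q)).im := by
        rw [relPos_im]; simp only [toPlane, hq2]; push_cast; linarith
      rw [log_eq_of_im_pos h3] at h1
      refine two_pi_I_cancel (z := Complex.log (-relPos h (toPlane q)) + Real.pi * Complex.I) ?_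
      rw [← h1, ← h2]; ring
    have hdown : ∀ q, toPlane q ∈ closedSquare c → q.2 = c.2 → n q = m + 1 := by
      intro q hq hq2
      have h1 := hn q hq
      have h2 := hm _ hq
      have h3 : (relPos h (toPlane q)).im < 0 := by
        rw [relPos_im]; simp only [toPlane, hq2]; linarith
      rw [log_eq_of_im_neg h3] at h1
      refine two_pi_I_cancel (z := Complex.log (-relPos h (toPlane q)) - Real.pi * Complex.I) ?_
      rw [← h1]; push_cast; rw [add_mul, ← h2]; ring
    rw [hdown _ v0 rfl, hdown _ v1 (by simp), hup _ v2 (by simp), hup _ v3 (by simp)]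
    have j1 : jump h c = -1 := if_pos ⟨hc2, hc1.le⟩
    have j2 : jump h (c + (1, 0)) = -1 := if_pos ⟨by simpa using hc2, by simpa using hc1⟩
    rw [j1, j2]
    omega
  · have hslit : ∀ p ∈ closedSquare c, relPos h p ∈ Complex.slitPlane := by
      intro p hp
      obtain ⟨⟨p1, p2⟩, p3, p4⟩ := mem_closedSquare.1 hp
      rw [Complex.mem_slitPlane_iff, relPos_re, relPos_im]
      by_cases h2 : c.2 = h.2
      · left
        have h1 : c.1 ≠ h.1 := fun h1 => hch (Prod.ext h1 h2)
        have h3 : h.1 + 1 ≤ c.1 := by omega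
        have h4 : (h.1 : ℝ) + 1 ≤ c.1 := by exact_mod_cast h3
        linarith
      · right
        rcases lt_or_gt_of_ne h2 with h3 | h3
        · have h4 : (c.2 : ℝ) + 1 ≤ h.2 := by exact_mod_cast h3
          exact (by linarith : p.2 - (h.2 + 1 / 2 : ℝ) < 0).ne
        · have h4 : (h.2 : ℝ) + 1 ≤ c.2 := by exact_mod_cast h3
          exact (by linarith : 0 < p.2 - (h.2 + 1 / 2 : ℝ)).ne'
    obtain ⟨m, hm⟩ := exists_int_of_exp_eq_one (isPreconnected_closedSquare c)
      (f := fun p => L p - Complex.log (relPos h p))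
      (hL.sub ((continuous_relPos h).continuousOn.clog hslit))
      fun p hp => by
        have h0 := relPos_ne_zero hch hp
        rw [Complex.exp_sub, hexp p hp, Complex.exp_log h0, div_self h0]
    have hall : ∀ q, toPlane q ∈ closedSquare c → n q = m := by
      intro q hq
      have h1 := hn q hq
      have h2 := hm _ hq
      refine two_pi_I_cancel (z := Complex.log (relPos h (toPlane q))) ?_
      rw [← h1, ← h2]; ring
    rw [hall _ v0, hall _ v1, hall _ v2, hall _ v3]
    have hch' : ¬ (c.1 = h.1 ∧ c.2 = h.2) := fun h' => hch (Prod.ext h'.1 h'.2)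
    have j1 : jump h c = 0 := if_neg (by omega)
    have j2 : jump h (c + (1, 0)) = 0 := if_neg (by simp only [Prod.fst_add, Prod.snd_add]; omega)
    rw [j1, j2]
    simp

/-- A trapped square `h` has a finite set `H` of squares reachable outside `D`. The logarithm of the
position relative to the centre of `h`, compared with the principal branch at the vertices, gives
the integers excluded by `not_surrounded`. -/
theorem IsBoard.escapes {D : Finset (ℤ × ℤ)} (hD : IsBoard D) : Escapes (D : Set (ℤ × ℤ)) := by
  classical
  intro h hh F
  by_contra hcon
  push Not at hcon
  set H := F.filter fun d => Reach (D : Set (ℤ × ℤ))ᶜ h d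
  have hH : ∀ d, d ∈ H ↔ Reach (D : Set (ℤ × ℤ))ᶜ h d := fun d => by
    rw [Finset.mem_filter]
    exact ⟨fun h' => h'.2, fun h' => ⟨by_contra fun hd => hcon d hd h', h'⟩⟩
  have hne : ∀ c ∈ D, c ≠ h := fun c hc hch => hh (hch ▸ hc)
  obtain ⟨L, hL, hexp⟩ := hD.exists_log (continuous_relPos h) fun p hp => by
    obtain ⟨c, hc, hpc⟩ := mem_region.1 hp
    exact relPos_ne_zero (hne c hc) hpc
  have hex : ∀ p : ℤ × ℤ, ∃ n : ℤ, toPlane p ∈ region D →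
      L (toPlane p) = Complex.log (relPos h (toPlane p)) + n * (2 * Real.pi * Complex.I) := by
    intro p
    by_cases hp : toPlane p ∈ region D
    · obtain ⟨c, hc, hpc⟩ := mem_region.1 hp
      have h0 := relPos_ne_zero (hne c hc) hpc
      obtain ⟨n, hn⟩ := Complex.exp_eq_exp_iff_exists_int.1
        ((hexp _ hp).trans (Complex.exp_log h0).symm)
      exact ⟨n, fun _ => hn⟩
    · exact ⟨0, fun h' => absurd h' hp⟩
  choose n hn using hex
  refine not_surrounded (D := D) (H := H) ((hH h).2 (Reach.refl _ _)) (fun c hc d hcd => ?_) n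
    fun c hc => ?_
  · by_cases hd : d ∈ D
    · exact Or.inr hd
    · exact Or.inl ((hH d).2 (((hH c).1 hc).tail hd hcd))
  · have hsub : closedSquare c ⊆ region D := fun p hp => mem_region.2 ⟨c, hc, hp⟩
    exact jump_of_log (hne c hc) (hL.mono hsub) (fun p hp => hexp p (hsub hp))
      fun p hp => hn p (hsub hp)

theorem IsBoard.isSimple {D : Finset (ℤ × ℤ)} (hD : IsBoard D) : IsSimple D :=
  ⟨hD.nonempty, hD.isConn, hD.escapes⟩

end Quad

namespace Quad

/-! ### Transport of diagonals by symmetries -/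

namespace LatticeIso

/-- The image of a set of squares. -/
def app (g : LatticeIso) (D : Finset (ℤ × ℤ)) : Finset (ℤ × ℤ) := D.map g.cell.toEmbedding

theorem mem_app {g : LatticeIso} {D : Finset (ℤ × ℤ)} {c : ℤ × ℤ} :
    c ∈ g.app D ↔ g.cell.symm c ∈ D := Finset.mem_map_equiv

theorem cell_mem_app {g : LatticeIso} {D : Finset (ℤ × ℤ)} {c : ℤ × ℤ} :
    g.cell c ∈ g.app D ↔ c ∈ D := by simp [mem_app]

theorem app_symm_app (g : LatticeIso) (D : Finset (ℤ × ℤ)) : g.symm.app (g.app D) = D := by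
  ext c
  rw [mem_app]
  exact cell_mem_app

theorem ext_app {g : LatticeIso} {D E : Finset (ℤ × ℤ)}
    (h : ∀ c, g.cell c ∈ E ↔ c ∈ D) : E = g.app D := by
  ext c
  obtain ⟨c, rfl⟩ := g.cell.surjective c
  rw [h, cell_mem_app]

theorem vertices_cell (g : LatticeIso) (c : ℤ × ℤ) :
    vertices (g.cell c) = (vertices c).map g.pt.toEmbedding := by
  ext p
  obtain ⟨p, rfl⟩ := g.pt.surjective p
  rw [g.mem, Finset.mem_map_equiv, Equiv.symm_apply_apply]

theorem vertexSet_app (g : LatticeIso) (D : Finset (ℤ × ℤ)) :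
    vertexSet (g.app D) = (vertexSet D).map g.pt.toEmbedding := by
  ext p
  obtain ⟨p, rfl⟩ := g.pt.surjective p
  rw [Finset.mem_map_equiv, Equiv.symm_apply_apply]
  simp only [vertexSet, Finset.mem_biUnion]
  constructor
  · rintro ⟨c, hc, hp⟩
    obtain ⟨c, rfl⟩ := g.cell.surjective c
    exact ⟨c, cell_mem_app.1 hc, (g.mem _ _).1 hp⟩
  · rintro ⟨c, hc, hp⟩
    exact ⟨_, cell_mem_app.2 hc, (g.mem _ _).2 hp⟩

theorem mem_vertexSet_app {g : LatticeIso} {D : Finset (ℤ × ℤ)} {p : ℤ × ℤ} :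
    g.pt p ∈ vertexSet (g.app D) ↔ p ∈ vertexSet D := by
  rw [vertexSet_app, Finset.mem_map_equiv, Equiv.symm_apply_apply]

theorem squaresAt_app (g : LatticeIso) (D : Finset (ℤ × ℤ)) (p : ℤ × ℤ) :
    squaresAt (g.app D) (g.pt p) = g.app (squaresAt D p) :=
  ext_app fun c => by simp only [squaresAt, Finset.mem_filter, cell_mem_app, g.mem]

theorem isInteriorVertex {g : LatticeIso} {D : Finset (ℤ × ℤ)} {p : ℤ × ℤ} :
    IsInteriorVertex (g.app D) (g.pt p) ↔ IsInteriorVertex D p := by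
  rw [IsInteriorVertex, squaresAt_app, app, Finset.card_map, IsInteriorVertex]

theorem isCorner {g : LatticeIso} {D : Finset (ℤ × ℤ)} {p : ℤ × ℤ} :
    IsCorner (g.app D) (g.pt p) ↔ IsCorner D p := by
  rw [IsCorner, squaresAt_app, app, Finset.card_map, IsCorner]

theorem isBoundaryVertex {g : LatticeIso} {D : Finset (ℤ × ℤ)} {p : ℤ × ℤ} :
    IsBoundaryVertex (g.app D) (g.pt p) ↔ IsBoundaryVertex D p := by
  rw [IsBoundaryVertex, isInteriorVertex, mem_vertexSet_app, IsBoundaryVertex]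

theorem isBoundaryEdge {g : LatticeIso} {D : Finset (ℤ × ℤ)} {p q : ℤ × ℤ} :
    IsBoundaryEdge (g.app D) (g.pt p) (g.pt q) ↔ IsBoundaryEdge D p q := by
  have : (g.app D).filter (fun c => g.pt p ∈ vertices c ∧ g.pt q ∈ vertices c) =
      g.app (D.filter fun c => p ∈ vertices c ∧ q ∈ vertices c) :=
    ext_app fun c => by simp only [Finset.mem_filter, cell_mem_app, g.mem]
  rw [IsBoundaryEdge, this, app, Finset.card_map, g.seg, IsBoundaryEdge]

theorem isBoard {g : LatticeIso} {D : Finset (ℤ × ℤ)} (h : IsBoard D) : IsBoard (g.app D) := by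
  obtain ⟨e⟩ := h
  obtain ⟨f⟩ := g.nonempty_homeomorph D
  exact ⟨f.symm.trans e⟩

theorem isUnionOfBoards {g : LatticeIso} {D : Finset (ℤ × ℤ)} (h : IsUnionOfBoards D) :
    IsUnionOfBoards (g.app D) := by
  classical
  obtain ⟨F, h1, h2, rfl⟩ := h
  refine ⟨F.image g.app, ?_, ?_, ?_⟩
  · intro B hB
    obtain ⟨A, hA, rfl⟩ := Finset.mem_image.1 hB
    exact isBoard (h1 A hA)
  · intro A hA B hB hAB
    obtain ⟨A, hA', rfl⟩ := Finset.mem_image.1 hA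
    obtain ⟨B, hB', rfl⟩ := Finset.mem_image.1 hB
    rw [vertexSet_app, vertexSet_app, ← Finset.map_inter, Finset.card_map]
    exact h2 A hA' B hB' fun h => hAB (by rw [h])
  · refine ext_app fun c => ?_
    simp only [Finset.mem_biUnion, Finset.mem_image, id]
    constructor
    · rintro ⟨B, ⟨A, hA, rfl⟩, hc⟩
      exact ⟨A, hA, cell_mem_app.1 hc⟩
    · rintro ⟨A, hA, hc⟩
      exact ⟨_, ⟨A, hA, rfl⟩, cell_mem_app.2 hc⟩

end LatticeIso

namespace Diagonal

open LatticeIso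

variable {D : Finset (ℤ × ℤ)}

/-- The image of a diagonal by a symmetry. -/
def map (δ : Diagonal D) (g : LatticeIso) : Diagonal (g.app D) where
  k := δ.k
  v i := g.pt (δ.v i)
  k_pos := δ.k_pos
  corner := isCorner.2 δ.corner
  interior i h h' := isInteriorVertex.2 (δ.interior i h h')
  boundary := isBoundaryVertex.2 δ.boundary
  opposite i h := (g.opposite _ _).2 (δ.opposite i h)
  mem i h := by rw [g.squareOn_eq _ _ (δ.opposite i h), cell_mem_app]; exact δ.mem i h
  single i h := by
    rw [g.squareOn_eq _ _ (δ.opposite i (by omega)), g.squareOn_eq _ _ (δ.opposite (i + 1) h),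
      vertices_cell, vertices_cell, ← Finset.map_inter, Finset.card_map]
    exact δ.single i h

variable (δ : Diagonal D) (g : LatticeIso)

theorem map_sq {i : ℕ} (h : i < δ.k) : (δ.map g).sq i = g.cell (δ.sq i) :=
  g.squareOn_eq _ _ (δ.opposite i h)

theorem map_mid (σ : Side) {i : ℕ} (h : i < δ.k) :
    (δ.map g).mid (g.side σ) i = g.pt (δ.mid σ i) :=
  g.sideVertex_eq _ _ _ (δ.opposite i h)

theorem map_flank (σ : Side) {i : ℕ} (h : i < δ.k) :
    (δ.map g).flank (g.side σ) i = g.cell (δ.flank σ i) := by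
  rw [flank, map_sq δ g h, map_mid δ g σ h, flank, g.cell_add]; rfl

theorem map_squares : (δ.map g).squares = g.app δ.squares := by
  refine ext_app fun c => ?_
  simp only [squares, Finset.mem_image, Finset.mem_range]
  refine exists_congr fun i => and_congr_right fun h => ?_
  rw [map_sq δ g h, g.cell.apply_eq_iff_eq]

theorem map_flanks (σ : Side) : (Finset.range (δ.map g).k).image ((δ.map g).flank (g.side σ)) =
    g.app ((Finset.range δ.k).image (δ.flank σ)) := by
  refine ext_app fun c => ?_
  simp only [Finset.mem_image, Finset.mem_range]
  refine exists_congr fun i => and_congr_right fun h => ?_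
  rw [map_flank δ g σ h, g.cell.apply_eq_iff_eq]

theorem mem_map_zigzag (σ : Side) (p : ℤ × ℤ) :
    g.pt p ∈ (δ.map g).zigzag (g.side σ) ↔ p ∈ δ.zigzag σ := by
  simp only [zigzag, Finset.mem_union, Finset.mem_image, Finset.mem_range, Finset.mem_Ioo]
  refine or_congr ?_ ?_
  · refine exists_congr fun i => and_congr_right fun h => ?_
    rw [map_mid δ g σ h, g.pt.apply_eq_iff_eq]
  · refine exists_congr fun i => and_congr_right fun h => ?_
    exact g.pt.apply_eq_iff_eq

theorem map_movedPart (σ : Side) :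
    (δ.map g).movedPart (g.side σ) = g.app (δ.movedPart σ) := by
  classical
  refine ext_app fun c => ?_
  have hmem : ∀ a, g.cell a ∈ g.app D \ (δ.map g).squares ↔ a ∈ D \ δ.squares := fun a => by
    rw [map_squares, Finset.mem_sdiff, Finset.mem_sdiff, cell_mem_app, cell_mem_app]
  simp only [movedPart, Finset.mem_filter]
  refine and_congr (hmem c) (exists_congr fun i => and_congr_right fun h => ?_)
  have h' : i < δ.k := by
    change i + 1 < δ.k at h
    omega
  rw [map_flank δ g σ h']
  constructor
  · intro h
    have := h.lift (p := fun a b => b ∈ D \ δ.squares ∧ ShareSide a b) g.cell.symm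
      fun a b hab => by
        obtain ⟨a, rfl⟩ := g.cell.surjective a
        obtain ⟨b, rfl⟩ := g.cell.surjective b
        rw [Function.onFun, g.cell.symm_apply_apply, g.cell.symm_apply_apply]
        exact ⟨(hmem b).1 hab.1, (g.adj _ _).1 hab.2⟩
    simpa [Function.onFun] using this
  · intro h
    exact h.lift g.cell fun a b hab => ⟨(hmem b).2 hab.1, (g.adj _ _).2 hab.2⟩

theorem map_fixedPart (σ : Side) :
    (δ.map g).fixedPart (g.side σ) = g.app (δ.fixedPart σ) := by
  refine ext_app fun c => ?_
  simp only [fixedPart, ← g.side_opp, map_flanks, map_squares, map_movedPart, Finset.mem_sdiff,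
    cell_mem_app]

theorem map_shift (σ : Side) (p : ℤ × ℤ) : p + (δ.map g).shift (g.side σ) =
    p + (g.pt (δ.mid σ.opp 0) - g.pt (δ.mid σ 0)) := by
  rw [shift, ← g.side_opp, map_mid δ g _ δ.k_pos, map_mid δ g _ δ.k_pos]

theorem cell_mem_map_image (σ : Side) (E : Finset (ℤ × ℤ)) (c : ℤ × ℤ) :
    g.cell c ∈ (g.app E).image (· + (δ.map g).shift (g.side σ)) ↔
      c ∈ E.image (· + δ.shift σ) := by
  simp only [Finset.mem_image]
  constructor
  · rintro ⟨a, ha, hac⟩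
    obtain ⟨a, rfl⟩ := g.cell.surjective a
    refine ⟨a, cell_mem_app.1 ha, g.cell.injective ?_⟩
    rw [← hac, map_shift, shift, g.cell_add]
  · rintro ⟨a, ha, rfl⟩
    refine ⟨_, cell_mem_app.2 ha, ?_⟩
    rw [map_shift, shift, g.cell_add]

theorem pt_mem_map_image (σ : Side) (E E' : Finset (ℤ × ℤ)) (hE : ∀ p, g.pt p ∈ E' ↔ p ∈ E)
    (c : ℤ × ℤ) : g.pt c ∈ E'.image (· + (δ.map g).shift (g.side σ)) ↔
      c ∈ E.image (· + δ.shift σ) := by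
  simp only [Finset.mem_image]
  constructor
  · rintro ⟨a, ha, hac⟩
    obtain ⟨a, rfl⟩ := g.pt.surjective a
    refine ⟨a, (hE a).1 ha, g.pt.injective ?_⟩
    rw [← hac, map_shift, shift, g.pt_add]
  · rintro ⟨a, ha, rfl⟩
    refine ⟨_, (hE a).2 ha, ?_⟩
    rw [map_shift, shift, g.pt_add]

theorem map_cutPaste (σ : Side) :
    (δ.map g).cutPaste (g.side σ) = g.app (δ.cutPaste σ) := by
  refine ext_app fun c => ?_
  rw [cutPaste, Finset.mem_union, map_fixedPart, map_movedPart, cell_mem_app,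
    cell_mem_map_image, cutPaste, Finset.mem_union]

theorem GluesInPlane.of_map {σ : Side} (h : (δ.map g).GluesInPlane (g.side σ)) :
    δ.GluesInPlane σ := by
  intro p hp
  rw [Finset.mem_inter] at hp
  rw [← pt_mem_map_image δ g σ _ _ fun q => mem_map_zigzag δ g σ q]
  refine h (Finset.mem_inter.2 ⟨?_, ?_⟩)
  · rw [map_fixedPart, mem_vertexSet_app]; exact hp.1
  · rw [pt_mem_map_image δ g σ (vertexSet (δ.movedPart σ)) _ fun q => ?_]
    · exact hp.2
    · rw [map_movedPart, mem_vertexSet_app]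

theorem map_isBoundaryEdge_iff (u : ℤ × ℤ) :
    (g.pt u ∈ vertices ((δ.map g).sq ((δ.map g).k - 1)) ∧
      IsBoundaryEdge (g.app D) ((δ.map g).v (δ.map g).k) (g.pt u)) ↔
    (u ∈ vertices (δ.sq (δ.k - 1)) ∧ IsBoundaryEdge D (δ.v δ.k) u) := by
  have hk := δ.k_pos
  change (_ ∈ vertices ((δ.map g).sq (δ.k - 1)) ∧ IsBoundaryEdge _ (g.pt (δ.v δ.k)) _) ↔ _
  rw [map_sq δ g (by omega), g.mem, isBoundaryEdge]

theorem CanCutPaste.of_map {σ : Side} (h : (δ.map g).CanCutPaste (g.side σ)) :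
    δ.CanCutPaste σ := by
  obtain ⟨⟨u, hu⟩, h2⟩ := h
  obtain ⟨u, rfl⟩ := g.pt.surjective u
  refine ⟨⟨u, (map_isBoundaryEdge_iff δ g u).1 hu⟩, fun hbal i hi => ?_⟩
  rw [← cell_mem_app (g := g), ← map_flank δ g _ hi, g.side_opp]
  refine h2 ?_ i hi
  obtain ⟨w, hw, huniq⟩ := hbal
  refine ⟨g.pt w, (map_isBoundaryEdge_iff δ g w).2 hw, fun w' hw' => ?_⟩
  obtain ⟨w', rfl⟩ := g.pt.surjective w'
  rw [huniq w' ((map_isBoundaryEdge_iff δ g w').1 hw')]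

theorem IsExcellentOn.map {δ : Diagonal D} {σ : Side} (h : δ.IsExcellentOn σ) (g : LatticeIso) :
    (δ.map g).IsExcellentOn (g.side σ) := by
  obtain ⟨n, u, ⟨h0, h1, h2, h3, h4, h5⟩, hm⟩ := h
  refine ⟨n, fun j => g.pt (u j), ⟨h0, ?_, ?_, ?_, ?_, fun j hj => isBoundaryEdge.2 (h5 j hj)⟩,
    (g.mono _ _).2 hm⟩
  · simp only [h1]; rfl
  · simp only [h2]; exact (map_mid δ g σ δ.k_pos).symm
  · simp only [h3]; rfl
  · exact fun a ha b hb hab => h4 ha hb (g.pt.injective hab)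

theorem exists_isExcellent_of_app (g : LatticeIso)
    (h : ∃ δ : Diagonal (g.app D), δ.IsExcellent) : ∃ δ : Diagonal D, δ.IsExcellent := by
  obtain ⟨δ, σ, h⟩ := h
  have : ∃ δ : Diagonal (g.symm.app (g.app D)), δ.IsExcellent := ⟨δ.map g.symm, _, h.map g.symm⟩
  rwa [app_symm_app] at this

/-- The conclusion of the theorem on cut and paste. -/
def CutPasteWorks (σ : Side) : Prop :=
  δ.CanCutPaste σ ∧ δ.GluesInPlane σ ∧ IsUnionOfBoards (δ.cutPaste σ)

theorem CutPasteWorks.of_map {σ : Side} (h : (δ.map g).CutPasteWorks (g.side σ)) :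
    δ.CutPasteWorks σ := by
  refine ⟨CanCutPaste.of_map δ g h.1, GluesInPlane.of_map δ g h.2.1, ?_⟩
  have := LatticeIso.isUnionOfBoards (g := g.symm) h.2.2
  rwa [map_cutPaste, app_symm_app] at this

/-! ### Standard position -/

/-- If either coordinate turned back, two consecutive squares would share a side or coincide,
against the single common vertex. So a diagonal is straight. -/
theorem add_two_sub {i : ℕ} (h : i + 1 < δ.k) :
    δ.v (i + 2) - δ.v (i + 1) = δ.v (i + 1) - δ.v i := by
  have h1 := areOpposite_iff.1 (δ.opposite i (by omega))
  have h2 := areOpposite_iff.1 (δ.opposite (i + 1) h)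
  have h3 := δ.single i h
  rw [Finset.card_eq_one] at h3
  obtain ⟨p, hp⟩ := h3
  have key : ∀ q, q ∈ vertices (squareOn (δ.v i) (δ.v (i + 1))) →
      q ∈ vertices (squareOn (δ.v (i + 1)) (δ.v (i + 2))) → q = δ.v (i + 1) := by
    have hv : δ.v (i + 1) ∈ vertices (squareOn (δ.v i) (δ.v (i + 1))) ∩
        vertices (squareOn (δ.v (i + 1)) (δ.v (i + 2))) := by
      rw [show i + 1 + 1 = i + 2 from rfl] at h2
      simp only [Finset.mem_inter, mem_vertices, squareOn]
      omega
    rw [hp, Finset.mem_singleton] at hv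
    intro q hq hq'
    have : q ∈ vertices (squareOn (δ.v i) (δ.v (i + 1))) ∩
        vertices (squareOn (δ.v (i + 1)) (δ.v (i + 2))) := Finset.mem_inter.2 ⟨hq, hq'⟩
    rw [hp, Finset.mem_singleton] at this
    rw [this, hv]
  have k1 := key ((δ.v (i + 2)).1, (δ.v (i + 1)).2)
  have k2 := key ((δ.v (i + 1)).1, (δ.v (i + 2)).2)
  simp only [mem_vertices, squareOn, Prod.ext_iff] at k1 k2
  rw [show i + 1 + 1 = i + 2 from rfl] at h2
  simp only [Prod.ext_iff, Prod.fst_sub, Prod.snd_sub]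
  constructor <;> omega

theorem v_eq {i : ℕ} (h : i ≤ δ.k) :
    (δ.v i).1 = (δ.v 0).1 + i * ((δ.v 1).1 - (δ.v 0).1) ∧
      (δ.v i).2 = (δ.v 0).2 + i * ((δ.v 1).2 - (δ.v 0).2) := by
  have hd : ∀ i, i + 1 ≤ δ.k → δ.v (i + 1) - δ.v i = δ.v 1 - δ.v 0 := by
    intro i
    induction i with
    | zero => intro _; rfl
    | succ i ih => intro h; rw [← ih (by omega)]; exact δ.add_two_sub h
  induction i with
  | zero => simp
  | succ i ih =>
    have h1 := hd i h
    have h2 := ih (by omega)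
    have h3 := congrArg Prod.fst h1
    have h4 := congrArg Prod.snd h1
    simp only [Prod.fst_sub, Prod.snd_sub] at h3 h4
    push_cast
    constructor
    · linear_combination h3 + h2.1
    · linear_combination h4 + h2.2

/-- A translation and sign changes bring the straight diagonal to the points (i, i); the swap fixes
these and exchanges the sides. -/
theorem exists_standard (σ : Side) :
    ∃ g : LatticeIso, g.side σ = .right ∧ ∀ i : ℕ, i ≤ δ.k → (δ.map g).v i = ((i : ℤ), (i : ℤ)) := by
  suffices h : ∃ g : LatticeIso, ∀ i : ℕ, i ≤ δ.k → (δ.map g).v i = ((i : ℤ), (i : ℤ)) by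
    obtain ⟨g, hg⟩ := h
    cases hs : g.side σ
    · refine ⟨g.trans LatticeIso.swap, ?_, fun i hi => ?_⟩
      · change Side.opp (g.side σ) = _
        rw [hs]; rfl
      · have := hg i hi
        change g.pt (δ.v i) = _ at this
        change LatticeIso.swap.pt (g.pt (δ.v i)) = _
        rw [this]; rfl
    · exact ⟨g, hs, hg⟩
  set vrefl := (LatticeIso.swap.trans LatticeIso.reflect).trans LatticeIso.swap
  set t := LatticeIso.translation (-δ.v 0)
  have ht : ∀ p, t.pt p = p - δ.v 0 := fun p => by
    change p + -δ.v 0 = _; abel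
  have h1 := areOpposite_iff.1 (δ.opposite 0 δ.k_pos)
  rw [zero_add] at h1
  have hx : ∀ p, LatticeIso.reflect.pt p = (-p.1, p.2) := fun p => rfl
  have hy : ∀ p, vrefl.pt p = (p.1, -p.2) := fun p => rfl
  rcases h1 with ⟨ha | ha, hb | hb⟩
  · refine ⟨t, fun i hi => ?_⟩
    obtain ⟨e1, e2⟩ := δ.v_eq hi
    rw [ha] at e1; rw [hb] at e2
    change t.pt (δ.v i) = _
    rw [ht, Prod.ext_iff]; simp only [Prod.fst_sub, Prod.snd_sub, e1, e2]; constructor <;> ring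
  · refine ⟨t.trans vrefl, fun i hi => ?_⟩
    obtain ⟨e1, e2⟩ := δ.v_eq hi
    rw [ha] at e1; rw [hb] at e2
    change vrefl.pt (t.pt (δ.v i)) = _
    rw [ht, hy, Prod.ext_iff]; simp only [Prod.fst_sub, Prod.snd_sub, e1, e2]; constructor <;> ring
  · refine ⟨t.trans LatticeIso.reflect, fun i hi => ?_⟩
    obtain ⟨e1, e2⟩ := δ.v_eq hi
    rw [ha] at e1; rw [hb] at e2
    change LatticeIso.reflect.pt (t.pt (δ.v i)) = _
    rw [ht, hx, Prod.ext_iff]; simp only [Prod.fst_sub, Prod.snd_sub, e1, e2]; constructor <;> ring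
  · refine ⟨(t.trans LatticeIso.reflect).trans vrefl, fun i hi => ?_⟩
    obtain ⟨e1, e2⟩ := δ.v_eq hi
    rw [ha] at e1; rw [hb] at e2
    change vrefl.pt (LatticeIso.reflect.pt (t.pt (δ.v i))) = _
    rw [ht, hx, hy, Prod.ext_iff]; simp only [Prod.fst_sub, Prod.snd_sub, e1, e2]
    constructor <;> ring

end Diagonal

end Quad

namespace Quad

/-! ### Diagonals and staircases in standard position -/

theorem squaresAt_eq (D : Finset (ℤ × ℤ)) (x y : ℤ) : squaresAt D (x, y) =
    ({(x, y), (x - 1, y), (x, y - 1), (x - 1, y - 1)} : Finset (ℤ × ℤ)).filter (· ∈ D) := by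
  ext ⟨a, b⟩
  simp only [squaresAt, Finset.mem_filter, mem_vertices, Finset.mem_insert, Finset.mem_singleton,
    Prod.mk.injEq]
  rw [and_comm]
  refine and_congr_left fun _ => ?_
  omega

theorem isInteriorVertex_iff {D : Finset (ℤ × ℤ)} {x y : ℤ} : IsInteriorVertex D (x, y) ↔
    (x, y) ∈ D ∧ (x - 1, y) ∈ D ∧ (x, y - 1) ∈ D ∧ (x - 1, y - 1) ∈ D := by
  have h4 : ({(x, y), (x - 1, y), (x, y - 1), (x - 1, y - 1)} : Finset (ℤ × ℤ)).card = 4 := by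
    rw [Finset.card_insert_of_notMem, Finset.card_insert_of_notMem, Finset.card_insert_of_notMem,
      Finset.card_singleton] <;> simp <;> omega
  rw [IsInteriorVertex, squaresAt_eq]
  constructor
  · intro h
    have := Finset.eq_of_subset_of_card_le (Finset.filter_subset (· ∈ D)
      ({(x, y), (x - 1, y), (x, y - 1), (x - 1, y - 1)} : Finset (ℤ × ℤ))) (by rw [h4, h])
    rw [Finset.filter_eq_self] at this
    exact ⟨this _ (by simp), this _ (by simp), this _ (by simp), this _ (by simp)⟩
  · rintro ⟨h1, h2, h3, h5⟩
    rw [Finset.filter_true_of_mem, h4]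
    intro c hc
    simp only [Finset.mem_insert, Finset.mem_singleton] at hc
    rcases hc with rfl | rfl | rfl | rfl <;> assumption

theorem isCorner_iff_of_mem {D : Finset (ℤ × ℤ)} {x y : ℤ} (h : (x, y) ∈ D) :
    IsCorner D (x, y) ↔ (x - 1, y) ∉ D ∧ (x, y - 1) ∉ D ∧ (x - 1, y - 1) ∉ D := by
  rw [IsCorner, squaresAt_eq, Finset.card_eq_one]
  constructor
  · rintro ⟨c, hc⟩
    have key : ∀ d ∈ ({(x, y), (x - 1, y), (x, y - 1), (x - 1, y - 1)} : Finset (ℤ × ℤ)),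
        d ∈ D → d = c := fun d hd hD => by
      have := Finset.mem_filter.2 ⟨hd, hD⟩
      rwa [hc, Finset.mem_singleton] at this
    have h0 := key (x, y) (by simp) h
    refine ⟨fun h' => ?_, fun h' => ?_, fun h' => ?_⟩ <;>
    · have := key _ (by simp) h'
      rw [← h0] at this
      simp at this
  · rintro ⟨h1, h2, h3⟩
    refine ⟨(x, y), ?_⟩
    ext d
    simp only [Finset.mem_filter, Finset.mem_insert, Finset.mem_singleton]
    constructor
    · rintro ⟨rfl | rfl | rfl | rfl, h'⟩
      exacts [rfl, absurd h' h1, absurd h' h2, absurd h' h3]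
    · rintro rfl
      exact ⟨Or.inl rfl, h⟩

theorem card_filter_pair {D : Finset (ℤ × ℤ)} {c d : ℤ × ℤ} (hcd : c ≠ d)
    {P : ℤ × ℤ → Prop} [DecidablePred P] (hP : ∀ e, P e ↔ e = c ∨ e = d) :
    (D.filter P).card = 1 ↔ (c ∈ D ↔ d ∉ D) := by
  have : D.filter P = ({c, d} : Finset (ℤ × ℤ)).filter (· ∈ D) := by
    ext e
    simp only [Finset.mem_filter, hP, Finset.mem_insert, Finset.mem_singleton]
    exact and_comm
  rw [this, Finset.filter_insert, Finset.filter_singleton]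
  by_cases hc : c ∈ D <;> by_cases hd : d ∈ D <;> simp [hc, hd, hcd]

theorem isBoundaryEdge_horizontal {D : Finset (ℤ × ℤ)} {x y : ℤ} :
    IsBoundaryEdge D (x, y) (x + 1, y) ↔ ((x, y) ∈ D ↔ (x, y - 1) ∉ D) := by
  rw [IsBoundaryEdge, card_filter_pair (c := (x, y)) (d := (x, y - 1)) (by simp; omega)]
  · simp [IsSegment]
  · rintro ⟨a, b⟩
    simp only [mem_vertices, Prod.mk.injEq]
    omega

theorem isBoundaryEdge_vertical {D : Finset (ℤ × ℤ)} {x y : ℤ} :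
    IsBoundaryEdge D (x, y) (x, y + 1) ↔ ((x, y) ∈ D ↔ (x - 1, y) ∉ D) := by
  rw [IsBoundaryEdge, card_filter_pair (c := (x, y)) (d := (x - 1, y)) (by simp; omega)]
  · simp [IsSegment]
  · rintro ⟨a, b⟩
    simp only [mem_vertices, Prod.mk.injEq]
    omega

theorem IsBoundaryEdge.symm {D : Finset (ℤ × ℤ)} {p q : ℤ × ℤ} (h : IsBoundaryEdge D p q) :
    IsBoundaryEdge D q p := by
  refine ⟨ShareSide.symm h.1, ?_⟩
  rw [← h.2]
  congr 1
  ext c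
  simp only [Finset.mem_filter, and_comm (a := p ∈ vertices c)]

/-- The diagonal of `D` with the vertices `(i, i)`, `0 ≤ i ≤ k`. -/
structure IsStdDiagonal (D : Finset (ℤ × ℤ)) (k : ℤ) : Prop where
  pos : 0 < k
  diag : ∀ i, 0 ≤ i → i < k → (i, i) ∈ D
  right : ∀ i, 0 ≤ i → i + 1 < k → (i + 1, i) ∈ D
  left : ∀ i, 0 ≤ i → i + 1 < k → (i, i + 1) ∈ D
  west : (-1, 0) ∉ D
  south : (0, -1) ∉ D
  southwest : (-1, -1) ∉ D
  last : ¬ ((k, k) ∈ D ∧ (k - 1, k) ∈ D ∧ (k, k - 1) ∈ D)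

/-- `(X j, j - X j)`, `0 ≤ j ≤ 2 * k`, are the vertices of a monotonic boundary path from `(0, 0)`
to `(k, k)` that has `D` on its left. -/
structure IsStair (D : Finset (ℤ × ℤ)) (k : ℤ) (X : ℤ → ℤ) : Prop where
  zero : X 0 = 0
  step : ∀ j, 0 ≤ j → j < 2 * k →
    (X (j + 1) = X j + 1 ∧ (X j, j - X j) ∈ D ∧ (X j, j - X j - 1) ∉ D) ∨
    (X (j + 1) = X j ∧ (X j, j - X j) ∉ D ∧ (X j - 1, j - X j) ∈ D)
  last : X (2 * k) = k

/-- The diagonal `δ` has the vertices `(i, i)`. -/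
def Diagonal.IsStd {D : Finset (ℤ × ℤ)} (δ : Diagonal D) : Prop :=
  ∀ i : ℕ, i ≤ δ.k → δ.v i = ((i : ℤ), (i : ℤ))

namespace Diagonal

variable {D : Finset (ℤ × ℤ)} {δ : Diagonal D}

theorem IsStd.sq (h : δ.IsStd) {i : ℕ} (hi : i < δ.k) : δ.sq i = ((i : ℤ), (i : ℤ)) := by
  rw [Diagonal.sq, h i hi.le, h (i + 1) hi]
  simp [squareOn]

theorem IsStd.mid_right (h : δ.IsStd) {i : ℕ} (hi : i < δ.k) :
    δ.mid .right i = ((i : ℤ) + 1, (i : ℤ)) := by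
  rw [Diagonal.mid, h i hi.le, h (i + 1) hi]
  simp [sideVertex, rightVertex]

theorem IsStd.mid_left (h : δ.IsStd) {i : ℕ} (hi : i < δ.k) :
    δ.mid .left i = ((i : ℤ), (i : ℤ) + 1) := by
  rw [Diagonal.mid, h i hi.le, h (i + 1) hi]
  simp [sideVertex, rightVertex]

theorem IsStd.flank_right (h : δ.IsStd) {i : ℕ} (hi : i < δ.k) :
    δ.flank .right i = ((i : ℤ) + 1, (i : ℤ)) := by
  rw [Diagonal.flank, h.sq hi, h.mid_right hi, h i hi.le]
  simp

theorem IsStd.flank_left (h : δ.IsStd) {i : ℕ} (hi : i < δ.k) :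
    δ.flank .left i = ((i : ℤ), (i : ℤ) + 1) := by
  rw [Diagonal.flank, h.sq hi, h.mid_left hi, h i hi.le]
  simp

theorem IsStd.isStdDiagonal (h : δ.IsStd) : IsStdDiagonal D δ.k := by
  have hk := δ.k_pos
  have hdiag : ∀ i : ℤ, 0 ≤ i → i < δ.k → (i, i) ∈ D := by
    intro i h0 hi
    obtain ⟨n, rfl⟩ := Int.eq_ofNat_of_zero_le h0
    have hn : n < δ.k := by omega
    have := δ.mem n hn
    rwa [← Diagonal.sq, h.sq hn] at this
  have hint : ∀ i : ℤ, 0 ≤ i → i + 1 < δ.k → IsInteriorVertex D (i + 1, i + 1) := by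
    intro i h0 hi
    obtain ⟨n, rfl⟩ := Int.eq_ofNat_of_zero_le h0
    have := δ.interior (n + 1) (by omega) (by omega)
    rw [h (n + 1) (by omega)] at this
    exact_mod_cast this
  have hc := δ.corner
  rw [h 0 (by omega), Nat.cast_zero, isCorner_iff_of_mem (hdiag 0 le_rfl (by omega))] at hc
  have hb := δ.boundary.2
  rw [h _ le_rfl, isInteriorVertex_iff] at hb
  refine ⟨by omega, hdiag, fun i h0 hi => ?_, fun i h0 hi => ?_, by simpa using hc.1,
    by simpa using hc.2.1, by simpa using hc.2.2, fun hl => hb ⟨hl.1, hl.2.1, hl.2.2,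
      hdiag _ (by omega) (by omega)⟩⟩
  · have := (isInteriorVertex_iff.1 (hint i h0 hi)).2.2.1
    simpa using this
  · have := (isInteriorVertex_iff.1 (hint i h0 hi)).2.1
    simpa using this

/-- A monotonic boundary arc on the right is a staircase. -/
theorem IsStd.exists_isStair (h : δ.IsStd) (hD : IsSimple D) (he : δ.IsExcellentOn .right) :
    ∃ X, IsStair D δ.k X := by
  have hstd := h.isStdDiagonal
  have hk := δ.k_pos
  obtain ⟨n, u, ⟨hn, h0, h1, hlast, -, hedge⟩, hm1, hm2⟩ := he
  rw [h 0 (by omega)] at h0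
  rw [h.mid_right hk] at h1
  rw [h _ le_rfl] at hlast
  have mono1 : ∀ j, j < n → (u j).1 ≤ (u (j + 1)).1 := by
    rcases hm1 with hm | hm
    · exact fun j hj => hm (Set.mem_Iic.2 hj.le) (Set.mem_Iic.2 hj) (Nat.le_succ j)
    · have := hm (Set.mem_Iic.2 (Nat.zero_le n)) (Set.mem_Iic.2 le_rfl) (Nat.zero_le n)
      simp only [h0, hlast] at this
      omega
  have mono2 : ∀ j, j < n → (u j).2 ≤ (u (j + 1)).2 := by
    rcases hm2 with hm | hm
    · exact fun j hj => hm (Set.mem_Iic.2 hj.le) (Set.mem_Iic.2 hj) (Nat.le_succ j)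
    · have := hm (Set.mem_Iic.2 (Nat.zero_le n)) (Set.mem_Iic.2 le_rfl) (Nat.zero_le n)
      simp only [h0, hlast] at this
      omega
  have hstep : ∀ j, j < n → (u (j + 1) = ((u j).1 + 1, (u j).2) ∨
      u (j + 1) = ((u j).1, (u j).2 + 1)) := by
    intro j hj
    have hs := shareSide_iff.1 (hedge j hj).1
    have a1 := mono1 j hj
    have a2 := mono2 j hj
    simp only [Prod.ext_iff]
    omega
  have hsum : ∀ j, j ≤ n → (u j).1 + (u j).2 = j := by
    intro j
    induction j with
    | zero => intro _; simp [h0]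
    | succ j ih =>
      intro hj
      have := ih (by omega)
      rcases hstep j hj with h' | h' <;> rw [h'] <;> push_cast <;> omega
  have hn2 : (n : ℤ) = 2 * δ.k := by
    have := hsum n le_rfl
    rw [hlast] at this
    simp only at this
    omega
  -- A boundary side has `D` on one of its sides only. The first one has it on the left, and at each
  -- later vertex a switch would produce a pinched vertex or contradict the preceding side.
  have key : ∀ j, j < n →
      (u (j + 1) = ((u j).1 + 1, (u j).2) ∧ u j ∈ D ∧ ((u j).1, (u j).2 - 1) ∉ D) ∨
      (u (j + 1) = ((u j).1, (u j).2 + 1) ∧ u j ∉ D ∧ ((u j).1 - 1, (u j).2) ∈ D) := by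
    intro j
    induction j with
    | zero =>
      intro _
      left
      rw [h1, h0]
      exact ⟨rfl, hstd.diag 0 le_rfl (by omega), hstd.south⟩
    | succ j ih =>
      intro hj
      have hprev := ih (by omega)
      have hedge1 := hedge (j + 1) hj
      rcases hstep (j + 1) hj with h' | h'
      · left
        refine ⟨h', ?_⟩
        rw [h'] at hedge1
        generalize u j = p at *
        generalize u (j + 1) = q at *
        obtain ⟨x, y⟩ := p
        obtain ⟨x', y'⟩ := q
        rw [isBoundaryEdge_horizontal] at hedge1
        simp only [Prod.mk.injEq] at hprev ⊢
        have pinch := (hD.no_pinch x (y - 1)).2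
        rw [sub_add_cancel] at pinch
        rcases hprev with ⟨⟨rfl, rfl⟩, p1, p2⟩ | ⟨⟨rfl, rfl⟩, p1, p2⟩
        · tauto
        · rw [add_sub_cancel_right] at hedge1 ⊢
          tauto
      · right
        refine ⟨h', ?_⟩
        rw [h'] at hedge1
        generalize u j = p at *
        generalize u (j + 1) = q at *
        obtain ⟨x, y⟩ := p
        obtain ⟨x', y'⟩ := q
        rw [isBoundaryEdge_vertical] at hedge1
        simp only [Prod.mk.injEq] at hprev ⊢
        have pinch := (hD.no_pinch (x - 1) y).1
        rw [sub_add_cancel] at pinch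
        rcases hprev with ⟨⟨rfl, rfl⟩, p1, p2⟩ | ⟨⟨rfl, rfl⟩, p1, p2⟩
        · rw [add_sub_cancel_right] at hedge1 ⊢
          tauto
        · tauto
  refine ⟨fun j => (u j.toNat).1, by simp [h0], fun j hj0 hj => ?_, ?_⟩
  · obtain ⟨m, rfl⟩ := Int.eq_ofNat_of_zero_le hj0
    have hm : m < n := by omega
    have e1 : ((m : ℤ) + 1).toNat = m + 1 := by omega
    simp only [e1, Int.toNat_natCast]
    have hs := hsum m hm.le
    have e2 : (m : ℤ) - (u m).1 = (u m).2 := by omega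
    rw [e2]
    rcases key m hm with ⟨a, b, c⟩ | ⟨a, b, c⟩
    · left; rw [a]; exact ⟨rfl, b, c⟩
    · right; rw [a]; exact ⟨rfl, b, c⟩
  · have : (2 * (δ.k : ℤ)).toNat = n := by omega
    simp only [this, hlast]

end Diagonal

theorem IsStdDiagonal.exists_diagonal {D : Finset (ℤ × ℤ)} {k : ℤ} (h : IsStdDiagonal D k) :
    ∃ δ : Diagonal D, δ.IsStd ∧ (δ.k : ℤ) = k := by
  have hpos := h.pos
  obtain ⟨n, rfl⟩ := Int.eq_ofNat_of_zero_le hpos.le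
  have hsq : ∀ i : ℕ, squareOn ((i : ℤ), (i : ℤ)) (((i + 1 : ℕ) : ℤ), ((i + 1 : ℕ) : ℤ)) =
      ((i : ℤ), (i : ℤ)) := fun i => by simp [squareOn]
  refine ⟨⟨n, fun i => (i, i), by omega, ?_, fun i h0 hi => ?_, ⟨?_, ?_⟩, fun i hi => ?_,
    fun i hi => ?_, fun i hi => ?_⟩, fun i hi => rfl, rfl⟩
  · rw [Nat.cast_zero, isCorner_iff_of_mem (h.diag 0 le_rfl hpos)]
    exact ⟨by simpa using h.west, by simpa using h.south, by simpa using h.southwest⟩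
  · rw [isInteriorVertex_iff]
    have e1 := h.right (i - 1) (by omega) (by omega)
    have e2 := h.left (i - 1) (by omega) (by omega)
    rw [sub_add_cancel] at e1 e2
    exact ⟨h.diag _ (by omega) (by omega), e2, e1, h.diag _ (by omega) (by omega)⟩
  · rw [vertexSet, Finset.mem_biUnion]
    refine ⟨_, h.diag (n - 1) (by omega) (by omega), ?_⟩
    simp [mem_vertices]
  · rw [isInteriorVertex_iff]
    exact fun h' => h.last ⟨h'.1, h'.2.1, h'.2.2.1⟩
  · rw [areOpposite_iff]; push_cast; omega
  · rw [hsq]; exact h.diag _ (by omega) (by omega)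
  · rw [hsq, hsq (i + 1), Finset.card_eq_one]
    refine ⟨(((i + 1 : ℕ) : ℤ), ((i + 1 : ℕ) : ℤ)), ?_⟩
    ext ⟨x, y⟩
    simp only [Finset.mem_inter, mem_vertices, Finset.mem_singleton, Prod.mk.injEq]
    omega

theorem IsStair.exists_isExcellent {D : Finset (ℤ × ℤ)} {k : ℤ} (h : IsStdDiagonal D k)
    {X : ℤ → ℤ} (hX : IsStair D k X) : ∃ δ : Diagonal D, δ.IsExcellent := by
  have hpos := h.pos
  obtain ⟨δ, hδ, hk⟩ := h.exists_diagonal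
  have hstep : ∀ j : ℕ, j < 2 * δ.k → (X (j + 1) = X j + 1 ∨ X (j + 1) = X j) := fun j hj =>
    (hX.step j (by omega) (by omega)).imp And.left And.left
  have hm1 : MonotoneOn (fun j : ℕ => X j) (Set.Iic (2 * δ.k)) := by
    refine monotoneOn_of_le_succ Set.ordConnected_Iic fun j _ _ hj => ?_
    rw [Order.succ_eq_add_one, Set.mem_Iic] at hj
    rw [Order.succ_eq_add_one]
    push_cast
    rcases hstep j hj with h' | h' <;> omega
  have hm2 : MonotoneOn (fun j : ℕ => (j : ℤ) - X j) (Set.Iic (2 * δ.k)) := by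
    refine monotoneOn_of_le_succ Set.ordConnected_Iic fun j _ _ hj => ?_
    rw [Order.succ_eq_add_one, Set.mem_Iic] at hj
    rw [Order.succ_eq_add_one]
    push_cast
    rcases hstep j hj with h' | h' <;> omega
  refine ⟨δ, .right, 2 * δ.k, fun j => (X j, j - X j), ⟨by omega, ?_, ?_, ?_, ?_, ?_⟩,
    Or.inl hm1, Or.inl hm2⟩
  · rw [hδ 0 (by omega)]; simp [hX.zero]
  · rw [hδ.mid_right (by omega)]
    rcases hX.step 0 le_rfl (by omega) with ⟨h', -⟩ | ⟨-, h', -⟩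
    · rw [zero_add, hX.zero] at h'
      simp [h']
    · rw [hX.zero] at h'
      exact absurd (h.diag 0 le_rfl hpos) h'
  · rw [hδ _ le_rfl]
    push_cast
    rw [hk, hX.last]
    ext <;> simp; omega
  · intro a _ b _ hab
    simp only [Prod.mk.injEq] at hab
    omega
  · intro j hj
    push_cast
    rcases hX.step j (by omega) (by omega) with ⟨h1, h2, h3⟩ | ⟨h1, h2, h3⟩
    · rw [h1, show (j : ℤ) + 1 - (X j + 1) = j - X j by ring, isBoundaryEdge_horizontal]
      tauto
    · rw [h1, show (j : ℤ) + 1 - X j = j - X j + 1 by ring, isBoundaryEdge_vertical]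
      tauto

end Quad

namespace Quad

/-! ### Cut and paste along an excellent diagonal in standard position -/

namespace IsStair

variable {D : Finset (ℤ × ℤ)} {k : ℤ} {X : ℤ → ℤ}

theorem mono (hX : IsStair D k X) {i j : ℤ} (hi : 0 ≤ i) (hij : i ≤ j) (hj : j ≤ 2 * k) :
    X i ≤ X j ∧ X j ≤ X i + (j - i) := by
  induction j, hij using Int.leInduction with
  | base => omega
  | succ j hij ih =>
    have := ih (by omega)
    rcases hX.step j (by omega) (by omega) with ⟨h, -⟩ | ⟨h, -⟩ <;> omega

theorem bounds (hX : IsStair D k X) {j : ℤ} (hi : 0 ≤ j) (hj : j ≤ 2 * k) :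
    0 ≤ X j ∧ X j ≤ j ∧ X j ≤ k ∧ j ≤ X j + k := by
  have h1 := hX.mono le_rfl hi hj
  have h2 := hX.mono hi hj le_rfl
  rw [hX.zero] at h1
  rw [hX.last] at h2
  omega

/-- The path starts to the right and cannot return to the diagonal before its end: the intermediate
vertices of the diagonal are interior, so no boundary side leaves them. -/
theorem below (hs : IsStdDiagonal D k) (hX : IsStair D k X) {j : ℤ} (h0 : 0 < j)
    (hj : j < 2 * k) : j < 2 * X j := by
  induction j, (show 1 ≤ j from h0) using Int.leInduction with
  | base =>
    have := hs.diag 0 le_rfl hs.pos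
    rcases hX.step 0 le_rfl (by omega) with ⟨h, -⟩ | ⟨-, h, -⟩
    · rw [hX.zero, zero_add] at h; omega
    · rw [hX.zero] at h; exact absurd this h
  | succ j hij ih =>
    have ih := ih (by omega) (by omega)
    have h1 : 2 * X (j + 1) ≠ j + 1 := by
      intro h
      have h2 : j + 1 - X (j + 1) = X (j + 1) := by omega
      have e1 := hs.diag (X (j + 1)) (by omega) (by omega)
      have e2 := hs.right (X (j + 1) - 1) (by omega) (by omega)
      rw [sub_add_cancel] at e2
      rcases hX.step (j + 1) (by omega) hj with ⟨-, -, h'⟩ | ⟨-, h', -⟩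
      · rw [h2] at h'; exact h' e2
      · rw [h2] at h'; exact h' e1
    rcases hX.step j (by omega) (by omega) with ⟨h, -⟩ | ⟨h, -⟩ <;> omega

/-- The square with the staircase vertex as lower right corner lies to the left of an adjacent step,
except where an upward step is followed by one to the right; there the absence of pinched vertices
supplies it. It makes the ribbon a subset of `D` except possibly at `j = 2 * k`. -/
theorem west (hD : IsSimple D) (hX : IsStair D k X) {j : ℤ} (h0 : 0 < j) (hj : j < 2 * k) :
    (X j - 1, j - X j) ∈ D := by
  rcases hX.step j h0.le hj with ⟨-, h1, h2⟩ | ⟨-, -, h⟩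
  · have hp := hX.step (j - 1) (by omega) (by omega)
    rw [sub_add_cancel] at hp
    rcases hp with ⟨h3, h4, -⟩ | ⟨h3, h4, h5⟩
    · rw [show X j - 1 = X (j - 1) by omega, show j - X j = j - 1 - X (j - 1) by omega]
      exact h4
    · rw [← h3] at h4 h5
      have pinch := (hD.no_pinch (X j - 1) (j - X j - 1)).1
      rw [sub_add_cancel, sub_add_cancel] at pinch
      rw [show j - 1 - X j = j - X j - 1 by ring] at h4 h5
      tauto
  · exact h

/-- The squares between the diagonal and the staircase. -/
def part (k : ℤ) (X : ℤ → ℤ) : Set (ℤ × ℤ) :=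
  {c | 0 ≤ c.2 ∧ c.2 < c.1 ∧ c.1 + c.2 + 1 ≤ 2 * k ∧ c.1 < X (c.1 + c.2 + 1)}

theorem mem_part {a b : ℤ} : (a, b) ∈ part k X ↔
    0 ≤ b ∧ b < a ∧ a + b + 1 ≤ 2 * k ∧ a < X (a + b + 1) := Iff.rfl

/-- The region is fenced by the diagonal and the staircase. Across the staircase one passes from a
square of `D` to one outside; recording both facts excludes walks inside `D` as well as walks inside
its complement. -/
theorem part_neighbour (hD : IsSimple D) (hX : IsStair D k X) {c d : ℤ × ℤ} (hc : c ∈ part k X)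
    (hcd : ShareSide c d) :
    d ∈ part k X ∨ (d.1 = d.2 ∧ 0 ≤ d.1 ∧ d.1 < k) ∨ (d ∉ D ∧ c ∈ D) := by
  obtain ⟨a, b⟩ := c
  obtain ⟨a', b'⟩ := d
  rw [mem_part] at hc
  obtain ⟨h0, h1, h2, h3⟩ := hc
  rw [shareSide_iff] at hcd
  have hb := hX.bounds (j := a + b + 1) (by omega) h2
  have hb' := hX.bounds (j := a + b) (by omega) (by omega)
  have s1 := hX.step (a + b) (by omega) (by omega)
  have s2 := hX.step (a + b + 1) (by omega) (by omega)
  simp only at hcd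
  rcases hcd with ⟨rfl, rfl⟩ | ⟨rfl, rfl⟩ | ⟨rfl, rfl⟩ | ⟨rfl, rfl⟩
  · rw [mem_part, show a + 1 + b' + 1 = a + b' + 1 + 1 by ring]
    have hw := hX.west hD (j := a + b' + 1) (by omega) (by omega)
    by_cases hx : X (a + b' + 1) = a + 1
    · rw [hx, show a + b' + 1 - (a + 1) = b' by ring, add_sub_cancel_right] at s2
      rw [hx, show a + b' + 1 - (a + 1) = b' by ring, add_sub_cancel_right] at hw
      rcases s2 with ⟨e1, e2, e3⟩ | ⟨e1, e2, e3⟩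
      · left; omega
      · right; right; exact ⟨e2, hw⟩
    · left
      rcases s2 with ⟨e1, e2, e3⟩ | ⟨e1, e2, e3⟩ <;> omega
  · rw [mem_part, show a - 1 + b' + 1 = a + b' by ring]
    by_cases hx : b' = a - 1
    · right; left; omega
    · left
      rcases s1 with ⟨e1, e2, e3⟩ | ⟨e1, e2, e3⟩ <;> omega
  · rw [mem_part, show a' + (b + 1) + 1 = a' + b + 1 + 1 by ring]
    by_cases hx : b + 1 = a'
    · right; left; omega
    · left
      rcases s2 with ⟨e1, e2, e3⟩ | ⟨e1, e2, e3⟩ <;> omega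
  · rw [mem_part, show a' + (b - 1) + 1 = a' + b by ring]
    by_cases hx : X (a' + b) = a'
    · rw [hx, add_sub_cancel_left] at s1
      rcases s1 with ⟨e1, e2, e3⟩ | ⟨e1, e2, e3⟩
      · right; right; exact ⟨e3, e2⟩
      · omega
    · left
      rcases s1 with ⟨e1, e2, e3⟩ | ⟨e1, e2, e3⟩ <;> omega

/-- A missing square in the region could not leave it without entering `D`, so it would be a hole.
-/
theorem part_subset (hD : IsSimple D) (hs : IsStdDiagonal D k) (hX : IsStair D k X) {c : ℤ × ℤ}
    (hc : c ∈ part k X) : c ∈ D := by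
  by_contra hcD
  obtain ⟨d, hd, hcd⟩ := hD.escapes c hcD (Finset.Icc 0 (2 * k) ×ˢ Finset.Icc 0 (2 * k))
  refine hd ?_
  have hdm : d ∈ part k X ∩ (D : Set (ℤ × ℤ))ᶜ := by
    refine hcd.invariant (R := part k X ∩ (D : Set (ℤ × ℤ))ᶜ) ⟨hc, hcD⟩ ?_
    rintro x ⟨hx, hxD⟩ y hy hxy
    refine ⟨?_, hy⟩
    rcases hX.part_neighbour hD hx hxy with h | ⟨h1, h2, h3⟩ | ⟨-, h⟩
    · exact h
    · refine absurd (hs.diag y.1 h2 h3) ?_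
      have : y = (y.1, y.1) := Prod.ext rfl h1.symm
      rw [← this]; exact hy
    · exact absurd h hxD
  obtain ⟨a, b⟩ := d
  obtain ⟨h0, h1, h2, -⟩ := mem_part.1 hdm.1
  rw [Finset.mem_product, Finset.mem_Icc, Finset.mem_Icc]
  simp only
  omega

theorem flank_mem_part (hs : IsStdDiagonal D k) (hX : IsStair D k X) {i : ℤ} (h0 : 0 ≤ i)
    (hi : i + 1 < k) : (i + 1, i) ∈ part k X := by
  have := hX.below hs (j := i + 1 + i + 1) (by omega) (by omega)
  rw [mem_part]
  omega

/-- The squares to the left of the vertices of the staircase. -/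
def ribbon (k : ℤ) (X : ℤ → ℤ) : Set (ℤ × ℤ) :=
  {c | ∃ j, 0 < j ∧ j ≤ 2 * k ∧ c = (X j - 1, j - X j)}

theorem mem_ribbon {a b : ℤ} : (a, b) ∈ ribbon k X ↔
    0 < a + b + 1 ∧ a + b + 1 ≤ 2 * k ∧ a + 1 = X (a + b + 1) := by
  constructor
  · rintro ⟨j, h0, hj, h⟩
    rw [Prod.mk.injEq] at h
    obtain rfl : j = a + b + 1 := by omega
    omega
  · rintro ⟨h0, h1, h2⟩
    refine ⟨_, h0, h1, ?_⟩
    rw [Prod.mk.injEq]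
    omega

/-- The squares of the diagonal, of the left flanks and between the diagonal and the staircase. -/
def band (k : ℤ) (X : ℤ → ℤ) : Set (ℤ × ℤ) :=
  {c | 0 ≤ c.1 ∧ 0 ≤ c.2 ∧ c.2 ≤ c.1 + 1 ∧ c.1 + c.2 + 1 ≤ 2 * k ∧ c.1 < X (c.1 + c.2 + 1)}

theorem mem_band {a b : ℤ} : (a, b) ∈ band k X ↔
    0 ≤ a ∧ 0 ≤ b ∧ b ≤ a + 1 ∧ a + b + 1 ≤ 2 * k ∧ a < X (a + b + 1) := Iff.rfl

theorem mem_band_iff (hs : IsStdDiagonal D k) (hX : IsStair D k X) {a b : ℤ} :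
    (a, b) ∈ band k X ↔ (0 ≤ a ∧ a < k ∧ b = a) ∨ (0 ≤ a ∧ a < k ∧ b = a + 1) ∨
      (a, b) ∈ part k X := by
  rw [mem_part, mem_band]
  constructor
  · intro h
    omega
  · rintro (⟨h0, h1, rfl⟩ | ⟨h0, h1, rfl⟩ | h)
    · have := hX.below hs (j := b + b + 1) (by omega) (by omega)
      omega
    · by_cases hk : a + 1 = k
      · have := hX.last
        rw [show a + (a + 1) + 1 = 2 * k by omega]
        omega
      · have := hX.below hs (j := a + (a + 1) + 1) (by omega) (by omega)
        omega
    · omega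

/-- The translate of the squares between the diagonal and the staircase. -/
theorem shifted_part_iff (hX : IsStair D k X) {a b : ℤ} :
    (a + 1, b - 1) ∈ part k X ↔ (a, b) ∈ band k X ∧ (a, b) ∉ ribbon k X := by
  rw [mem_part, mem_band, mem_ribbon, show a + 1 + (b - 1) + 1 = a + b + 1 by ring]
  constructor
  · intro h
    omega
  · rintro ⟨h1, h2⟩
    have := hX.bounds (j := a + b + 1) (by omega) (by omega)
    omega

theorem ribbon_subset_band (hs : IsStdDiagonal D k) (hX : IsStair D k X) :
    ribbon k X ⊆ band k X := by
  rintro ⟨a, b⟩ h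
  rw [mem_ribbon] at h
  rw [mem_band]
  have hb := hX.bounds (j := a + b + 1) (by omega) (by omega)
  by_cases hj : a + b + 1 = 2 * k
  · have := hX.last
    rw [← hj] at this
    omega
  · have := hX.below hs (j := a + b + 1) (by omega) (by omega)
    omega

theorem shifted_part_subset (hD : IsSimple D) (hs : IsStdDiagonal D k) (hX : IsStair D k X)
    {a b : ℤ} (h : (a + 1, b - 1) ∈ part k X) : (a, b) ∈ D := by
  have hb := ((shifted_part_iff hX).1 h).1
  rcases (hX.mem_band_iff hs).1 hb with ⟨h0, h1, rfl⟩ | ⟨h0, h1, rfl⟩ | hp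
  · exact hs.diag _ h0 h1
  · have h2 := mem_part.1 h
    rw [show a + 1 + (a + 1 - 1) + 1 = 2 * (a + 1) by ring] at h2
    have h3 := hX.bounds (j := 2 * (a + 1)) (by omega) (by omega)
    exact hs.left _ h0 (by omega)
  · exact hX.part_subset hD hs hp

end IsStair

end Quad

/-! ### Cut and paste as the removal of the ribbon -/

namespace Quad

namespace Diagonal

variable {D : Finset (ℤ × ℤ)} {δ : Diagonal D} {X : ℤ → ℤ}

theorem IsStd.mem_squares (h : δ.IsStd) {a b : ℤ} :
    (a, b) ∈ δ.squares ↔ 0 ≤ a ∧ a < δ.k ∧ b = a := by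
  simp only [squares, Finset.mem_image, Finset.mem_range]
  constructor
  · rintro ⟨i, hi, hs⟩
    rw [h.sq hi, Prod.mk.injEq] at hs
    omega
  · rintro ⟨h0, h1, rfl⟩
    refine ⟨b.toNat, by omega, ?_⟩
    rw [h.sq (by omega), Int.toNat_of_nonneg h0]

theorem IsStd.mem_left_flanks (h : δ.IsStd) {a b : ℤ} :
    (a, b) ∈ (Finset.range δ.k).image (δ.flank .left) ↔ 0 ≤ a ∧ a < δ.k ∧ b = a + 1 := by
  simp only [Finset.mem_image, Finset.mem_range]
  constructor
  · rintro ⟨i, hi, hs⟩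
    rw [h.flank_left hi, Prod.mk.injEq] at hs
    omega
  · rintro ⟨h0, h1, rfl⟩
    refine ⟨a.toNat, by omega, ?_⟩
    rw [h.flank_left (by omega), Int.toNat_of_nonneg h0]

/-- A walk from a right flank that avoids the diagonal is confined by the fence; conversely the row
of a square of the region leads inside the region to the flank `(b + 1, b)`. -/
theorem IsStd.mem_movedPart (h : δ.IsStd) (hD : IsSimple D) (hX : IsStair D δ.k X) {c : ℤ × ℤ} :
    c ∈ δ.movedPart .right ↔ c ∈ IsStair.part δ.k X := by
  have hs := h.isStdDiagonal
  simp only [movedPart, Finset.mem_filter, Finset.mem_sdiff]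
  have hdisj : ∀ c ∈ IsStair.part δ.k X, c ∉ δ.squares := by
    rintro ⟨a, b⟩ hc hc'
    have h1 := IsStair.mem_part.1 hc
    have h2 := h.mem_squares.1 hc'
    omega
  constructor
  · rintro ⟨-, i, hi, hreach⟩
    have hreach' : Reach ((D \ δ.squares : Finset (ℤ × ℤ)) : Set (ℤ × ℤ)) (δ.flank .right i) c :=
      Relation.ReflTransGen.mono (fun x y hxy => ⟨by simpa using hxy.1, hxy.2⟩) _ _ hreach
    refine hreach'.invariant ?_ ?_
    · rw [h.flank_right (by omega)]
      exact hX.flank_mem_part hs (by omega) (by omega)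
    · rintro x hx ⟨a, b⟩ hy hxy
      rw [Finset.mem_coe, Finset.mem_sdiff] at hy
      rcases hX.part_neighbour hD hx hxy with h' | ⟨h1, h2, h3⟩ | ⟨h', -⟩
      · exact h'
      · exact absurd (h.mem_squares.2 ⟨h2, h3, h1.symm⟩) hy.2
      · exact absurd hy.1 h'
  · intro hc
    refine ⟨⟨hX.part_subset hD hs hc, hdisj c hc⟩, ?_⟩
    obtain ⟨a, b⟩ := c
    obtain ⟨h0, h1, h2, h3⟩ := IsStair.mem_part.1 hc
    have hb := hX.bounds (j := a + b + 1) (by omega) h2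
    refine ⟨b.toNat, by omega, ?_⟩
    rw [h.flank_right (by omega), Int.toNat_of_nonneg h0]
    have hr : Reach ((D \ δ.squares : Finset (ℤ × ℤ)) : Set (ℤ × ℤ)) (b + 1, b) (a, b) := by
      refine reach_row_of_between fun i hi0 hi1 => ?_
      have hm : (i, b) ∈ IsStair.part δ.k X := by
        rw [IsStair.mem_part]
        have := hX.mono (i := i + b + 1) (j := a + b + 1) (by omega) (by omega) (by omega)
        omega
      rw [Finset.mem_coe, Finset.mem_sdiff]
      exact ⟨hX.part_subset hD hs hm, hdisj _ hm⟩
    exact Relation.ReflTransGen.mono (fun x y hxy => ⟨by simpa using hxy.1, hxy.2⟩) _ _ hr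

theorem IsStd.mem_fixedPart (h : δ.IsStd) (hD : IsSimple D) (hX : IsStair D δ.k X) {c : ℤ × ℤ} :
    c ∈ δ.fixedPart .right ↔ c ∈ D ∧ c ∉ IsStair.band δ.k X := by
  obtain ⟨a, b⟩ := c
  rw [hX.mem_band_iff h.isStdDiagonal]
  simp only [fixedPart, Finset.mem_sdiff, h.mem_movedPart hD hX, h.mem_squares, Side.opp,
    h.mem_left_flanks]
  tauto

theorem IsStd.shift_right (h : δ.IsStd) : δ.shift .right = (-1, 1) := by
  rw [shift, h.mid_right δ.k_pos, Side.opp, h.mid_left δ.k_pos]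
  simp

theorem IsStd.mem_shifted (h : δ.IsStd) {E : Finset (ℤ × ℤ)} {a b : ℤ} :
    (a, b) ∈ E.image (· + δ.shift .right) ↔ (a + 1, b - 1) ∈ E := by
  rw [h.shift_right, Finset.mem_image]
  constructor
  · rintro ⟨⟨x, y⟩, hx, hxy⟩
    rw [Prod.mk_add_mk, Prod.mk.injEq] at hxy
    rwa [show a + 1 = x by omega, show b - 1 = y by omega]
  · intro hm
    exact ⟨_, hm, by simp⟩

/-- The fixed part is `D` without the band, and the translated part fills the band except for the
ribbon. This replaces the gluing by the deletion of one ribbon from `D`. -/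
theorem IsStd.mem_cutPaste (h : δ.IsStd) (hD : IsSimple D) (hX : IsStair D δ.k X) {c : ℤ × ℤ} :
    c ∈ δ.cutPaste .right ↔ c ∈ D ∧ c ∉ IsStair.ribbon δ.k X := by
  obtain ⟨a, b⟩ := c
  rw [cutPaste, Finset.mem_union, h.mem_fixedPart hD hX, h.mem_shifted, h.mem_movedPart hD hX]
  have h1 := @IsStair.shifted_part_subset D δ.k X hD h.isStdDiagonal hX a b
  have h2 := @IsStair.shifted_part_iff D δ.k X hX a b
  have h3 := @IsStair.ribbon_subset_band D δ.k X h.isStdDiagonal hX (a, b)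
  tauto

/-- The staircase stays below the diagonal and within abscissa k, so its last step is vertical and
is a side of the last square. Balance then means that the other side at the last vertex is not on
the boundary, so the last left flank exists. -/
theorem IsStd.canCutPaste (h : δ.IsStd) (hX : IsStair D δ.k X) : δ.CanCutPaste .right := by
  have hk := δ.k_pos
  have hs := h.isStdDiagonal
  have hlast : X (2 * δ.k - 1) = δ.k := by
    have h1 := hX.bounds (j := 2 * (δ.k : ℤ) - 1) (by omega) (by omega)
    have h2 := hX.below hs (j := 2 * (δ.k : ℤ) - 1) (by omega) (by omega)
    omega
  have hout : ((δ.k : ℤ), (δ.k : ℤ) - 1) ∉ D := by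
    have h1 := hX.step (2 * δ.k - 1) (by omega) (by omega)
    rw [sub_add_cancel, hX.last, hlast, show 2 * (δ.k : ℤ) - 1 - δ.k = δ.k - 1 by ring] at h1
    rcases h1 with ⟨h1, -⟩ | ⟨-, h1, -⟩
    · omega
    · exact h1
  have hin := hs.diag (δ.k - 1) (by omega) (by omega)
  have hsq : δ.sq (δ.k - 1) = ((δ.k : ℤ) - 1, (δ.k : ℤ) - 1) := by
    rw [h.sq (by omega), Nat.cast_sub hk, Nat.cast_one]
  have e1 : ((δ.k : ℤ), (δ.k : ℤ) - 1) ∈ vertices (δ.sq (δ.k - 1)) ∧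
      IsBoundaryEdge D (δ.v δ.k) ((δ.k : ℤ), (δ.k : ℤ) - 1) := by
    constructor
    · rw [hsq, mem_vertices]; simp
    · refine IsBoundaryEdge.symm ?_
      have := (isBoundaryEdge_vertical (D := D) (x := δ.k) (y := δ.k - 1)).2 (by tauto)
      rw [sub_add_cancel] at this
      rwa [h _ le_rfl]
  refine ⟨⟨_, e1⟩, fun hbal i hi => ?_⟩
  change δ.flank .left i ∈ D
  rw [h.flank_left hi]
  by_cases hi' : i + 1 < δ.k
  · exact hs.left i (by omega) (by omega)
  · have hik : (i : ℤ) = δ.k - 1 := by omega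
    rw [hik, sub_add_cancel]
    by_contra hcon
    obtain ⟨u, -, huniq⟩ := hbal
    have e2 : ((δ.k : ℤ) - 1, (δ.k : ℤ)) ∈ vertices (δ.sq (δ.k - 1)) ∧
        IsBoundaryEdge D (δ.v δ.k) ((δ.k : ℤ) - 1, (δ.k : ℤ)) := by
      constructor
      · rw [hsq, mem_vertices]; simp
      · refine IsBoundaryEdge.symm ?_
        have := (isBoundaryEdge_horizontal (D := D) (x := δ.k - 1) (y := δ.k)).2 (by tauto)
        rw [sub_add_cancel] at this
        rwa [h _ le_rfl]
    have := (huniq _ e1).trans (huniq _ e2).symm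
    rw [Prod.mk.injEq] at this
    omega

theorem IsStd.gluesInPlane (h : δ.IsStd) (hD : IsSimple D) (hX : IsStair D δ.k X) :
    δ.GluesInPlane .right := by
  rintro ⟨x, y⟩ hp
  rw [Finset.mem_inter, h.mem_shifted] at hp
  simp only [vertexSet, Finset.mem_biUnion, h.mem_movedPart hD hX, h.mem_fixedPart hD hX] at hp
  obtain ⟨⟨⟨fa, fb⟩, ⟨-, hf⟩, hfp⟩, ⟨⟨a, b⟩, hc, hcp⟩⟩ := hp
  rw [mem_vertices] at hfp hcp
  simp only at hfp hcp
  rw [IsStair.mem_part] at hc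
  rw [IsStair.mem_band] at hf
  have hb := hX.bounds (j := a + b + 1) (by omega) (by omega)
  rw [h.mem_shifted]
  simp only [zigzag, Finset.mem_union, Finset.mem_image, Finset.mem_range, Finset.mem_Ioo]
  -- Vertices of the translated region satisfy y ≤ x + 2. With x < y only y = x + 1 and y = x + 2
  -- remain: translates of the right vertices, respectively of the vertices of the diagonal.
  by_cases hd : x < y
  · by_cases hd1 : y = x + 1
    · left
      refine ⟨x.toNat, by omega, ?_⟩
      rw [h.mid_right (by omega), Prod.mk.injEq]
      omega
    · right
      refine ⟨(x + 1).toNat, by omega, ?_⟩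
      rw [h _ (by omega), Prod.mk.injEq]
      omega
  · exfalso
    -- On or below the line x = y the fixed square can be outside the band only by lying beyond the
    -- staircase; monotonicity keeps it from touching the translated region there.
    have hj : 0 ≤ fa + fb + 1 ∧ fa + fb + 1 ≤ 2 * δ.k := by omega
    have hf' : ¬ fa < X (fa + fb + 1) := by omega
    rcases le_total (fa + fb + 1) (a + b + 1) with hle | hle
    · have := hX.mono hj.1 hle hc.2.2.1
      omega
    · have := hX.mono (i := a + b + 1) (by omega) hle hj.2
      omega

end Diagonal

open Classical in
/-- The connected component of a square in a set of squares. -/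
noncomputable def component (P : Finset (ℤ × ℤ)) (c : ℤ × ℤ) : Finset (ℤ × ℤ) :=
  P.filter fun d => Reach (P : Set (ℤ × ℤ)) c d

theorem mem_component {P : Finset (ℤ × ℤ)} {c d : ℤ × ℤ} :
    d ∈ component P c ↔ d ∈ P ∧ Reach (P : Set (ℤ × ℤ)) c d := by
  classical
  simp [component]

theorem component_closed {P : Finset (ℤ × ℤ)} {c x y : ℤ × ℤ} (hx : x ∈ component P c)
    (hy : y ∈ P) (hxy : ShareSide x y) : y ∈ component P c :=
  mem_component.2 ⟨hy, (mem_component.1 hx).2.tail hy hxy⟩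

theorem isConn_component {P : Finset (ℤ × ℤ)} {c : ℤ × ℤ} (hc : c ∈ P) :
    IsConn (component P c : Set (ℤ × ℤ)) := by
  refine isConn_of_reach c (Finset.mem_coe.2 (mem_component.2 ⟨hc, Reach.refl _ _⟩)) fun b hb => ?_
  have := (mem_component.1 hb).2.restrict (R := (component P c : Set (ℤ × ℤ)))
    (Finset.mem_coe.2 (mem_component.2 ⟨hc, Reach.refl _ _⟩)) fun x hx y hy hxy =>
      component_closed hx hy hxy
  exact this.mono Set.inter_subset_right

theorem component_eq {P : Finset (ℤ × ℤ)} {c d : ℤ × ℤ} (hc : c ∈ P)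
    (hd : d ∈ component P c) : component P d = component P c := by
  have hcd := (mem_component.1 hd).2
  ext x
  rw [mem_component, mem_component]
  exact and_congr_right fun _ => ⟨fun h => hcd.trans h, fun h => (hcd.symm hc).trans h⟩

/-- If every union of components of `P` has a connected complement, then `P` is a union of boards
that have at most single vertices in common. -/
theorem isUnionOfBoards_of_escapes {P : Finset (ℤ × ℤ)}
    (h : ∀ Q : Finset (ℤ × ℤ), Q ⊆ P → (∀ x ∈ Q, ∀ y ∈ P, ShareSide x y → y ∈ Q) →
      Escapes (Q : Set (ℤ × ℤ))) : IsUnionOfBoards P := by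
  classical
  have hsub : ∀ c, component P c ⊆ P := fun c x hx => (mem_component.1 hx).1
  have hself : ∀ c ∈ P, c ∈ component P c := fun c hc => mem_component.2 ⟨hc, Reach.refl _ _⟩
  refine ⟨P.image (component P), fun B hB => ?_, fun A hA B hB hAB => ?_, ?_⟩
  · obtain ⟨c, hc, rfl⟩ := Finset.mem_image.1 hB
    exact IsSimple.isBoard ⟨⟨c, hself c hc⟩, isConn_component hc,
      h _ (hsub c) fun x hx y hy hxy => component_closed hx hy hxy⟩
  · obtain ⟨c, hc, rfl⟩ := Finset.mem_image.1 hA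
    obtain ⟨d, hd, rfl⟩ := Finset.mem_image.1 hB
    have hdisj : ∀ x ∈ component P c, x ∉ component P d := fun x hx hx' =>
      hAB ((component_eq hc hx).symm.trans (component_eq hd hx'))
    have hsep : ∀ x ∈ component P c, ∀ y ∈ component P d, ¬ ShareSide x y := fun x hx y hy hxy =>
      hdisj y (component_closed hx (hsub d hy) hxy) hy
    -- Here the hypothesis is needed for a union of two components, not only for single ones.
    have hesc : Escapes ((component P c : Set (ℤ × ℤ)) ∪ component P d) := by
      rw [← Finset.coe_union]
      refine h _ (Finset.union_subset (hsub c) (hsub d)) fun x hx y hy hxy => ?_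
      rcases Finset.mem_union.1 hx with hx | hx
      · exact Finset.mem_union_left _ (component_closed hx hy hxy)
      · exact Finset.mem_union_right _ (component_closed hx hy hxy)
    rw [Finset.card_le_one]
    intro p hp q hq
    rw [Finset.mem_inter, vertexSet, vertexSet, Finset.mem_biUnion, Finset.mem_biUnion] at hp hq
    obtain ⟨⟨c1, hc1, hp1⟩, c2, hc2, hp2⟩ := hp
    obtain ⟨⟨d1, hd1, hq1⟩, d2, hd2, hq2⟩ := hq
    exact vertex_unique_of_escapes (Finset.finite_toSet _) (Finset.finite_toSet _)
      (isConn_component hc) (isConn_component hd) hdisj hsep hesc hc1 hc2 hd1 hd2 hp1 hp2 hq1 hq2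
  · ext x
    simp only [Finset.mem_biUnion, Finset.mem_image, id]
    constructor
    · rintro ⟨B, ⟨c, hc, rfl⟩, hx⟩
      exact hsub c hx
    · exact fun hx => ⟨_, ⟨x, hx, rfl⟩, hself x hx⟩

/-- The ribbon is a channel: consecutive squares share a side, and the first, `(0, 0)`, adjoins
`(-1, 0)`, which is outside `D`. -/
theorem IsStair.reach_ribbon {D : Finset (ℤ × ℤ)} {k : ℤ} {X : ℤ → ℤ} (hs : IsStdDiagonal D k)
    (hX : IsStair D k X) {Q : Set (ℤ × ℤ)} (hQ : ∀ c ∈ Q, c ∈ D ∧ c ∉ ribbon k X) {c : ℤ × ℤ}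
    (hc : c ∈ ribbon k X) : Reach Qᶜ c (-1, 0) := by
  obtain ⟨j, h0, hj, rfl⟩ := hc
  induction j, (show 1 ≤ j from h0) using Int.leInduction with
  | base =>
    refine Reach.single (fun h => hs.west (hQ _ h).1) ?_
    have : X 1 = 1 := by
      have h1 := hX.bounds (j := 1) (by omega) (by omega)
      by_cases hk : k = 1
      · have := hX.mono (i := 1) (j := 2 * k) (by omega) (by omega) le_rfl
        have := hs.diag 0 le_rfl hs.pos
        rcases hX.step 0 le_rfl (by omega) with ⟨h, -⟩ | ⟨-, h, -⟩
        · rw [hX.zero, zero_add] at h; omega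
        · rw [hX.zero] at h; exact absurd this h
      · have h2 := hX.below hs (j := 1) (by omega) (by omega)
        omega
    rw [shareSide_iff, this]
    simp
  | succ j hij ih =>
    refine Reach.trans (Reach.single (fun h => (hQ _ h).2 ⟨j, by omega, by omega, rfl⟩) ?_)
      (ih (by omega) (by omega))
    rw [shareSide_iff]
    simp only
    rcases hX.step j (by omega) (by omega) with ⟨h, -⟩ | ⟨h, -⟩ <;> omega

/-- From a deleted square one walks west. A union of components cannot be entered from another
square of the result, so the walk ends outside `D` or in the ribbon, which leads outside. -/
theorem Diagonal.IsStd.isUnionOfBoards {D : Finset (ℤ × ℤ)} {δ : Diagonal D} {X : ℤ → ℤ}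
    (h : δ.IsStd) (hD : IsSimple D) (hX : IsStair D δ.k X) :
    IsUnionOfBoards (δ.cutPaste .right) := by
  have hmem := @Diagonal.IsStd.mem_cutPaste D δ X h hD hX
  refine isUnionOfBoards_of_escapes fun Q hQ hclosed => ?_
  have hQ' : ∀ c ∈ (Q : Set (ℤ × ℤ)), c ∈ D ∧ c ∉ IsStair.ribbon δ.k X := fun c hc =>
    hmem.1 (hQ hc)
  have hwest : ((-1, 0) : ℤ × ℤ) ∉ (D : Set (ℤ × ℤ)) := h.isStdDiagonal.west
  refine hD.escapes.of_reach (fun c hc => (hQ' c hc).1) fun c hc hcQ => ?_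
  by_cases hcR : c ∈ IsStair.ribbon δ.k X
  · exact ⟨_, hwest, hX.reach_ribbon h.isStdDiagonal hQ' hcR⟩
  · obtain ⟨d, hd, hcd⟩ := exists_reach_of_walk (D := δ.cutPaste .right) (Q := Q) (t := (-1, 0))
      (by rw [shareSide_iff]; simp) (fun z hz hzQ hzt hztQ => hzQ <| by
        refine hclosed _ hztQ z hz ?_
        rw [shareSide_iff]
        simp) hQ hcQ
    by_cases hdR : d ∈ IsStair.ribbon δ.k X
    · exact ⟨_, hwest, hcd.trans (hX.reach_ribbon h.isStdDiagonal hQ' hdR)⟩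
    · exact ⟨d, fun hdD => hd (hmem.2 ⟨hdD, hdR⟩), hcd⟩

theorem Diagonal.IsStd.cutPasteWorks {D : Finset (ℤ × ℤ)} {δ : Diagonal D} (h : δ.IsStd)
    (hD : IsSimple D) (he : δ.IsExcellentOn .right) : δ.CutPasteWorks .right := by
  obtain ⟨X, hX⟩ := h.exists_isStair hD he
  exact ⟨h.canCutPaste hX, h.gluesInPlane hD hX, h.isUnionOfBoards hD hX⟩

theorem Diagonal.IsExcellentOn.cutPasteWorks {D : Finset (ℤ × ℤ)} {δ : Diagonal D} {σ : Side}
    (hD : IsBoard D) (h : δ.IsExcellentOn σ) : δ.CutPasteWorks σ := by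
  obtain ⟨g, hσ, hg⟩ := δ.exists_standard σ
  refine CutPasteWorks.of_map δ g ?_
  have := h.map g
  rw [hσ] at this ⊢
  exact IsStd.cutPasteWorks hg (LatticeIso.isBoard hD).isSimple this

end Quad

namespace Quad

/-! ### Closed paths crossing from one set of squares to another -/

/-- The tool for separation: only two steps of the cycle pass between `A` and `B`. Following the
winding number along the frontier of `B` from one vertex outside to another, both with value 0, and
meeting only one crossing gives a contradiction. -/
theorem exists_winding_of_cycle {D : Finset (ℤ × ℤ)} {A B : Set (ℤ × ℤ)} (hA : A ⊆ D) (hB : B ⊆ D)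
    (hAB : ∀ x ∈ A, x ∉ B) (hD : Escapes (D : Set (ℤ × ℤ))) {a a' b b' : ℤ × ℤ} (ha : a ∈ A)
    (haa : Reach A a a') (hab' : ShareSide a' b') (hb' : b' ∈ B) (hbb : Reach B b' b)
    (hba : ShareSide b a) :
    ∃ m w, IsWinding m w ∧ (∀ s t, m s t = - m t s) ∧ (∀ s t, m s t ≠ 0 → s ∈ D ∧ t ∈ D) ∧
      (∀ z ∉ D, ∀ v ∈ vertices z, w v = 0) ∧ ∀ s ∈ B, ∀ t ∈ A,
        m s t = (if s = b ∧ t = a then 1 else 0) - (if s = b' ∧ t = a' then 1 else 0) := by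
  obtain ⟨m1, h1⟩ := haa.exists_flow ha
  obtain ⟨m2, h2⟩ := hbb.exists_flow hb'
  have ha' : a' ∈ A := haa.mem ha
  have hb : b ∈ B := hbb.mem hb'
  have hm := (((h1.add (stepFlow_isFlow hab')).add h2).add (stepFlow_isFlow hba)).mono
    (Q := (D : Set (ℤ × ℤ))) (by
      rintro x (((hx | rfl | rfl) | hx) | rfl | rfl)
      exacts [hA hx, hA ha', hB hb', hB hx, hB hb, hA ha])
  obtain ⟨w, hw⟩ := hm.exists_winding D.finite_toSet
  refine ⟨_, w, hw, hm.antisymm, hm.mem, fun z hz v hv => hw.eq_zero hm hD hz hv,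
    fun s hs t ht => ?_⟩
  have e1 : m1 s t = 0 := by
    by_contra h
    exact hAB s (h1.mem s t h).1 hs
  have e2 : m2 s t = 0 := by
    by_contra h
    exact hAB t ht (h2.mem s t h).2
  have e3 : ¬ (s = a' ∧ t = b') := fun h => hAB a' ha' (h.1 ▸ hs)
  have e4 : ¬ (s = a ∧ t = b) := fun h => hAB a ha (h.1 ▸ hs)
  simp only [e1, e2, stepFlow, e3, e4, if_false]
  ring

/-! ### Runs of squares in a row -/

/-- The squares of the row `y` from `(a, y)` to `(b, y)`. -/
def rowSet (a b y : ℤ) : Set (ℤ × ℤ) := {c | c.2 = y ∧ a ≤ c.1 ∧ c.1 ≤ b}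

theorem mem_rowSet {a b y u v : ℤ} : (u, v) ∈ rowSet a b y ↔ v = y ∧ a ≤ u ∧ u ≤ b := Iff.rfl

/-- A maximal segment of a row of `D`. -/
structure IsRun (D : Finset (ℤ × ℤ)) (a b y : ℤ) : Prop where
  le : a ≤ b
  mem : ∀ x, a ≤ x → x ≤ b → (x, y) ∈ D
  left : (a - 1, y) ∉ D
  right : (b + 1, y) ∉ D

theorem exists_isRun {D : Finset (ℤ × ℤ)} {u v : ℤ} (h : (u, v) ∈ D) :
    ∃ a b, IsRun D a b v ∧ a ≤ u ∧ u ≤ b := by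
  classical
  obtain ⟨B, hB0, hB⟩ := exists_box D.finite_toSet
  have e1 : ∃ n : ℕ, (u + n + 1, v) ∉ D := by
    refine ⟨(B - u).toNat, fun h' => ?_⟩
    have := hB _ h'
    simp only at this
    omega
  have e2 : ∃ n : ℕ, (u - n - 1, v) ∉ D := by
    refine ⟨(u + B).toNat, fun h' => ?_⟩
    have := hB _ h'
    simp only at this
    omega
  refine ⟨u - Nat.find e2, u + Nat.find e1, ⟨by omega, fun x h1 h2 => ?_, Nat.find_spec e2,
    Nat.find_spec e1⟩, by omega, by omega⟩
  rcases lt_trichotomy x u with hx | rfl | hx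
  · have := Nat.find_min e2 (m := (u - x - 1).toNat) (by omega)
    rw [not_not] at this
    rwa [show x = u - ((u - x - 1).toNat : ℕ) - 1 by omega]
  · exact h
  · have := Nat.find_min e1 (m := (x - u - 1).toNat) (by omega)
    rw [not_not] at this
    rwa [show x = u + ((x - u - 1).toNat : ℕ) + 1 by omega]

namespace IsRun

variable {D : Finset (ℤ × ℤ)} {a b y : ℤ}

theorem subset (h : IsRun D a b y) : rowSet a b y ⊆ D := by
  rintro ⟨u, v⟩ ⟨rfl, h1, h2⟩
  exact h.mem u h1 h2

theorem reach (h : IsRun D a b y) {c d : ℤ × ℤ} (hc : c ∈ rowSet a b y) (hd : d ∈ rowSet a b y) :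
    Reach (rowSet a b y) c d := by
  obtain ⟨u, v⟩ := c
  obtain ⟨u', v'⟩ := d
  rw [mem_rowSet] at hc hd
  obtain ⟨rfl, hc1, hc2⟩ := hc
  obtain ⟨rfl, hd1, hd2⟩ := hd
  exact reach_row_of_between fun i h1 h2 => mem_rowSet.2 ⟨rfl, by omega, by omega⟩

/-- A square of `D` that shares a side with a run lies above or below it. -/
theorem neighbour (h : IsRun D a b y) {c d : ℤ × ℤ} (hc : c ∈ D) (hcr : c ∉ rowSet a b y)
    (hd : d ∈ rowSet a b y) (hcd : ShareSide c d) :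
    c.1 = d.1 ∧ (c.2 = y + 1 ∨ c.2 = y - 1) := by
  obtain ⟨u, v⟩ := c
  obtain ⟨u', v'⟩ := d
  rw [mem_rowSet] at hcr hd
  rw [shareSide_iff] at hcd
  obtain ⟨rfl, hd1, hd2⟩ := hd
  have h1 := h.left
  have h2 := h.right
  have e1 : v = v' → u ≠ a - 1 := by rintro rfl rfl; exact h1 hc
  have e2 : v = v' → u ≠ b + 1 := by rintro rfl rfl; exact h2 hc
  simp only at hcd ⊢
  omega

/-- If a run does not disconnect the board, then it has neighbours on one side only. -/
theorem not_both (hD : Escapes (D : Set (ℤ × ℤ))) (h : IsRun D a b y)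
    (hconn : IsConn ((D : Set (ℤ × ℤ)) \ rowSet a b y)) :
    (∀ x, a ≤ x → x ≤ b → (x, y - 1) ∉ D) ∨ (∀ x, a ≤ x → x ≤ b → (x, y + 1) ∉ D) := by
  by_contra hcon
  push Not at hcon
  obtain ⟨⟨j, hj1, hj2, hj⟩, i, hi1, hi2, hi⟩ := hcon
  have hup : ∀ x, (x, y + 1) ∉ rowSet a b y := fun x hx => by rw [mem_rowSet] at hx; omega
  have hdown : ∀ x, (x, y - 1) ∉ rowSet a b y := fun x hx => by rw [mem_rowSet] at hx; omega
  obtain ⟨m, w, hw, hanti, hmem, hzero, hm⟩ := exists_winding_of_cycle (D := D)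
    (A := (D : Set (ℤ × ℤ)) \ rowSet a b y) (B := rowSet a b y) Set.sdiff_subset h.subset
    (fun x hx => hx.2) hD (a := (i, y + 1)) (a' := (j, y - 1)) (b := (i, y)) (b' := (j, y))
    ⟨hi, hup i⟩ (hconn _ ⟨hi, hup i⟩ _ ⟨hj, hdown j⟩) (by rw [shareSide_iff]; simp)
    ⟨rfl, hj1, hj2⟩ (h.reach ⟨rfl, hj1, hj2⟩ ⟨rfl, hi1, hi2⟩) (by rw [shareSide_iff]; simp)
  have hcross : ∀ x, a ≤ x → x ≤ b → m (x, y) (x, y + 1) = if x = i then 1 else 0 := by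
    intro x h1 h2
    by_cases hx : (x, y + 1) ∈ D
    · rw [hm _ ⟨rfl, h1, h2⟩ _ ⟨hx, hup x⟩]
      have e : ¬ ((x, y) = (j, y) ∧ (x, y + 1) = (j, y - 1)) := by
        simp only [Prod.mk.injEq]; omega
      rw [if_neg e, sub_zero]
      simp only [Prod.mk.injEq, and_true, and_self]
    · rw [if_neg fun h' : x = i => hx (h' ▸ hi)]
      by_contra h'
      exact hx (hmem _ _ h').2
  -- Along the top of the run only the crossing at `i` is met, yet `w` vanishes at both ends, which
  -- belong to the missing squares beside the run.
  have key : ∀ x, a ≤ x → x ≤ b + 1 → w (x, y + 1) = if i < x then -1 else 0 := by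
    intro x hx
    induction x, hx using Int.leInduction with
    | base =>
      intro _
      rw [if_neg (by omega)]
      exact hzero _ h.left _ (by rw [mem_vertices]; simp)
    | succ x hx ih =>
      intro hxb
      have h1 := ih (by omega)
      have h2 := hw.fst x (y + 1)
      rw [add_sub_cancel_right, hcross x hx (by omega), h1] at h2
      split_ifs at * <;> omega
  have h1 := key (b + 1) (by have := h.le; omega) le_rfl
  rw [if_pos (by omega), hzero _ h.right _ (by rw [mem_vertices]; simp)] at h1
  omega

/-- The square `c` has no neighbours to the left and below, or no neighbours to the right and
above. -/
def _root_.Quad.IsAcuteCorner (D : Finset (ℤ × ℤ)) (c : ℤ × ℤ) : Prop :=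
  ((c.1 - 1, c.2) ∉ D ∧ (c.1, c.2 - 1) ∉ D) ∨ ((c.1 + 1, c.2) ∉ D ∧ (c.1, c.2 + 1) ∉ D)

theorem exists_isAcuteCorner_of_isConn (hD : Escapes (D : Set (ℤ × ℤ))) (h : IsRun D a b y)
    (hconn : IsConn ((D : Set (ℤ × ℤ)) \ rowSet a b y)) :
    ∃ c ∈ rowSet a b y, IsAcuteCorner D c := by
  have hle := h.le
  rcases h.not_both hD hconn with h1 | h1
  · exact ⟨(a, y), ⟨rfl, le_rfl, hle⟩, Or.inl ⟨h.left, h1 a le_rfl hle⟩⟩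
  · exact ⟨(b, y), ⟨rfl, hle, le_rfl⟩, Or.inr ⟨h.right, h1 b hle le_rfl⟩⟩

/-- A run that does not disconnect `D` has an acute corner at one end. Otherwise one passes to an
adjacent run cut off from `Z`; the set of squares cut off from `Z` shrinks, since the old run
becomes reachable. -/
theorem exists_isAcuteCorner (hD : IsSimple D) {Z : Set (ℤ × ℤ)} (hZD : Z ⊆ D) (hZ : IsConn Z)
    {z₀ : ℤ × ℤ} (hz₀ : z₀ ∈ Z) (h : IsRun D a b y) (hrun : ∀ c ∈ rowSet a b y, c ∉ Z) :
    ∃ c ∈ D, c ∉ Z ∧ IsAcuteCorner D c := by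
  classical
  induction hn : (D.filter fun c => ¬ Reach ((D : Set (ℤ × ℤ)) \ rowSet a b y) z₀ c).card
    using Nat.strong_induction_on generalizing a b y with
  | _ n ih =>
  subst hn
  set P := (D : Set (ℤ × ℤ)) \ rowSet a b y with hP
  have hz₀P : z₀ ∈ P := ⟨hZD hz₀, fun h' => hrun _ h' hz₀⟩
  by_cases hleaf : ∀ u ∈ P, Reach P z₀ u
  · obtain ⟨c, hc, hcc⟩ := h.exists_isAcuteCorner_of_isConn hD.escapes
      (isConn_of_reach z₀ hz₀P hleaf)
    exact ⟨c, h.subset hc, hrun c hc, hcc⟩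
  push Not at hleaf
  obtain ⟨u, huP, hu⟩ := hleaf
  have har : (a, y) ∈ rowSet a b y := ⟨rfl, le_rfl, h.le⟩
  obtain ⟨x, r, hux, -, hr, hrR, hxr⟩ := (hD.conn u huP.1 (a, y) (h.subset har)).first_exit
    (R := (rowSet a b y)ᶜ) huP.2 fun h' => h' har
  rw [← Set.sdiff_eq, ← hP] at hux
  have hxP : x ∈ P := hux.mem huP
  have hx : ¬ Reach P z₀ x := fun h' => hu (h'.trans (hux.symm huP))
  rw [Set.notMem_compl_iff] at hrR
  have hxy := (h.neighbour hxP.1 hxP.2 hrR hxr).2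
  obtain ⟨a', b', h', hxa, hxb⟩ := exists_isRun (D := D) (u := x.1) (v := x.2) hxP.1
  have hdisj : ∀ c ∈ rowSet a' b' x.2, c ∉ rowSet a b y := by
    rintro ⟨c1, c2⟩ hc hc'
    rw [mem_rowSet] at hc hc'
    omega
  have hxrun : x ∈ rowSet a' b' x.2 := ⟨rfl, hxa, hxb⟩
  have hrunP : rowSet a' b' x.2 ⊆ P := fun c hc => ⟨h'.subset hc, hdisj c hc⟩
  have hrunW : ∀ c ∈ rowSet a' b' x.2, ¬ Reach P z₀ c := fun c hc hz =>
    hx (hz.trans ((h'.reach hc hxrun).mono hrunP))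
  have hZW : ∀ z ∈ Z, Reach P z₀ z := fun z hz =>
    (hZ z₀ hz₀ z hz).mono fun c hc => ⟨hZD hc, fun hcr => hrun c hcr hc⟩
  have hWW : ∀ c, Reach P z₀ c → Reach ((D : Set (ℤ × ℤ)) \ rowSet a' b' x.2) z₀ c := by
    intro c hc
    have := hc.restrict (R := {c | Reach P z₀ c}) (Reach.refl _ _)
      fun p hp q hq hpq => Reach.tail hp hq hpq
    exact this.mono fun q hq => ⟨hq.1.1, fun hqr => hrunW q hqr hq.2⟩
  refine ih _ ?_ h' (fun c hc hcZ => hrunW c hc (hZW c hcZ)) rfl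
  obtain ⟨q, r', hzq, -, hr', hrR', hqr'⟩ := (hD.conn z₀ hz₀P.1 (a, y) (h.subset har)).first_exit
    (R := (rowSet a b y)ᶜ) hz₀P.2 fun h' => h' har
  rw [← Set.sdiff_eq, ← hP] at hzq
  rw [Set.notMem_compl_iff] at hrR'
  refine Finset.card_lt_card ⟨fun c hc => ?_, fun hsub => ?_⟩
  · rw [Finset.mem_filter] at hc ⊢
    exact ⟨hc.1, fun h' => hc.2 (hWW c h')⟩
  · have h1 : r' ∈ D.filter fun c => ¬ Reach P z₀ c :=
      Finset.mem_filter.2 ⟨hr', fun h' => (h'.mem hz₀P).2 hrR'⟩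
    have h2 := (Finset.mem_filter.1 (hsub h1)).2
    exact h2 (Reach.tail (hWW q hzq) ⟨hr', fun h' => hdisj _ h' hrR'⟩ hqr')

end IsRun

/-- If the row of a square of `D` does not lead inside `D` to the connected subset `Z`, then `D` has
an acute corner outside `Z`. -/
theorem exists_isAcuteCorner_of_row {D : Finset (ℤ × ℤ)} (hD : IsSimple D) {Z : Set (ℤ × ℤ)}
    (hZD : Z ⊆ D) (hZ : IsConn Z) {z₀ : ℤ × ℤ} (hz₀ : z₀ ∈ Z) {u v : ℤ} (huv : (u, v) ∈ D)
    (h : ∀ x, (∀ i, min u x ≤ i → i ≤ max u x → (i, v) ∈ D) → (x, v) ∉ Z) :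
    ∃ c ∈ D, c ∉ Z ∧ IsAcuteCorner D c := by
  obtain ⟨a, b, hrun, hu1, hu2⟩ := exists_isRun huv
  refine hrun.exists_isAcuteCorner hD hZD hZ hz₀ ?_
  rintro ⟨c1, c2⟩ hc
  rw [mem_rowSet] at hc
  obtain ⟨rfl, h1, h2⟩ := hc
  exact h c1 fun i hi1 hi2 => hrun.mem i (by omega) (by omega)

theorem Reach.map_cell {P Q : Set (ℤ × ℤ)} (g : LatticeIso) (hPQ : ∀ c ∈ P, g.cell c ∈ Q)
    {a b : ℤ × ℤ} (h : Reach P a b) : Reach Q (g.cell a) (g.cell b) := by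
  induction h with
  | refl => exact Reach.refl _ _
  | tail _ hbc ih => exact ih.tail (hPQ _ hbc.1) ((g.adj _ _).2 hbc.2)

theorem IsConn.image_cell {P : Set (ℤ × ℤ)} (hP : IsConn P) (g : LatticeIso) :
    IsConn (g.cell '' P) := by
  rintro _ ⟨a, ha, rfl⟩ _ ⟨b, hb, rfl⟩
  exact (hP a ha b hb).map_cell g fun c hc => Set.mem_image_of_mem _ hc

theorem IsSimple.app {D : Finset (ℤ × ℤ)} (hD : IsSimple D) (g : LatticeIso) :
    IsSimple (g.app D) := (LatticeIso.isBoard hD.isBoard).isSimple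

theorem exists_isAcuteCorner_of_column {D : Finset (ℤ × ℤ)} (hD : IsSimple D) {Z : Set (ℤ × ℤ)}
    (hZD : Z ⊆ D) (hZ : IsConn Z) {z₀ : ℤ × ℤ} (hz₀ : z₀ ∈ Z) {u v : ℤ} (huv : (u, v) ∈ D)
    (h : ∀ y, (∀ i, min v y ≤ i → i ≤ max v y → (u, i) ∈ D) → (u, y) ∉ Z) :
    ∃ c ∈ D, c ∉ Z ∧ IsAcuteCorner D c := by
  have hmem : ∀ x y : ℤ, (x, y) ∈ LatticeIso.swap.app D ↔ (y, x) ∈ D := fun x y =>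
    LatticeIso.cell_mem_app (g := LatticeIso.swap) (c := (y, x))
  have hmemZ : ∀ x y : ℤ, (x, y) ∈ LatticeIso.swap.cell '' Z ↔ (y, x) ∈ Z := fun x y =>
    LatticeIso.swap.cell.injective.mem_set_image (a := (y, x))
  obtain ⟨⟨c1, c2⟩, hc, hcZ, hcc⟩ := exists_isAcuteCorner_of_row (hD.app LatticeIso.swap)
    (Z := LatticeIso.swap.cell '' Z) (by
      rintro ⟨x, y⟩ hxy
      exact (hmem x y).2 (hZD ((hmemZ x y).1 hxy))) (hZ.image_cell _) ⟨z₀, hz₀, rfl⟩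
      ((hmem v u).2 huv) fun x hx => by
        rw [hmemZ]
        exact h x fun i h1 h2 => (hmem i u).1 (hx i h1 h2)
  refine ⟨(c2, c1), (hmem c1 c2).1 hc, fun h' => hcZ ((hmemZ _ _).2 h'), ?_⟩
  simp only [IsAcuteCorner, hmem] at hcc ⊢
  tauto

end Quad

namespace Quad

/-! ### The two sides of a diagonal -/

/-- The squares of the standard diagonal. -/
def diagSet (k : ℤ) : Set (ℤ × ℤ) := {c | c.1 = c.2 ∧ 0 ≤ c.1 ∧ c.1 < k}

theorem mem_diagSet {a b k : ℤ} : (a, b) ∈ diagSet k ↔ a = b ∧ 0 ≤ a ∧ a < k := Iff.rfl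

/-- The part of `D` to the right of the diagonal. -/
def rightPart (D : Finset (ℤ × ℤ)) (k : ℤ) : Set (ℤ × ℤ) :=
  {c | ∃ i, 0 ≤ i ∧ i < k ∧ (i + 1, i) ∈ D ∧ Reach ((D : Set (ℤ × ℤ)) \ diagSet k) (i + 1, i) c}

/-- The part of `D` to the left of the diagonal. -/
def leftPart (D : Finset (ℤ × ℤ)) (k : ℤ) : Set (ℤ × ℤ) :=
  {c | ∃ i, 0 ≤ i ∧ i < k ∧ (i, i + 1) ∈ D ∧ Reach ((D : Set (ℤ × ℤ)) \ diagSet k) (i, i + 1) c}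

variable {D : Finset (ℤ × ℤ)} {k : ℤ}

theorem rightPart_subset {c : ℤ × ℤ} (h : c ∈ rightPart D k) :
    c ∈ (D : Set (ℤ × ℤ)) \ diagSet k := by
  obtain ⟨i, h0, h1, h2, h3⟩ := h
  exact h3.mem ⟨h2, fun h => by rw [mem_diagSet] at h; omega⟩

theorem leftPart_subset {c : ℤ × ℤ} (h : c ∈ leftPart D k) :
    c ∈ (D : Set (ℤ × ℤ)) \ diagSet k := by
  obtain ⟨i, h0, h1, h2, h3⟩ := h
  exact h3.mem ⟨h2, fun h => by rw [mem_diagSet] at h; omega⟩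

theorem rightPart_of_reach {c d : ℤ × ℤ} (h : c ∈ rightPart D k)
    (hcd : Reach ((D : Set (ℤ × ℤ)) \ diagSet k) c d) : d ∈ rightPart D k := by
  obtain ⟨i, h0, h1, h2, h3⟩ := h
  exact ⟨i, h0, h1, h2, h3.trans hcd⟩

theorem leftPart_of_reach {c d : ℤ × ℤ} (h : c ∈ leftPart D k)
    (hcd : Reach ((D : Set (ℤ × ℤ)) \ diagSet k) c d) : d ∈ leftPart D k := by
  obtain ⟨i, h0, h1, h2, h3⟩ := h
  exact ⟨i, h0, h1, h2, h3.trans hcd⟩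

theorem rightPart_of_adj {c d : ℤ × ℤ} (h : c ∈ rightPart D k) (hd : d ∈ D) (hdk : d ∉ diagSet k)
    (hcd : ShareSide c d) : d ∈ rightPart D k :=
  rightPart_of_reach h (Reach.single ⟨hd, hdk⟩ hcd)

theorem right_flank_mem {i : ℤ} (h0 : 0 ≤ i) (h1 : i < k) (h : (i + 1, i) ∈ D) :
    (i + 1, i) ∈ rightPart D k := ⟨i, h0, h1, h, Reach.refl _ _⟩

theorem left_flank_mem {i : ℤ} (h0 : 0 ≤ i) (h1 : i < k) (h : (i, i + 1) ∈ D) :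
    (i, i + 1) ∈ leftPart D k := ⟨i, h0, h1, h, Reach.refl _ _⟩

namespace IsStdDiagonal

theorem reach_diag {Q : Set (ℤ × ℤ)} (hQ : diagSet k ⊆ Q)
    (hQ' : ∀ i, 0 ≤ i → i + 1 < k → (i, i + 1) ∈ Q) {i j : ℤ} (hi : 0 ≤ i) (hik : i < k)
    (hj : 0 ≤ j) (hjk : j < k) : Reach Q (i, i) (j, j) := by
  wlog hij : i ≤ j generalizing i j
  · exact (this hj hjk hi hik (by omega)).symm (hQ ⟨rfl, hj, hjk⟩)
  induction j, hij using Int.leInduction with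
  | base => exact Reach.refl _ _
  | succ j hij ih =>
    refine ((ih (by omega) (by omega)).tail (hQ' j (by omega) (by omega)) ?_).tail
      (hQ ⟨rfl, hj, hjk⟩) ?_ <;> rw [shareSide_iff] <;> simp

theorem diagSet_subset (hs : IsStdDiagonal D k) : diagSet k ⊆ D := by
  rintro ⟨a, b⟩ h
  obtain ⟨rfl, h0, h1⟩ := mem_diagSet.1 h
  exact hs.diag a h0 h1

/-- The diagonal separates its two sides. -/
theorem disjoint (hD : IsSimple D) (hs : IsStdDiagonal D k) {c : ℤ × ℤ} (hr : c ∈ rightPart D k)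
    (hl : c ∈ leftPart D k) : False := by
  obtain ⟨i, hi0, hik, hiD, hic⟩ := hr
  obtain ⟨j, hj0, hjk, hjD, hjc⟩ := hl
  set P := (D : Set (ℤ × ℤ)) \ diagSet k with hP
  have hPi : (i + 1, i) ∈ P := ⟨hiD, fun h => by rw [mem_diagSet] at h; omega⟩
  have hPj : (j, j + 1) ∈ P := ⟨hjD, fun h => by rw [mem_diagSet] at h; omega⟩
  -- The squares of the diagonal have no common sides; the left flanks are added to make `B`
  -- connected. A walk from the right to the left then first enters `B` at a left flank.
  set B : Set (ℤ × ℤ) := {c | c ∈ D ∧ (c ∈ diagSet k ∨ ∃ l, 0 ≤ l ∧ l < k ∧ c = (l, l + 1))}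
    with hB
  have hBi : ∀ i, (i + 1, i) ∉ B := by
    rintro i ⟨-, h | ⟨l, -, -, h⟩⟩
    · rw [mem_diagSet] at h; omega
    · rw [Prod.mk.injEq] at h; omega
  have hBj : (j, j + 1) ∈ B := ⟨hjD, Or.inr ⟨j, hj0, hjk, rfl⟩⟩
  obtain ⟨x, y, hx, hxB, hy, hyB, hxy⟩ := (hic.trans (hjc.symm hPj)).first_exit (R := Bᶜ)
    (hBi i) fun h => h hBj
  rw [Set.notMem_compl_iff] at hyB
  obtain ⟨hyD, hy' | ⟨l, hl0, hlk, rfl⟩⟩ := hyB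
  · exact hy.2 hy'
  have hSB : diagSet k ⊆ B := fun c hc => ⟨hs.diagSet_subset hc, Or.inl hc⟩
  have hback : Reach B (l, l + 1) (i, i) :=
    Reach.trans (Reach.single (hSB ⟨rfl, hl0, hlk⟩) (by rw [shareSide_iff]; simp))
      (reach_diag hSB (fun i h0 h1 => ⟨hs.left i h0 h1, Or.inr ⟨i, h0, by omega, rfl⟩⟩) hl0 hlk
        hi0 hik)
  obtain ⟨m, w, hw, hanti, hmem, hzero, hm⟩ := exists_winding_of_cycle (D := D) (A := P ∩ Bᶜ)
    (B := B) (fun c hc => hc.1.1) (fun c hc => hc.1) (fun c hc => hc.2) hD.escapes ⟨hPi, hBi i⟩ hx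
    hxy ⟨hyD, Or.inr ⟨l, hl0, hlk, rfl⟩⟩ hback (by rw [shareSide_iff]; simp)
  have hcross : ∀ n, 0 ≤ n → n < k → ∀ t, (t = (n + 1, n) ∨ t = (n, n - 1)) →
      m (n, n) t = if t = (n + 1, n) ∧ n = i then 1 else 0 := by
    intro n h0 h1 t ht
    by_cases htD : t ∈ D
    · have htA : t ∈ P ∩ Bᶜ := by
        refine ⟨⟨htD, fun h => ?_⟩, fun h => ?_⟩
        · rcases ht with rfl | rfl <;> rw [mem_diagSet] at h <;> omega
        · rcases ht with rfl | rfl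
          · exact hBi n h
          · have := hBi (n - 1)
            rw [sub_add_cancel] at this
            exact this h
      rw [hm _ (hSB ⟨rfl, h0, h1⟩) t htA]
      have e : ¬ ((n, n) = (l, l + 1) ∧ t = x) := by
        rw [Prod.mk.injEq]; omega
      rw [if_neg e, sub_zero]
      refine if_congr ?_ rfl rfl
      rcases ht with rfl | rfl <;> simp only [Prod.mk.injEq] <;> grind
    · rw [if_neg]
      · by_contra h'
        exact htD (hmem _ _ h').2
      · rintro ⟨rfl, rfl⟩
        exact htD hiD
  -- The lower right frontier of the diagonal is crossed only at `i`, whereas the vertices (0, 0)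
  -- and (k, k) at its ends both belong to squares outside `D`.
  have key : ∀ n, 0 ≤ n → n ≤ k → w (n, n) = if i < n then 1 else 0 := by
    intro n hn
    induction n, hn using Int.leInduction with
    | base =>
      intro _
      rw [if_neg (by omega)]
      exact hzero _ hs.west _ (by rw [mem_vertices]; simp)
    | succ n hn ih =>
      intro hnk
      have h1 := ih (by omega)
      have h2 := hw.fst n n
      have h3 := hw.snd (n + 1) n
      rw [hanti, hcross n hn (by omega) _ (Or.inr rfl),
        if_neg (by rw [Prod.mk.injEq]; omega)] at h2
      rw [add_sub_cancel_right, hcross n hn (by omega) _ (Or.inl rfl)] at h3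
      simp only [true_and] at h3
      split_ifs at * <;> omega
  have h1 := key k hs.pos.le le_rfl
  rw [if_pos hik] at h1
  have h2 : w (k, k) = 0 := by
    by_contra hne
    refine hs.last ⟨?_, ?_, ?_⟩ <;>
    · by_contra hz
      exact hne (hzero _ hz _ (by rw [mem_vertices]; simp))
  omega

theorem cover (hD : IsSimple D) (hs : IsStdDiagonal D k) {c : ℤ × ℤ}
    (hc : c ∈ (D : Set (ℤ × ℤ)) \ diagSet k) : c ∈ rightPart D k ∨ c ∈ leftPart D k := by
  have h0 : ((0, 0) : ℤ × ℤ) ∈ diagSet k := ⟨rfl, le_rfl, hs.pos⟩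
  obtain ⟨x, ⟨n, n'⟩, hx, hxR, hyD, hyR, hxy⟩ := (hD.conn c hc.1 (0, 0)
    (hs.diagSet_subset h0)).first_exit (R := (diagSet k)ᶜ) hc.2 fun h => h h0
  rw [← Set.sdiff_eq] at hx
  rw [Set.notMem_compl_iff, mem_diagSet] at hyR
  obtain ⟨rfl, hn0, hnk⟩ := hyR
  have hxP := hx.mem hc
  obtain ⟨u, v⟩ := x
  rw [shareSide_iff] at hxy
  have hxD : (u, v) ∈ D := hxP.1
  have hflank : (u, v) ∈ rightPart D k ∨ (u, v) ∈ leftPart D k := by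
    simp only at hxy
    rcases hxy with ⟨rfl, rfl⟩ | ⟨h, rfl⟩ | ⟨rfl, rfl⟩ | ⟨rfl, h⟩
    · by_cases hu : u = -1
      · subst hu; exact absurd hxD hs.west
      · right; exact left_flank_mem (by omega) (by omega) hxD
    · left
      obtain rfl : u = n + 1 := by omega
      exact right_flank_mem hn0 hnk hxD
    · by_cases hv : v = -1
      · subst hv; exact absurd hxD hs.south
      · left; exact right_flank_mem (by omega) (by omega) hxD
    · right
      obtain rfl : v = n + 1 := by omega
      exact left_flank_mem hn0 hnk hxD
  exact hflank.imp (fun h => rightPart_of_reach h (hx.symm hc))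
    fun h => leftPart_of_reach h (hx.symm hc)

/-- The diagonal is connected through its left flanks, and a walk from any other remaining square to
the diagonal cannot meet the right part before arriving. -/
theorem isConn_sdiff_rightPart (hD : IsSimple D) (hs : IsStdDiagonal D k) :
    IsConn ((D : Set (ℤ × ℤ)) \ rightPart D k) := by
  set Z := (D : Set (ℤ × ℤ)) \ rightPart D k with hZ
  have hSZ : diagSet k ⊆ Z := fun c hc => ⟨hs.diagSet_subset hc, fun h => (rightPart_subset h).2 hc⟩
  have h0 : ((0, 0) : ℤ × ℤ) ∈ diagSet k := ⟨rfl, le_rfl, hs.pos⟩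
  refine isConn_of_reach (0, 0) (hSZ h0) fun b hb => Reach.symm ?_ hb
  have hdiag : ∀ n, (n, n) ∈ diagSet k → Reach Z (n, n) (0, 0) := fun n hn =>
    reach_diag hSZ (fun i h0 h1 => ⟨hs.left i h0 h1, fun h => hs.disjoint hD h
      (left_flank_mem h0 (by omega) (hs.left i h0 h1))⟩) hn.2.1 hn.2.2 le_rfl hs.pos
  by_cases hbS : b ∈ diagSet k
  · obtain ⟨n, n'⟩ := b
    obtain ⟨rfl, -⟩ := mem_diagSet.1 hbS
    exact hdiag n hbS
  obtain ⟨x, ⟨n, n'⟩, hx, hxR, hyD, hyR, hxy⟩ := (hD.conn b hb.1 (0, 0)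
    (hs.diagSet_subset h0)).first_exit (R := (diagSet k)ᶜ) hbS fun h => h h0
  rw [← Set.sdiff_eq] at hx
  rw [Set.notMem_compl_iff] at hyR
  obtain ⟨rfl, -⟩ := mem_diagSet.1 hyR
  have hbx : Reach Z b x := by
    have := hx.restrict (R := (D : Set (ℤ × ℤ)) \ diagSet k ∩ (rightPart D k)ᶜ)
      ⟨⟨hb.1, hbS⟩, hb.2⟩ fun p hp q hq hpq =>
        ⟨hq, fun hqT => hp.2 (rightPart_of_adj hqT hp.1.1 hp.1.2 hpq.symm)⟩
    exact this.mono fun q hq => ⟨hq.1.1, hq.2.2⟩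
  exact (hbx.tail (hSZ hyR) hxy).trans (hdiag n hyR)

end IsStdDiagonal

end Quad

namespace Quad

/-! ### Existence of an excellent diagonal -/

variable {D : Finset (ℤ × ℤ)} {k : ℤ}

/-- Rows and columns lead inside `D` from the squares to the right of the diagonal to the
diagonal. -/
def IsStaircase (D : Finset (ℤ × ℤ)) (k : ℤ) : Prop :=
  ∀ a b, (a, b) ∈ rightPart D k → 0 ≤ b ∧ b < a ∧ a < k ∧ (∀ x, b ≤ x → x ≤ a → (x, b) ∈ D) ∧
    ∀ y, b ≤ y → y ≤ a → (a, y) ∈ D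

theorem rightPart_of_west {x y : ℤ} (hxy : y < x)
    (hW : (x - 1, y) ∈ rightPart D k ∨ (x - 1, y) ∈ diagSet k) (hD : (x, y) ∈ D) :
    (x, y) ∈ rightPart D k := by
  have hS : (x, y) ∉ diagSet k := fun h => by rw [mem_diagSet] at h; omega
  rcases hW with hW | hW
  · exact rightPart_of_adj hW hD hS (by rw [shareSide_iff]; simp)
  · rw [mem_diagSet] at hW
    obtain rfl : x = y + 1 := by omega
    exact right_flank_mem (by omega) (by omega) hD

namespace IsStaircase

/-- If `(x + 1, y - 1)` were in `D`, so would be `(x + 1, y)`, both would lie on the right, and the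
row of the former would lead to the diagonal through the missing square `(x, y - 1)`. -/
theorem horizontal_step (hs : IsSimple D) (hT : IsStaircase D k) {x y : ℤ} (hxy : y < x)
    (hW : (x - 1, y) ∈ rightPart D k ∨ (x - 1, y) ∈ diagSet k) (hE : (x, y - 1) ∉ D)
    (hD : (x, y) ∈ D) : (x, y) ∈ rightPart D k ∧ (x + 1, y - 1) ∉ D := by
  have h1 := rightPart_of_west hxy hW hD
  refine ⟨h1, fun h2 => ?_⟩
  have h3 : (x + 1, y) ∈ D := by
    have := (hs.no_pinch x (y - 1)).2 h2
    rw [sub_add_cancel] at this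
    exact (this hD).resolve_left hE
  have h4 := rightPart_of_west (k := k) (x := x + 1) (y := y) (by omega)
    (by rw [add_sub_cancel_right]; exact Or.inl h1) h3
  have h5 := rightPart_of_adj h4 h2 (fun h => by rw [mem_diagSet] at h; omega)
    (by rw [shareSide_iff]; simp)
  exact hE ((hT _ _ h5).2.2.2.1 x (by omega) (by omega))

/-- The square to the west keeps the path attached to the right part or the diagonal; its column
continues upwards to the diagonal, which is met by the path only at the final vertex. -/
theorem vertical_step (hd : IsStdDiagonal D k) (hT : IsStaircase D k) {x y : ℤ} (hxy : y < x)
    (hW : (x - 1, y) ∈ rightPart D k ∨ (x - 1, y) ∈ diagSet k) (hD : (x, y) ∉ D) :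
    (x - 1, y) ∈ D ∧ (x = y + 1 → x = k) ∧
      (x ≠ y + 1 → (x - 1, y + 1) ∈ rightPart D k ∨ (x - 1, y + 1) ∈ diagSet k) := by
  refine ⟨hW.elim (fun h => (rightPart_subset h).1) fun h => hd.diagSet_subset h, ?_, ?_⟩
  · rintro rfl
    have h1 : (y + 1 - 1, y) ∈ diagSet k := by
      refine hW.resolve_left fun h => ?_
      have := (hT _ _ h).2.1
      omega
    rw [mem_diagSet] at h1
    by_contra h2
    exact hD (hd.right y (by omega) (by omega))
  · intro hne
    have h1 : (x - 1, y) ∈ rightPart D k := hW.resolve_right fun h => by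
      rw [mem_diagSet] at h; omega
    obtain ⟨h2, h3, h4, -, h5⟩ := hT _ _ h1
    by_cases h6 : y + 1 = x - 1
    · right; rw [mem_diagSet]; omega
    · left
      exact rightPart_of_adj h1 (h5 _ (by omega) (by omega))
        (fun h => by rw [mem_diagSet] at h; omega) (by rw [shareSide_iff]; simp)

/-- The abscissae of the vertices of the path that starts at the origin and has `D` on its left. -/
def path (D : Finset (ℤ × ℤ)) : ℕ → ℤ
  | 0 => 0
  | j + 1 => path D j + if (path D j, j - path D j) ∈ D then 1 else 0

theorem path_succ (D : Finset (ℤ × ℤ)) (j : ℕ) : path D (j + 1) =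
    path D j + if (path D j, j - path D j) ∈ D then 1 else 0 := rfl

theorem path_invariant (hs : IsSimple D) (hd : IsStdDiagonal D k) (hT : IsStaircase D k) (j : ℕ)
    (h0 : 0 < j) (hj : (j : ℤ) < 2 * k) : j - path D j < path D j ∧
      ((path D j - 1, j - path D j) ∈ rightPart D k ∨ (path D j - 1, j - path D j) ∈ diagSet k) ∧
      (path D j, j - path D j - 1) ∉ D := by
  induction j, (show 1 ≤ j from h0) using Nat.le_induction with
  | base =>
    have h1 : path D 1 = 1 := by
      rw [path_succ]
      simp [path, hd.diag 0 le_rfl hd.pos]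
    rw [h1]
    have hS : ((1 - 1, ((1 : ℕ) : ℤ) - 1) : ℤ × ℤ) ∈ diagSet k := by
      have := hd.pos
      rw [mem_diagSet]; omega
    refine ⟨by norm_num, Or.inr hS, fun h => ?_⟩
    norm_num at h
    have h2 := (hs.no_pinch 0 (-1)).2 (by simpa using h)
    norm_num at h2
    have h3 := (h2 (hd.diag 0 le_rfl hd.pos)).resolve_left hd.south
    have h4 := right_flank_mem (i := 0) le_rfl hd.pos (by simpa using h3)
    have h5 := rightPart_of_adj h4 h (fun h => by rw [mem_diagSet] at h; omega)
      (by rw [shareSide_iff]; simp)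
    have := (hT _ _ h5).1
    omega
  | succ j hj1 ih =>
    push_cast at hj ⊢
    obtain ⟨i1, i2, i3⟩ := ih (by omega) (by omega)
    rw [path_succ]
    by_cases hx : (path D j, j - path D j) ∈ D
    · rw [if_pos hx]
      obtain ⟨e1, e2⟩ := hT.horizontal_step hs i1 i2 i3 hx
      rw [show (j : ℤ) + 1 - (path D j + 1) = j - path D j by ring, add_sub_cancel_right]
      exact ⟨by omega, Or.inl e1, e2⟩
    · rw [if_neg hx]
      obtain ⟨e1, e2, e3⟩ := hT.vertical_step hd i1 i2 hx
      rw [add_zero, show (j : ℤ) + 1 - path D j = j - path D j + 1 by ring, add_sub_cancel_right]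
      have e4 : path D j ≠ j - path D j + 1 := fun h => by
        have := e2 h
        omega
      exact ⟨by omega, e3 e4, hx⟩

theorem exists_isStair (hs : IsSimple D) (hd : IsStdDiagonal D k) (hT : IsStaircase D k) :
    ∃ X, IsStair D k X := by
  have hk := hd.pos
  refine ⟨fun j => path D j.toNat, rfl, fun j h0 hj => ?_, ?_⟩
  · obtain ⟨n, rfl⟩ := Int.eq_ofNat_of_zero_le h0
    have e : ((n : ℤ) + 1).toNat = n + 1 := by omega
    simp only [e, Int.toNat_natCast]
    rw [path_succ]
    by_cases hn : n = 0
    · subst hn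
      left
      simp only [path, Nat.cast_zero, sub_zero]
      have := hd.diag 0 le_rfl hk
      exact ⟨by simp [this], this, hd.south⟩
    · obtain ⟨i1, i2, i3⟩ := path_invariant hs hd hT n (by omega) hj
      by_cases hx : (path D n, n - path D n) ∈ D
      · left; exact ⟨by rw [if_pos hx], hx, i3⟩
      · right; exact ⟨by rw [if_neg hx, add_zero], hx, (hT.vertical_step hd i1 i2 hx).1⟩
  · obtain ⟨n, hn⟩ := Int.eq_ofNat_of_zero_le (show 0 ≤ 2 * k - 1 by omega)
    have e : (2 * k).toNat = n + 1 := by omega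
    simp only [e]
    obtain ⟨i1, i2, i3⟩ := path_invariant hs hd hT n (by omega) (by omega)
    -- One step before the end the path is below the diagonal, so its abscissa is at least k, and
    -- the square to its west bounds it by k.
    have hle : path D n ≤ k := by
      rcases i2 with h | h
      · have := (hT _ _ h).2.2.1; omega
      · rw [mem_diagSet] at h; omega
    have hpn : path D n = k := by omega
    rw [path_succ, if_neg, add_zero, hpn]
    intro h
    have := (hT _ _ (rightPart_of_west i1 i2 h)).2.2.1
    omega

end IsStaircase

/-! ### Descent -/

/-- Every square outside the diagonal from which the diagonal can be reached along a row lies on the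
expected side. -/
theorem IsStdDiagonal.isStaircase (hs : IsSimple D) (hd : IsStdDiagonal D k)
    (hrow : ∀ a b, (a, b) ∈ rightPart D k →
      ∃ x, (∀ i, min a x ≤ i → i ≤ max a x → (i, b) ∈ D) ∧ (x, b) ∉ rightPart D k)
    (hcol : ∀ a b, (a, b) ∈ rightPart D k →
      ∃ y, (∀ i, min b y ≤ i → i ≤ max b y → (a, i) ∈ D) ∧ (a, y) ∉ rightPart D k) :
    IsStaircase D k := by
  intro a b hab
  have habD := rightPart_subset hab
  -- A row can leave the right part inside `D` only through the diagonal, whose square in row `b` is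
  -- `(b, b)`.
  have hr : 0 ≤ b ∧ b < k ∧ ∀ i, min a b ≤ i → i ≤ max a b → (i, b) ∈ D := by
    obtain ⟨x, hx, hxT⟩ := hrow a b hab
    by_contra hcon
    refine hxT (rightPart_of_reach hab (reach_row_of_between fun i h1 h2 => ⟨hx i h1 h2, fun h => ?_⟩))
    obtain ⟨rfl, h3, h4⟩ := mem_diagSet.1 h
    exact hcon ⟨h3, h4, fun i' h5 h6 => hx i' (by omega) (by omega)⟩
  have hc : 0 ≤ a ∧ a < k ∧ ∀ i, min b a ≤ i → i ≤ max b a → (a, i) ∈ D := by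
    obtain ⟨y, hy, hyT⟩ := hcol a b hab
    by_contra hcon
    refine hyT (rightPart_of_reach hab (reach_col_of_between fun i h1 h2 => ⟨hy i h1 h2, fun h => ?_⟩))
    obtain ⟨rfl, h3, h4⟩ := mem_diagSet.1 h
    exact hcon ⟨h3, h4, fun i' h5 h6 => hy i' (by omega) (by omega)⟩
  have hne : a ≠ b := by
    rintro rfl
    exact habD.2 ⟨rfl, hr.1, hr.2.1⟩
  -- A square reaching the diagonal from above would be joined along its row to a left flank.
  have hlt : b < a := by
    by_contra hlt
    have hlt : a < b := by omega
    have hb := hr.2.2 (b - 1) (by omega) (by omega)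
    have hfl : (b - 1, b - 1 + 1) ∈ leftPart D k := left_flank_mem (by omega) (by omega)
      (by rwa [sub_add_cancel])
    rw [sub_add_cancel] at hfl
    refine hd.disjoint hs hab (leftPart_of_reach hfl (reach_row_of_between fun i h1 h2 =>
      ⟨hr.2.2 i (by omega) (by omega), fun h => ?_⟩))
    rw [mem_diagSet] at h
    omega
  exact ⟨hr.1, hlt, hc.2.1, fun x h1 h2 => hr.2.2 x (by omega) (by omega),
    fun y h1 h2 => hc.2.2 y (by omega) (by omega)⟩

/-- The diagonal is prolonged until its end is not interior; two missing neighbours make the origin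
a corner, since the opposite square would create a pinched vertex. -/
theorem exists_isStdDiagonal (hs : IsSimple D) (h0 : ((0, 0) : ℤ × ℤ) ∈ D)
    (hw : ((-1, 0) : ℤ × ℤ) ∉ D) (hso : ((0, -1) : ℤ × ℤ) ∉ D) : ∃ k, IsStdDiagonal D k := by
  classical
  obtain ⟨B, hB0, hB⟩ := exists_box D.finite_toSet
  have hex : ∃ n : ℕ, ¬ (((n : ℤ) + 1, (n : ℤ) + 1) ∈ D ∧ ((n : ℤ), (n : ℤ) + 1) ∈ D ∧
      ((n : ℤ) + 1, (n : ℤ)) ∈ D) := by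
    refine ⟨B.toNat, fun h => ?_⟩
    have := hB _ h.1
    simp only at this
    omega
  have hmin : ∀ i : ℤ, 0 ≤ i → i < Nat.find hex →
      (i + 1, i + 1) ∈ D ∧ (i, i + 1) ∈ D ∧ (i + 1, i) ∈ D := by
    intro i h0 hi
    obtain ⟨n, rfl⟩ := Int.eq_ofNat_of_zero_le h0
    have := Nat.find_min hex (m := n) (by omega)
    rwa [not_not] at this
  refine ⟨Nat.find hex + 1, by omega, fun i hi0 hi => ?_, fun i hi0 hi => ?_, fun i hi0 hi => ?_, hw,
    hso, fun h => ?_, ?_⟩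
  · by_cases hi' : i = 0
    · rw [hi']; exact h0
    · have := (hmin (i - 1) (by omega) (by omega)).1
      rwa [sub_add_cancel] at this
  · exact (hmin i hi0 (by omega)).2.2
  · exact (hmin i hi0 (by omega)).2.1
  · have := (hs.no_pinch (-1) (-1)).1 h
    norm_num at this
    exact (this h0).elim hso hw
  · have := Nat.find_spec hex
    rwa [add_sub_cancel_right]

/-- The translation or the point reflection that takes the square `c` to the origin. -/
theorem exists_latticeIso (c : ℤ × ℤ) {ε : ℤ} (hε : ε = 1 ∨ ε = -1) :
    ∃ g : LatticeIso, ∀ y, g.cell.symm y = (c.1 + ε * y.1, c.2 + ε * y.2) := by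
  rcases hε with rfl | rfl
  · refine ⟨LatticeIso.translation (-c), fun y => ?_⟩
    rw [Equiv.symm_apply_eq]
    change y = (c.1 + 1 * y.1, c.2 + 1 * y.2) + -c
    ext <;> simp
  · refine ⟨(((LatticeIso.translation (-c)).trans LatticeIso.reflect).trans
      (LatticeIso.swap.trans (LatticeIso.reflect.trans LatticeIso.swap))).trans
      (LatticeIso.translation (1, 1)), fun y => ?_⟩
    rw [Equiv.symm_apply_eq]
    change y = (-(c.1 + -1 * y.1 + -c.1) - 1, -(c.2 + -1 * y.2 + -c.2) - 1) + (1, 1)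
    ext <;> simp

/-- If some row or column from the right part never returns to the connected remainder of `D`, the
search for acute corners away from that remainder succeeds. -/
theorem exists_isAcuteCorner_or_isStaircase (hs : IsSimple D) (hd : IsStdDiagonal D k) :
    IsStaircase D k ∨ ∃ c ∈ rightPart D k, IsAcuteCorner D c := by
  by_contra hcon
  push Not at hcon
  obtain ⟨hst, hcor⟩ := hcon
  have hconn := hd.isConn_sdiff_rightPart hs
  have h0 : ((0, 0) : ℤ × ℤ) ∈ diagSet k := ⟨rfl, le_rfl, hd.pos⟩
  have h0Z : ((0, 0) : ℤ × ℤ) ∈ (D : Set (ℤ × ℤ)) \ rightPart D k :=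
    ⟨hd.diagSet_subset h0, fun h => (rightPart_subset h).2 h0⟩
  refine hst (hd.isStaircase hs (fun a b hab => ?_) fun a b hab => ?_)
  · by_contra hno
    push Not at hno
    obtain ⟨c, hc, hcZ, hcc⟩ := exists_isAcuteCorner_of_row hs Set.sdiff_subset hconn h0Z
      (rightPart_subset hab).1 fun x hx hxZ => hxZ.2 (hno x hx)
    exact hcor c (by_contra fun h => hcZ ⟨hc, h⟩) hcc
  · by_contra hno
    push Not at hno
    obtain ⟨c, hc, hcZ, hcc⟩ := exists_isAcuteCorner_of_column hs Set.sdiff_subset hconn h0Z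
      (rightPart_subset hab).1 fun x hx hxZ => hxZ.2 (hno x hx)
    exact hcor c (by_contra fun h => hcZ ⟨hc, h⟩) hcc

end Quad

/-! ### The induction that yields an excellent diagonal -/

namespace Quad

theorem swap_mem_app {D : Finset (ℤ × ℤ)} {x y : ℤ} :
    (x, y) ∈ LatticeIso.swap.app D ↔ (y, x) ∈ D :=
  LatticeIso.cell_mem_app (g := LatticeIso.swap) (c := (y, x))

theorem IsStdDiagonal.swap {D : Finset (ℤ × ℤ)} {k : ℤ} (h : IsStdDiagonal D k) :
    IsStdDiagonal (LatticeIso.swap.app D) k where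
  pos := h.pos
  diag i h0 h1 := swap_mem_app.2 (h.diag i h0 h1)
  right i h0 h1 := swap_mem_app.2 (h.left i h0 h1)
  left i h0 h1 := swap_mem_app.2 (h.right i h0 h1)
  west h' := h.south (swap_mem_app.1 h')
  south h' := h.west (swap_mem_app.1 h')
  southwest h' := h.southwest (swap_mem_app.1 h')
  last h' := h.last ⟨swap_mem_app.1 h'.1, swap_mem_app.1 h'.2.2, swap_mem_app.1 h'.2.1⟩

theorem rightPart_swap_subset (D : Finset (ℤ × ℤ)) (k : ℤ) :
    rightPart (LatticeIso.swap.app D) k ⊆ LatticeIso.swap.cell '' leftPart D k := by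
  rintro c ⟨i, h0, h1, h2, h3⟩
  refine ⟨LatticeIso.swap.cell c, ⟨i, h0, h1, swap_mem_app.1 h2, ?_⟩, rfl⟩
  refine h3.map_cell LatticeIso.swap ?_
  rintro ⟨x, y⟩ hd
  refine ⟨swap_mem_app.1 hd.1, fun h => hd.2 ?_⟩
  obtain ⟨h4, h5, h6⟩ := mem_diagSet.1 h
  exact ⟨h4.symm, by rwa [← h4], by rwa [← h4]⟩

/-- The diagonal that starts at an acute corner on the right of a given diagonal stays on the
right. -/
theorem IsStdDiagonal.subset_rightPart {D D' : Finset (ℤ × ℤ)} {k k' : ℤ} (hd : IsStdDiagonal D k)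
    {c : ℤ × ℤ} {ε : ℤ} (hε : ε = 1 ∨ ε = -1)
    (hD' : ∀ y, y ∈ D' ↔ (c.1 + ε * y.1, c.2 + ε * y.2) ∈ D) (hd' : IsStdDiagonal D' k')
    (hc : c ∈ rightPart D k) {i : ℤ} (h0 : 0 ≤ i) (hi : i < k') :
    (c.1 + ε * i, c.2 + ε * i) ∈ rightPart D k := by
  obtain ⟨a, b⟩ := c
  induction i, h0 using Int.leInduction with
  | base => simpa using hc
  | succ i h0 ih =>
    have ih := ih (by omega)
    have e1 := (hD' _).1 (hd'.right i h0 (by omega))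
    have e2 := (hD' _).1 (hd'.left i h0 (by omega))
    have e3 := (hD' _).1 (hd'.diag (i + 1) (by omega) hi)
    simp only at ih e1 e2 e3 ⊢
    have hmid : ∃ x, x ∈ rightPart D k ∧ ShareSide x (a + ε * (i + 1), b + ε * (i + 1)) := by
      have hne : (a + ε * (i + 1), b + ε * i) ∉ diagSet k ∨
          (a + ε * i, b + ε * (i + 1)) ∉ diagSet k := by
        by_contra hcon
        push Not at hcon
        have h1 := (mem_diagSet.1 hcon.1).1
        have h2 := (mem_diagSet.1 hcon.2).1
        rcases hε with rfl | rfl <;> omega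
      rcases hne with h | h
      · refine ⟨_, rightPart_of_adj ih e1 h ?_, ?_⟩ <;> rw [shareSide_iff] <;>
          rcases hε with rfl | rfl <;> simp <;> omega
      · refine ⟨_, rightPart_of_adj ih e2 h ?_, ?_⟩ <;> rw [shareSide_iff] <;>
          rcases hε with rfl | rfl <;> simp <;> omega
    obtain ⟨x, hx, hxs⟩ := hmid
    -- Parallel diagonals moving by `(ε, ε)` could meet only if the new one came from beyond an end
    -- of the old one, at `(-1, -1)` or `(k, k)`; both are excluded.
    refine rightPart_of_adj hx e3 (fun h => ?_) hxs
    have h4 := (rightPart_subset ih).2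
    have h5 := (rightPart_subset ih).1
    rw [Finset.mem_coe] at h5
    rw [mem_diagSet] at h h4
    rcases hε with rfl | rfl
    · refine hd.southwest ?_
      rwa [show a + 1 * i = -1 by omega, show b + 1 * i = -1 by omega] at h5
    · have ha : a + -1 * i = k := by omega
      have hb : b + -1 * i = k := by omega
      have ha' : a + -1 * (i + 1) = k - 1 := by omega
      have hb' : b + -1 * (i + 1) = k - 1 := by omega
      rw [ha, hb] at h5
      rw [ha', hb] at e1
      rw [ha, hb'] at e2
      exact hd.last ⟨h5, e1, e2⟩

theorem rightPart_finite (D : Finset (ℤ × ℤ)) (k : ℤ) : (rightPart D k).Finite :=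
  D.finite_toSet.subset fun _ h => (rightPart_subset h).1

/-- Descent on the size of the right part. The diagonal from an acute corner `c` stays in the old
right part, whose complement is connected and hence lies on one side of it. The other side is
smaller, since it misses `c`; a swap makes it the right side if necessary. -/
theorem exists_isExcellent_of_isStdDiagonal {D : Finset (ℤ × ℤ)} {k : ℤ} (hs : IsSimple D)
    (hd : IsStdDiagonal D k) : ∃ δ : Diagonal D, δ.IsExcellent := by
  induction hn : (rightPart D k).ncard using Nat.strong_induction_on generalizing D k with
  | _ n ih =>
  subst hn
  rcases exists_isAcuteCorner_or_isStaircase hs hd with hst | ⟨c, hc, hcc⟩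
  · obtain ⟨X, hX⟩ := hst.exists_isStair hs hd
    exact hX.exists_isExcellent hd
  obtain ⟨ε, hε, hw, hso⟩ : ∃ ε : ℤ, (ε = 1 ∨ ε = -1) ∧ (c.1 - ε, c.2) ∉ D ∧ (c.1, c.2 - ε) ∉ D := by
    rcases hcc with h | h
    · exact ⟨1, Or.inl rfl, h.1, h.2⟩
    · exact ⟨-1, Or.inr rfl, by simpa using h.1, by simpa using h.2⟩
  obtain ⟨g, hg⟩ := exists_latticeIso c hε
  have hD' : ∀ y, y ∈ g.app D ↔ (c.1 + ε * y.1, c.2 + ε * y.2) ∈ D := fun y => by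
    rw [LatticeIso.mem_app, hg]
  have hs' := hs.app g
  obtain ⟨k', hd'⟩ := exists_isStdDiagonal hs' ((hD' _).2 (by simpa using (rightPart_subset hc).1))
    (fun h => hw (by simpa [sub_eq_add_neg] using (hD' _).1 h))
    (fun h => hso (by simpa [sub_eq_add_neg] using (hD' _).1 h))
  have hdiag : ∀ y ∈ diagSet k', g.cell.symm y ∈ rightPart D k := by
    rintro ⟨y, y'⟩ hy
    obtain ⟨rfl, h0, h1⟩ := mem_diagSet.1 hy
    rw [hg]
    exact hd.subset_rightPart hε hD' hd' hc h0 h1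
  set Z := g.cell '' ((D : Set (ℤ × ℤ)) \ rightPart D k) with hZ
  have hZconn : IsConn Z := (hd.isConn_sdiff_rightPart hs).image_cell g
  have hZD : Z ⊆ (g.app D : Set (ℤ × ℤ)) \ diagSet k' := by
    rintro _ ⟨z, hz, rfl⟩
    refine ⟨LatticeIso.cell_mem_app.2 hz.1, fun h => hz.2 ?_⟩
    simpa using hdiag _ h
  have h0 : ((0, 0) : ℤ × ℤ) ∈ diagSet k := ⟨rfl, le_rfl, hd.pos⟩
  have hz₀ : g.cell (0, 0) ∈ Z :=
    ⟨_, ⟨hd.diagSet_subset h0, fun h => (rightPart_subset h).2 h0⟩, rfl⟩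
  -- A set avoiding `Z` comes from the old right part; the strict inequality is due to `c`, which
  -- lies on the new diagonal.
  have hcard : ∀ P : Set (ℤ × ℤ), P ⊆ (g.app D : Set (ℤ × ℤ)) \ diagSet k' → (∀ z ∈ Z, z ∉ P) →
      P.ncard < (rightPart D k).ncard := by
    intro P hP hPZ
    rw [← Set.ncard_image_of_injective P g.cell.symm.injective]
    refine Set.ncard_lt_ncard ⟨?_, fun h => ?_⟩ (rightPart_finite D k)
    · rintro _ ⟨y, hy, rfl⟩
      by_contra hcon
      exact hPZ y ⟨_, ⟨LatticeIso.mem_app.1 (hP hy).1, hcon⟩, by simp⟩ hy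
    · obtain ⟨y, hy, hyc⟩ := h hc
      have : y = (0, 0) := by
        rw [hg, Prod.ext_iff] at hyc
        ext <;> rcases hε with rfl | rfl <;> simp only at hyc ⊢ <;> omega
      exact (hP hy).2 (this ▸ ⟨rfl, le_rfl, hd'.pos⟩)
  rcases hd'.cover hs' (hZD hz₀) with hr | hl
  · have hZr : ∀ z ∈ Z, z ∈ rightPart (g.app D) k' := fun z hz =>
      rightPart_of_reach hr ((hZconn _ hz₀ z hz).mono hZD)
    have hlt := hcard (leftPart (g.app D) k') (fun y hy => leftPart_subset hy)
      fun z hz hzl => hd'.disjoint hs' (hZr z hz) hzl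
    have hle : (rightPart (LatticeIso.swap.app (g.app D)) k').ncard ≤
        (leftPart (g.app D) k').ncard := by
      refine (Set.ncard_le_ncard (rightPart_swap_subset _ _) (Set.Finite.image _ ?_)).trans_eq
        (Set.ncard_image_of_injective _ LatticeIso.swap.cell.injective)
      exact (g.app D).finite_toSet.subset fun _ h => (leftPart_subset h).1
    exact Diagonal.exists_isExcellent_of_app g (Diagonal.exists_isExcellent_of_app LatticeIso.swap
      (ih _ (hle.trans_lt hlt) (hs'.app _) hd'.swap rfl))
  · have hZl : ∀ z ∈ Z, z ∈ leftPart (g.app D) k' := fun z hz =>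
      leftPart_of_reach hl ((hZconn _ hz₀ z hz).mono hZD)
    have hlt := hcard (rightPart (g.app D) k') (fun y hy => rightPart_subset hy)
      fun z hz hzr => hd'.disjoint hs' hzr (hZl z hz)
    exact Diagonal.exists_isExcellent_of_app g (ih _ hlt hs' hd' rfl)

/-- The lexicographically least square has nothing to its left or below, so a diagonal starts there
and the descent can begin. -/
theorem exists_isExcellent {D : Finset (ℤ × ℤ)} (hD : IsBoard D) :
    ∃ δ : Diagonal D, δ.IsExcellent := by
  have hs := hD.isSimple
  obtain ⟨c, hc, hmin⟩ := Finset.exists_min_image D (fun c => toLex c) hs.nonempty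
  have hlt : ∀ d, toLex d < toLex c → d ∉ D := fun d hd hdD => (hmin d hdD).not_gt hd
  have hw : (c.1 - 1, c.2) ∉ D := hlt _ (Prod.Lex.toLex_lt_toLex.2 (Or.inl (by simp)))
  have hso : (c.1, c.2 - 1) ∉ D := hlt _ (Prod.Lex.toLex_lt_toLex.2 (Or.inr ⟨rfl, by simp⟩))
  obtain ⟨g, hg⟩ := exists_latticeIso c (Or.inl rfl)
  have hD' : ∀ y, y ∈ g.app D ↔ (c.1 + 1 * y.1, c.2 + 1 * y.2) ∈ D := fun y => by
    rw [LatticeIso.mem_app, hg]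
  obtain ⟨k, hd⟩ := exists_isStdDiagonal (hs.app g) ((hD' _).2 (by simpa using hc))
    (fun h => hw (by simpa [sub_eq_add_neg] using (hD' _).1 h))
    (fun h => hso (by simpa [sub_eq_add_neg] using (hD' _).1 h))
  exact Diagonal.exists_isExcellent_of_app g (exists_isExcellent_of_isStdDiagonal (hs.app g) hd)

end Quad

/-- Every board has an excellent diagonal, and cut and paste along any excellent diagonal, moving
the part on the side of a monotonic boundary arc, is defined, can be carried out in the plane, and
gives a disjoint union of boards. -/
theorem theorem9 (Δ : Finset (ℤ × ℤ)) (hΔ : Quad.IsBoard Δ) :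
    (∃ δ : Quad.Diagonal Δ, δ.IsExcellent) ∧
      ∀ (δ : Quad.Diagonal Δ) (σ : Quad.Side), δ.IsExcellentOn σ →
        δ.CanCutPaste σ ∧ δ.GluesInPlane σ ∧ Quad.IsUnionOfBoards (δ.cutPaste σ) := by
  exact ⟨Quad.exists_isExcellent hΔ, fun δ σ h => Quad.Diagonal.IsExcellentOn.cutPasteWorks hΔ h⟩
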